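/- Let $(M,I,J,K)$ be a hypercomplex manifold of real dimension $4n$: a smooth manifold with complex structures $I,J,K$, acting on the right on $TM$, such that $IJ=-JI=K$. Let $g$ be a quaternionic Hermitian metric, i.e. a smooth Riemannian metric invariant under the group $SU(2)$ of unit quaternions. Put $$\omega_I(X,Y)=g(X,Y\circ I),\qquad \Omega(X,Y)=-\bigl(g(X,Y\circ J)-\sqrt{-1}\,g(X,Y\circ K)\bigr).$$ Let $\partial,\bar\partial$ be the Dolbeault operators of the complex manifold $(M,I)$, where a complex covector $\lambda$ is of type $(1,0)$ if $\lambda(X\circ I)=\sqrt{-1}\,\lambda(X)$. On functions let $\partial_J=J^{-1}\circ\bar\partial$, where $(J^{-1}\lambda)(X)=\lambda(X\circ J^{-1})$. The group $SU(2)$ acts on $T_xM$ on the right, hence on $\Lambda^p(M)=\Lambda^pT^*M\otimes\mathbb C$ on the left, multiplicatively. Let $\Lambda^p_+(M)\subset\Lambda^p(M)$ be the maximal subspace on which $SU(2)$ acts with weight $p$ (the sum of all irreducible subrepresentations of dimension $p+1$), let $V^p$ be the sum of all irreducible subrepresentations of weight less than $p$, and let $P_+:\Lambda^p(M)\to\Lambda^p_+(M)$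 be the projection along $V^p$ in the decomposition $\Lambda^p(M)=\Lambda^p_+(M)\oplus V^p$. Let $f,\phi$ be real-valued $C^\infty$ functions on $M$ and let $A$ be a real constant. Then the quaternionic Monge–Ampère equation $$(\Omega+\partial\partial_J\phi)^n=A\,e^f\,\Omega^n$$ is equivalent to the equation $$(\omega_I-\sqrt{-1}\,\partial\bar\partial\phi)^n\wedge P_+(\omega_I^n)=A\,e^f\,\omega_I^n\wedge P_+(\omega_I^n).$$ The equivalence holds at every point of $M$, and hence also for the two equations on all of $M$. -/

import Mathlib

open scoped Manifold ContDiff Quaternion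

noncomputable section

namespace Hypercomplex

/-! ### Multilinear algebra on one tangent space

`T` is a real vector space on which the quaternions act on the right, the action being given by
the three endomorphisms `I, J, K : X ↦ X∘I, X∘J, X∘K`. -/

section Pointwise

variable (T : Type*) [AddCommGroup T] [Module ℝ T]

/-- `Λ¹ ⊗ ℂ`: the complex-valued real-linear forms on `T`. -/
abbrev Covector := T →ₗ[ℝ] ℂ

/-- `Λ* ⊗ ℂ`: the algebra of complex-valued exterior forms on `T`; its multiplication is the
wedge product. -/
abbrev Forms := ExteriorAlgebra ℂ (Covector T)

variable {T}

/-- Pull-back of complex covectors by a real endomorphism: `(A λ)(X) = λ(A X)`. -/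
def pullCovector (A : T →ₗ[ℝ] T) : Covector T →ₗ[ℂ] Covector T where
  toFun l := l ∘ₗ A
  map_add' _ _ := rfl
  map_smul' _ _ := rfl

/-- The right action of a quaternion `h = a + bi + cj + dk`: `X∘h = aX + b X∘I + c X∘J + d X∘K`. -/
def rightAct (I J K : T →ₗ[ℝ] T) (h : ℍ[ℝ]) : T →ₗ[ℝ] T :=
  h.re • LinearMap.id + h.imI • I + h.imJ • J + h.imK • K

/-- The induced left action of quaternions on forms, extended multiplicatively from covectors. Its
restriction to the unit quaternions is the action of `SU(2)` on `Λ*`. -/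
def formAct (I J K : T →ₗ[ℝ] T) (h : ℍ[ℝ]) : Forms T →ₐ[ℂ] Forms T :=
  ExteriorAlgebra.map (pullCovector (rightAct I J K h))

/-- A complex subspace of the exterior algebra which is stable under `SU(2)`. -/
def IsSU2Stable (I J K : T →ₗ[ℝ] T) (U : Submodule ℂ (Forms T)) : Prop :=
  ∀ h : ℍ[ℝ], ‖h‖ = 1 → ∀ u ∈ U, formAct I J K h u ∈ U

/-- `U` is an irreducible `SU(2)`-subspace of weight `w`, that is, of dimension `w + 1` (up to
isomorphism `SU(2)` has exactly one irreducible representation of weight `w`, the `w`-th symmetric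
power of `ℂ²`, and it is the one of dimension `w + 1`). -/
structure IsIrreducibleOfWeight (I J K : T →ₗ[ℝ] T) (w : ℕ) (U : Submodule ℂ (Forms T)) :
    Prop where
  stable : IsSU2Stable I J K U
  ne_bot : U ≠ ⊥
  eq_bot_or_eq : ∀ W : Submodule ℂ (Forms T), W ≤ U → IsSU2Stable I J K W → W = ⊥ ∨ W = U
  finrank_eq : Module.finrank ℂ U = w + 1

/-- `Λ^p_+`: the maximal subspace of `Λ^p` on which `SU(2)` acts with weight `p`. -/
def plusForms (I J K : T →ₗ[ℝ] T) (p : ℕ) : Submodule ℂ (Forms T) :=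
  sSup {U | U ≤ ⋀[ℂ]^p (Covector T) ∧ IsIrreducibleOfWeight I J K p U}

/-- `V^p`: the sum of all `SU(2)`-subspaces of `Λ^p` of weight less than `p`. -/
def lowerForms (I J K : T →ₗ[ℝ] T) (p : ℕ) : Submodule ℂ (Forms T) :=
  sSup {U | U ≤ ⋀[ℂ]^p (Covector T) ∧ ∃ w < p, IsIrreducibleOfWeight I J K w U}

open Classical in
/-- The projection `P_+ : Λ^p → Λ^p_+` along `V^p` in the decomposition `Λ^p = Λ^p_+ ⊕ V^p`. -/
def plusProj (I J K : T →ₗ[ℝ] T) (p : ℕ) (ξ : Forms T) : Forms T :=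
  if h : ∃ η ∈ plusForms I J K p, ξ - η ∈ lowerForms I J K p then h.choose else 0

section TwoForms

variable [Module.Finite ℝ T]

/-- The covector `εᵢ` dual to the `i`-th vector of a fixed basis of `T`, with values in `ℂ`. -/
def dualVec (i : Fin (Module.finrank ℝ T)) : Covector T :=
  Algebra.linearMap ℝ ℂ ∘ₗ (Module.finBasis ℝ T).coord i

/-- The element of `Λ²` given by an alternating bilinear form `B`, namely
`½ ∑ᵢⱼ B(eᵢ, eⱼ) εᵢ ∧ εⱼ`. It does not depend on the basis, see `toForm_wedge`. -/
def toForm (B : T → T → ℂ) : Forms T :=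
  (1 / 2 : ℂ) • ∑ i, ∑ j, B (Module.finBasis ℝ T i) (Module.finBasis ℝ T j) •
    (ExteriorAlgebra.ι ℂ (dualVec i) * ExteriorAlgebra.ι ℂ (dualVec j))

theorem sum_dualVec (l : Covector T) :
    ∑ i, l (Module.finBasis ℝ T i) • dualVec i = l := by
  apply (Module.finBasis ℝ T).ext
  intro k
  simp [dualVec, LinearMap.sum_apply, Finsupp.single_apply]

/-- The bilinear form `(X, Y) ↦ λ(X) μ(Y) - λ(Y) μ(X)` corresponds to `λ ∧ μ`. -/
theorem toForm_wedge (l m : Covector T) :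
    toForm (fun X Y => l X * m Y - l Y * m X) =
      ExteriorAlgebra.ι ℂ l * ExteriorAlgebra.ι ℂ m := by
  have key : ∀ l m : Covector T,
      ∑ i, ∑ j, (l (Module.finBasis ℝ T i) * m (Module.finBasis ℝ T j)) •
        (ExteriorAlgebra.ι ℂ (dualVec i) * ExteriorAlgebra.ι ℂ (dualVec j)) =
      ExteriorAlgebra.ι ℂ l * ExteriorAlgebra.ι ℂ m := by
    intro l m
    conv_rhs => rw [← sum_dualVec l, ← sum_dualVec m]
    simp only [map_sum, map_smul, Finset.sum_mul_sum, smul_mul_smul_comm]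
  have hk := key m l
  have h1 : toForm (fun X Y => l X * m Y - l Y * m X) =
      (1 / 2 : ℂ) • (ExteriorAlgebra.ι ℂ l * ExteriorAlgebra.ι ℂ m -
        ExteriorAlgebra.ι ℂ m * ExteriorAlgebra.ι ℂ l) := by
    rw [← key l m, ← key m l]
    simp only [toForm, sub_smul, Finset.sum_sub_distrib, mul_comm]
  have h2 : ExteriorAlgebra.ι ℂ m * ExteriorAlgebra.ι ℂ l =
      - (ExteriorAlgebra.ι ℂ l * ExteriorAlgebra.ι ℂ m) := by
    rw [eq_neg_iff_add_eq_zero]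
    exact ExteriorAlgebra.ι_add_mul_swap m l
  rw [h1, h2, sub_neg_eq_add, ← two_smul ℂ, smul_smul]
  norm_num

end TwoForms

/-- The `(2,0)`-part of a complex-valued 2-form with respect to the complex structure `I`, for
which `λ` has type `(1,0)` when `λ(X∘I) = √-1 λ(X)`. -/
def part20 (I : T → T) (B : T → T → ℂ) (X Y : T) : ℂ :=
  (1 / 4 : ℂ) * (B X Y - Complex.I * B (I X) Y - Complex.I * B X (I Y) - B (I X) (I Y))

/-- The `(1,1)`-part of a complex-valued 2-form with respect to the complex structure `I`. -/
def part11 (I : T → T) (B : T → T → ℂ) (X Y : T) : ℂ :=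
  (1 / 2 : ℂ) * (B X Y + B (I X) (I Y))

end Pointwise

/-! ### Hypercomplex manifolds -/

section Manifold

variable {E : Type*} [NormedAddCommGroup E] [NormedSpace ℝ E] [FiniteDimensional ℝ E]
  {M : Type*} [TopologicalSpace M] [ChartedSpace E M]

instance (x : M) : Module.Finite ℝ (TangentSpace 𝓘(ℝ, E) x) :=
  inferInstanceAs (Module.Finite ℝ E)

variable (E M) in
/-- Fields of endomorphisms of the tangent spaces. -/
abbrev EndField := ∀ x : M, TangentSpace 𝓘(ℝ, E) x →L[ℝ] TangentSpace 𝓘(ℝ, E) x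

/-- The Nijenhuis tensor `N(X,Y) = [LX, LY] - L[LX, Y] - L[X, LY] - [X, Y]` of `L`. -/
def nijenhuis (L : EndField E M) (X Y : ∀ x : M, TangentSpace 𝓘(ℝ, E) x) (x : M) :
    TangentSpace 𝓘(ℝ, E) x :=
  VectorField.mlieBracket 𝓘(ℝ, E) (fun y => L y (X y)) (fun y => L y (Y y)) x
    - L x (VectorField.mlieBracket 𝓘(ℝ, E) (fun y => L y (X y)) Y x)
    - L x (VectorField.mlieBracket 𝓘(ℝ, E) X (fun y => L y (Y y)) x)
    - VectorField.mlieBracket 𝓘(ℝ, E) X Y x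

variable [IsManifold 𝓘(ℝ, E) ∞ M]

/-- `L` is a complex structure on `M`: a smooth field of endomorphisms with `L² = -1` which is
integrable, that is, whose Nijenhuis tensor vanishes. -/
structure IsComplexStructure (L : EndField E M) : Prop where
  smooth : ContMDiff 𝓘(ℝ, E) (𝓘(ℝ, E).prod 𝓘(ℝ, E →L[ℝ] E)) ∞
    (fun x => Bundle.TotalSpace.mk' (E →L[ℝ] E)
      (E := fun x : M => TangentSpace 𝓘(ℝ, E) x →L[ℝ] TangentSpace 𝓘(ℝ, E) x) x (L x))
  sq : ∀ (x : M) (X : TangentSpace 𝓘(ℝ, E) x), L x (L x X) = -X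
  integrable : ∀ (X Y : ∀ x : M, TangentSpace 𝓘(ℝ, E) x) (x : M),
    ContMDiffAt 𝓘(ℝ, E) 𝓘(ℝ, E).tangent ∞ (fun y => (X y : TangentBundle 𝓘(ℝ, E) M)) x →
    ContMDiffAt 𝓘(ℝ, E) 𝓘(ℝ, E).tangent ∞ (fun y => (Y y : TangentBundle 𝓘(ℝ, E) M)) x →
    nijenhuis L X Y x = 0

variable (E M) in
/-- A hypercomplex structure: complex structures `I, J, K` with `IJ = -JI = K`, acting on the right
on the tangent spaces. Thus `I x X` stands for `X∘I`, and `X∘(IJ) = (X∘I)∘J`. -/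
structure HypercomplexStructure where
  I : EndField E M
  J : EndField E M
  K : EndField E M
  complexI : IsComplexStructure I
  complexJ : IsComplexStructure J
  complexK : IsComplexStructure K
  mul_IJ : ∀ (x : M) (X : TangentSpace 𝓘(ℝ, E) x), J x (I x X) = K x X
  mul_JI : ∀ (x : M) (X : TangentSpace 𝓘(ℝ, E) x), I x (J x X) = -K x X

variable (E M) in
/-- Smooth Riemannian metrics on `M`. -/
abbrev RiemMetric :=
  Bundle.ContMDiffRiemannianMetric (IB := 𝓘(ℝ, E)) (n := ∞) (F := E)
    (E := fun x : M => TangentSpace 𝓘(ℝ, E) x)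

namespace HypercomplexStructure

variable (S : HypercomplexStructure E M)

/-- The right action of the quaternions on `T_x M`. -/
def act (x : M) (h : ℍ[ℝ]) : TangentSpace 𝓘(ℝ, E) x →ₗ[ℝ] TangentSpace 𝓘(ℝ, E) x :=
  rightAct (S.I x).toLinearMap (S.J x).toLinearMap (S.K x).toLinearMap h

/-- The metric `g` is quaternionic Hermitian: it is invariant under the unit quaternions. -/
def IsQuaternionicHermitian (g : RiemMetric E M) : Prop :=
  ∀ (x : M) (h : ℍ[ℝ]), ‖h‖ = 1 → ∀ X Y : TangentSpace 𝓘(ℝ, E) x,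
    g.inner x (S.act x h X) (S.act x h Y) = g.inner x X Y

/-- `ω_I(X, Y) = g(X, Y∘I)`. -/
def omegaI (g : RiemMetric E M) (x : M) : Forms (TangentSpace 𝓘(ℝ, E) x) :=
  toForm fun X Y => ((g.inner x X (S.I x Y) : ℝ) : ℂ)

/-- `Ω(X, Y) = -(g(X, Y∘J) - √-1 g(X, Y∘K))`. -/
def Omega (g : RiemMetric E M) (x : M) : Forms (TangentSpace 𝓘(ℝ, E) x) :=
  toForm fun X Y =>
    -(((g.inner x X (S.J x Y) : ℝ) : ℂ) - Complex.I * ((g.inner x X (S.K x Y) : ℝ) : ℂ))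

/-- The projection `P_+ : Λ^p → Λ^p_+` at the point `x`. -/
def Pplus (x : M) (p : ℕ) (ξ : Forms (TangentSpace 𝓘(ℝ, E) x)) :
    Forms (TangentSpace 𝓘(ℝ, E) x) :=
  plusProj (S.I x).toLinearMap (S.J x).toLinearMap (S.K x).toLinearMap p ξ

end HypercomplexStructure

/-! ### Exterior derivative and Dolbeault operators in low degree -/

variable (E M) in
/-- Complex-valued differential 1-forms on `M`. -/
abbrev OneForm := ∀ x : M, TangentSpace 𝓘(ℝ, E) x →L[ℝ] ℂ

/-- The differential of a real function, as a complex-valued 1-form. -/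
def dFun (φ : M → ℝ) : OneForm E M := fun x =>
  Complex.ofRealCLM ∘L (mfderiv 𝓘(ℝ, E) 𝓘(ℝ, ℝ) φ x : TangentSpace 𝓘(ℝ, E) x →L[ℝ] ℝ)

/-- The local expression of a 1-form in the preferred chart at `x`. -/
def localForm (lam : OneForm E M) (x : M) (y : E) : E →L[ℝ] ℂ :=
  lam ((extChartAt 𝓘(ℝ, E) x).symm y) ∘L
    (mfderiv 𝓘(ℝ, E) 𝓘(ℝ, E) (extChartAt 𝓘(ℝ, E) x).symm y :
      E →L[ℝ] TangentSpace 𝓘(ℝ, E) ((extChartAt 𝓘(ℝ, E) x).symm y))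

/-- The exterior derivative of a 1-form, `dλ(X,Y)`, computed in the preferred chart at `x`. -/
def dOne (lam : OneForm E M) (x : M) (X Y : TangentSpace 𝓘(ℝ, E) x) : ℂ :=
  extDeriv (fun y => ContinuousAlternatingMap.ofSubsingleton ℝ E ℂ (0 : Fin 1)
      (localForm lam x y)) (extChartAt 𝓘(ℝ, E) x x)
    ![mfderiv 𝓘(ℝ, E) 𝓘(ℝ, E) (extChartAt 𝓘(ℝ, E) x) x X,
      mfderiv 𝓘(ℝ, E) 𝓘(ℝ, E) (extChartAt 𝓘(ℝ, E) x) x Y]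

/-- The `(1,0)`-part of a 1-form with respect to `I`. -/
def part10 (I : EndField E M) (lam : OneForm E M) : OneForm E M := fun x =>
  (1 / 2 : ℂ) • (lam x - Complex.I • (lam x ∘L I x))

/-- The `(0,1)`-part of a 1-form with respect to `I`. -/
def part01 (I : EndField E M) (lam : OneForm E M) : OneForm E M := fun x =>
  (1 / 2 : ℂ) • (lam x + Complex.I • (lam x ∘L I x))

/-- `∂̄` on functions. -/
def delbarFun (I : EndField E M) (φ : M → ℝ) : OneForm E M := part01 I (dFun φ)

/-- `∂` on 1-forms: on forms of type `(1,0)` it is the `(2,0)`-part of `d`, on forms of type `(0,1)`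
it is the `(1,1)`-part of `d`. -/
def delOne (I : EndField E M) (lam : OneForm E M) (x : M) : Forms (TangentSpace 𝓘(ℝ, E) x) :=
  toForm (part20 (I x) (dOne (part10 I lam) x)) + toForm (part11 (I x) (dOne (part01 I lam) x))

namespace HypercomplexStructure

variable (S : HypercomplexStructure E M)

/-- `∂_J = J⁻¹ ∘ ∂̄` on functions, where `(J⁻¹ λ)(X) = λ(X∘J⁻¹)` and `J⁻¹ = -J`. -/
def delJFun (φ : M → ℝ) : OneForm E M := fun x => delbarFun S.I φ x ∘L (-S.J x)

/-- `∂∂_J φ`. -/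
def deldelJ (φ : M → ℝ) (x : M) : Forms (TangentSpace 𝓘(ℝ, E) x) :=
  delOne S.I (S.delJFun φ) x

/-- `∂∂̄ φ`, with respect to the complex structure `I`. -/
def deldelbar (φ : M → ℝ) (x : M) : Forms (TangentSpace 𝓘(ℝ, E) x) :=
  delOne S.I (delbarFun S.I φ) x

/-- The quaternionic Monge-Ampère equation `(Ω + ∂∂_J φ)^n = A e^f Ω^n` at the point `x`. -/
def QuaternionicMongeAmpere (g : RiemMetric E M) (n : ℕ) (A : ℝ) (f φ : M → ℝ) (x : M) : Prop :=
  (S.Omega g x + S.deldelJ φ x) ^ n = ((A * Real.exp (f x) : ℝ) : ℂ) • S.Omega g x ^ n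

/-- The equation `(ω_I - √-1 ∂∂̄φ)^n ∧ P_+(ω_I^n) = A e^f ω_I^n ∧ P_+(ω_I^n)` at the point `x`. -/
def ComplexHessian (g : RiemMetric E M) (n : ℕ) (A : ℝ) (f φ : M → ℝ) (x : M) : Prop :=
  (S.omegaI g x - Complex.I • S.deldelbar φ x) ^ n * S.Pplus x (2 * n) (S.omegaI g x ^ n) =
    ((A * Real.exp (f x) : ℝ) : ℂ) • (S.omegaI g x ^ n * S.Pplus x (2 * n) (S.omegaI g x ^ n))

end HypercomplexStructure

end Manifold

end Hypercomplex

end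

/-! The equivalence is pointwise linear algebra plus one identity of second derivatives. Put p = 2n.
The complex covectors at a point form ℂ² ⊗ ℂᵖ, with the (1,0)-covectors as one factor and their
images under J as the other. Unit quaternions act through 2 × 2 matrices m ⊗ 1, and since forms of
degree p depend polynomially on m, a subspace of Λᵖ stable under SU(2) is stable under all complex 2
× 2 matrices, singular ones included (`isMatStable_of_quaternion`).

A rank-one matrix u wᵀ maps Λᵖ into the line of `volForm b u`. Hence a stable subspace of Λᵖ either
is killed by all rank-one matrices (`lowerSpace`) or contains all the forms `volForm b u`, which
span a copy of Symᵖ ℂ² (`plusSpace`). With complete reducibility and a lowest-weight argument this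
gives Λᵖ_+ = `plusSpace` and Vᵖ = `lowerSpace` (`IsAdapted.plusForms_eq`,
`IsAdapted.lowerForms_eq`). The wedge product of the two summands is zero, and the (n,n)-part of
`plusSpace` is a line on which the wedge square does not vanish.

Let G be the map on forms induced by the rank-one matrix with rows (1,1) and (0,0). It is
multiplicative and sends an (n,n)-form to a multiple of one fixed (2n,0)-form; that multiple
determines the Λ_+-component of the form. So for (n,n)-forms ξ, η with G ξ ≠ 0, the equation η ∧
P_+ξ = c ξ ∧ P_+ξ means G η = c G ξ (`mul_plus_eq_iff`). Now G ω_I = -√-1 Ω, and Ωⁿ ≠ 0. It remains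
to see that G(∂∂̄φ) = ∂∂_Jφ, and then the n-th powers of the two sides correspond. This last
identity (`part20_dOne_delJFun`) is where integrability enters: in a chart its second-order terms
agree by symmetry of the Hessian, and its first-order terms agree because the Nijenhuis tensors of I
and J vanish. -/

noncomputable section
namespace Hypercomplex

open ExteriorAlgebra Module

/-! ### Polynomial families of vectors -/

section Polynomial

variable {V : Type*} [AddCommGroup V] [Module ℂ V]

/-- If a vector-valued polynomial takes values in a subspace at infinitely many points, then its
coefficients lie in that subspace. -/
theorem coeff_mem_of_infinite (U : Submodule ℂ V) {d : ℕ} {c : ℕ → V} {S : Set ℂ}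
    (hS : S.Infinite) (h : ∀ t ∈ S, ∑ k ∈ Finset.range d, t ^ k • c k ∈ U) {k : ℕ} (hk : k < d) :
    c k ∈ U := by
  by_contra hc
  obtain ⟨f, hf, hU⟩ := Submodule.exists_le_ker_of_notMem hc
  let P : Polynomial ℂ := ∑ i ∈ Finset.range d, Polynomial.C (f (c i)) * Polynomial.X ^ i
  have hP : P = 0 := by
    refine Polynomial.eq_zero_of_infinite_isRoot P (hS.mono fun t ht => ?_)
    have := hU (h t ht)
    simp only [LinearMap.mem_ker, map_sum, map_smul, smul_eq_mul] at this
    simp only [Set.mem_ofPred_eq, Polynomial.IsRoot, P, Polynomial.eval_finsetSum,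
      Polynomial.eval_mul, Polynomial.eval_C, Polynomial.eval_pow, Polynomial.eval_X]
    rw [← this]
    exact Finset.sum_congr rfl fun i _ => mul_comm _ _
  have h2 := congrArg (fun Q => Polynomial.coeff Q k) hP
  simp [P, Polynomial.coeff_X_pow, hk] at h2
  exact hf h2

theorem coeff_eq_of_infinite {d : ℕ} {c c' : ℕ → V} {S : Set ℂ} (hS : S.Infinite)
    (h : ∀ t ∈ S, ∑ k ∈ Finset.range d, t ^ k • c k = ∑ k ∈ Finset.range d, t ^ k • c' k)
    {k : ℕ} (hk : k < d) : c k = c' k := by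
  have := coeff_mem_of_infinite (⊥ : Submodule ℂ V) (d := d) (c := fun k => c k - c' k) hS
    (fun t ht => by simp [smul_sub, Finset.sum_sub_distrib, h t ht]) hk
  simpa [sub_eq_zero] using this

theorem sum_range_mem_of_infinite (U : Submodule ℂ V) {d : ℕ} {c : ℕ → V} {S : Set ℂ}
    (hS : S.Infinite) (h : ∀ t ∈ S, ∑ k ∈ Finset.range d, t ^ k • c k ∈ U) (t : ℂ) :
    ∑ k ∈ Finset.range d, t ^ k • c k ∈ U :=
  U.sum_mem fun _ hk => U.smul_mem _ (coeff_mem_of_infinite U hS h (Finset.mem_range.1 hk))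

end Polynomial

/-! ### Polynomial dependence of the map on forms on the underlying endomorphism. -/

section Expansion

variable {V : Type*} [AddCommGroup V] [Module ℂ V]

theorem map_mem_exteriorPower (A : V →ₗ[ℂ] V) {p : ℕ} {ξ : ExteriorAlgebra ℂ V}
    (hξ : ξ ∈ ⋀[ℂ]^p V) : ExteriorAlgebra.map A ξ ∈ ⋀[ℂ]^p V := by
  rw [← ιMulti_span_fixedDegree] at hξ ⊢
  induction hξ using Submodule.span_induction with
  | mem x hx =>
    obtain ⟨v, rfl⟩ := hx
    rw [map_apply_ιMulti]
    exact Submodule.subset_span ⟨_, rfl⟩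
  | zero => simp
  | add x y _ _ hx hy => rw [map_add]; exact add_mem hx hy
  | smul a x _ hx => rw [map_smul]; exact Submodule.smul_mem _ _ hx

/-- Multilinear expansion: s is the set of slots that receive B, and the terms are grouped by its
cardinality. -/
theorem map_smul_add_smul_ιMulti (A B : V →ₗ[ℂ] V) {p : ℕ} (v : Fin p → V) (x y : ℂ) :
    ExteriorAlgebra.map (x • A + y • B) (ιMulti ℂ p v) =
      ∑ k ∈ Finset.range (p + 1), (x ^ (p - k) * y ^ k) •
        ∑ s ∈ Finset.univ.filter (fun s : Finset (Fin p) => s.card = k),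
          ιMulti ℂ p (s.piecewise (fun i => B (v i)) (fun i => A (v i))) := by
  classical
  rw [map_apply_ιMulti]
  have h1 : (⇑(x • A + y • B) ∘ v) = (fun i => y • B (v i)) + (fun i => x • A (v i)) := by
    funext i; simp [add_comm]
  have h2 : ∀ s : Finset (Fin p), ιMulti ℂ p (s.piecewise (fun i => y • B (v i))
      (fun i => x • A (v i))) = (x ^ (p - s.card) * y ^ s.card) •
        ιMulti ℂ p (s.piecewise (fun i => B (v i)) (fun i => A (v i))) := by
    intro s
    have h3 : s.piecewise (fun i => y • B (v i)) (fun i => x • A (v i)) =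
        fun i => (s.piecewise (fun _ => y) (fun _ => x) i) •
          (s.piecewise (fun i => B (v i)) (fun i => A (v i)) i) := by
      funext i
      by_cases hi : i ∈ s <;> simp [hi]
    rw [h3]
    have := (ιMulti ℂ p (M := V)).toMultilinearMap.map_smul_univ
      (s.piecewise (fun _ => y) (fun _ => x)) (s.piecewise (fun i => B (v i)) (fun i => A (v i)))
    simp only [AlternatingMap.coe_multilinearMap] at this
    rw [this, Finset.prod_piecewise]
    simp [← Finset.compl_eq_univ_sdiff, Finset.card_compl, mul_comm]
  have h4 := (ιMulti ℂ p (M := V)).toMultilinearMap.map_add_univ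
    (fun i => y • B (v i)) (fun i => x • A (v i))
  simp only [AlternatingMap.coe_multilinearMap] at h4
  rw [h1, h4, Finset.sum_congr rfl fun s _ => h2 s]
  rw [← Finset.sum_fiberwise_of_maps_to (g := Finset.card) (t := Finset.range (p + 1))]
  · refine Finset.sum_congr rfl fun k _ => ?_
    rw [Finset.smul_sum]
    refine Finset.sum_congr rfl fun s hs => ?_
    rw [(Finset.mem_filter.1 hs).2]
  · intro s _
    exact Finset.mem_range.2 (Nat.lt_succ_of_le (by simpa using s.card_le_univ))

/-- Forms of degree `p` depend polynomially, homogeneously of degree `p`, on the endomorphism by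
which they are transformed. -/
theorem exists_map_expansion (A B : V →ₗ[ℂ] V) {p : ℕ} {ξ : ExteriorAlgebra ℂ V}
    (hξ : ξ ∈ ⋀[ℂ]^p V) :
    ∃ c : ℕ → ExteriorAlgebra ℂ V, ∀ x y : ℂ, ExteriorAlgebra.map (x • A + y • B) ξ =
      ∑ k ∈ Finset.range (p + 1), (x ^ (p - k) * y ^ k) • c k := by
  rw [← ιMulti_span_fixedDegree] at hξ
  induction hξ using Submodule.span_induction with
  | mem x hx =>
    obtain ⟨v, rfl⟩ := hx
    exact ⟨_, fun x y => map_smul_add_smul_ιMulti A B v x y⟩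
  | zero => exact ⟨0, by simp⟩
  | add x y _ _ hx hy =>
    obtain ⟨c, hc⟩ := hx
    obtain ⟨d, hd⟩ := hy
    exact ⟨c + d, fun x y => by simp [hc, hd, smul_add, Finset.sum_add_distrib]⟩
  | smul a x _ hx =>
    obtain ⟨c, hc⟩ := hx
    exact ⟨a • c, fun x y => by simp [hc, Finset.smul_sum, smul_comm a]⟩

theorem exists_map_expansion_one (A B : V →ₗ[ℂ] V) {p : ℕ} {ξ : ExteriorAlgebra ℂ V}
    (hξ : ξ ∈ ⋀[ℂ]^p V) :
    ∃ c : ℕ → ExteriorAlgebra ℂ V, ∀ t : ℂ, ExteriorAlgebra.map (A + t • B) ξ =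
      ∑ k ∈ Finset.range (p + 1), t ^ k • c k := by
  obtain ⟨c, hc⟩ := exists_map_expansion A B hξ
  exact ⟨c, fun t => by simpa using hc 1 t⟩

theorem map_smul_apply (t : ℂ) (A : V →ₗ[ℂ] V) {p : ℕ} {ξ : ExteriorAlgebra ℂ V}
    (hξ : ξ ∈ ⋀[ℂ]^p V) :
    ExteriorAlgebra.map (t • A) ξ = t ^ p • ExteriorAlgebra.map A ξ := by
  rw [← ιMulti_span_fixedDegree] at hξ
  induction hξ using Submodule.span_induction with
  | mem x hx =>
    obtain ⟨v, rfl⟩ := hx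
    rw [map_apply_ιMulti, map_apply_ιMulti]
    have := (ιMulti ℂ p (M := V)).toMultilinearMap.map_smul_univ (fun _ => t) (⇑A ∘ v)
    change ιMulti ℂ p (fun i => t • A (v i)) = _
    simpa using this
  | zero => simp
  | add x y _ _ hx hy => simp [hx, hy]
  | smul a x _ hx => simp only [_root_.map_smul, hx]; rw [smul_comm]

/-- The density argument used throughout: along a line of endomorphisms the transformed form is
polynomial in t, so membership in a subspace spreads from infinitely many t to all. It passes from
real to complex parameters and from generic to degenerate matrices. -/
theorem mem_of_real_line (U : Submodule ℂ (ExteriorAlgebra ℂ V)) (A B : V →ₗ[ℂ] V) {p : ℕ}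
    {ξ : ExteriorAlgebra ℂ V} (hξ : ξ ∈ ⋀[ℂ]^p V) {S : Set ℂ} (hS : S.Infinite)
    (h : ∀ t ∈ S, ExteriorAlgebra.map (A + t • B) ξ ∈ U) (t : ℂ) :
    ExteriorAlgebra.map (A + t • B) ξ ∈ U := by
  obtain ⟨c, hc⟩ := exists_map_expansion_one A B hξ
  rw [hc]
  exact sum_range_mem_of_infinite U hS (fun t ht => hc t ▸ h t ht) t

theorem infinite_range_ofReal : (Set.range ((↑) : ℝ → ℂ)).Infinite :=
  Set.infinite_range_of_injective Complex.ofReal_injective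

theorem infinite_ne (a : ℂ) : {t : ℂ | t ≠ a}.Infinite :=
  (Set.finite_singleton a).infinite_compl

end Expansion

/-! ### The action of `2 × 2` matrices on the forms on `ℂ² ⊗ ℂᵖ` -/

section MatrixAction

variable {V : Type*} [AddCommGroup V] [Module ℂ V] {p : ℕ} (b : Basis (Fin 2 × Fin p) ℂ V)

/-- The endomorphism `m ⊗ 1` of `V = ℂ² ⊗ ℂᵖ`. -/
def matAct (m : Matrix (Fin 2) (Fin 2) ℂ) : V →ₗ[ℂ] V :=
  Matrix.toLinAlgEquiv b (Matrix.kronecker m (1 : Matrix (Fin p) (Fin p) ℂ))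

/-- The action of the matrix `m` on exterior forms, extended multiplicatively from `m ⊗ 1`. -/
def formMat (m : Matrix (Fin 2) (Fin 2) ℂ) : ExteriorAlgebra ℂ V →ₐ[ℂ] ExteriorAlgebra ℂ V :=
  ExteriorAlgebra.map (matAct b m)

/-- The vector `u ⊗ eₐ`. -/
def tens (u : Fin 2 → ℂ) (a : Fin p) : V := u 0 • b (0, a) + u 1 • b (1, a)

/-- The form `⋀ₐ (u ⊗ eₐ)` of degree `p`. -/
def volForm (u : Fin 2 → ℂ) : ExteriorAlgebra ℂ V := ιMulti ℂ p (tens b u)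

theorem matAct_add (m m' : Matrix (Fin 2) (Fin 2) ℂ) :
    matAct b (m + m') = matAct b m + matAct b m' := by
  simp [matAct, Matrix.kronecker, Matrix.kroneckerMap_add_left, add_mul]

theorem matAct_smul (t : ℂ) (m : Matrix (Fin 2) (Fin 2) ℂ) :
    matAct b (t • m) = t • matAct b m := by
  simp [matAct, Matrix.kronecker, Matrix.kroneckerMap_smul_left, mul_assoc]

theorem matAct_mul (m m' : Matrix (Fin 2) (Fin 2) ℂ) :
    matAct b (m * m') = matAct b m ∘ₗ matAct b m' := by
  have : Matrix.kronecker (m * m') (1 : Matrix (Fin p) (Fin p) ℂ) =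
      Matrix.kronecker m 1 * Matrix.kronecker m' 1 := by
    rw [Matrix.kronecker, ← Matrix.mul_kronecker_mul, mul_one]
  rw [matAct, this, map_mul]
  rfl

theorem matAct_one : matAct b 1 = LinearMap.id := by
  rw [matAct, Matrix.kronecker, Matrix.one_kronecker_one, map_one]
  rfl

theorem matAct_basis (m : Matrix (Fin 2) (Fin 2) ℂ) (i : Fin 2) (a : Fin p) :
    matAct b m (b (i, a)) = tens b (fun j => m j i) a := by
  rw [matAct, Matrix.toLinAlgEquiv_self, Fintype.sum_prod_type]
  simp [Fin.sum_univ_two, tens, Matrix.kroneckerMap_apply, Matrix.one_apply, ite_smul]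

theorem matAct_tens (m : Matrix (Fin 2) (Fin 2) ℂ) (u : Fin 2 → ℂ) (a : Fin p) :
    matAct b m (tens b u a) = tens b (m.mulVec u) a := by
  rw [tens, map_add, map_smul, map_smul, matAct_basis, matAct_basis]
  simp only [tens, Matrix.mulVec, dotProduct, Fin.sum_univ_two]
  module

theorem basis_eq_tens (i : Fin 2) (a : Fin p) : b (i, a) = tens b (Pi.single i 1) a := by
  fin_cases i <;> simp [tens]

theorem formMat_mul (m m' : Matrix (Fin 2) (Fin 2) ℂ) (ξ : ExteriorAlgebra ℂ V) :
    formMat b (m * m') ξ = formMat b m (formMat b m' ξ) := by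
  rw [formMat, matAct_mul, ← ExteriorAlgebra.map_comp_map]
  rfl

theorem formMat_one (ξ : ExteriorAlgebra ℂ V) : formMat b 1 ξ = ξ := by
  rw [formMat, matAct_one, ExteriorAlgebra.map_id]
  rfl

theorem formMat_mem (m : Matrix (Fin 2) (Fin 2) ℂ) {ξ : ExteriorAlgebra ℂ V} {q : ℕ}
    (hξ : ξ ∈ ⋀[ℂ]^q V) : formMat b m ξ ∈ ⋀[ℂ]^q V :=
  map_mem_exteriorPower _ hξ

theorem formMat_smul (t : ℂ) (m : Matrix (Fin 2) (Fin 2) ℂ) {ξ : ExteriorAlgebra ℂ V} {q : ℕ}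
    (hξ : ξ ∈ ⋀[ℂ]^q V) : formMat b (t • m) ξ = t ^ q • formMat b m ξ := by
  rw [formMat, matAct_smul, map_smul_apply t _ hξ, formMat]

theorem exists_formMat_expansion (m m' : Matrix (Fin 2) (Fin 2) ℂ) {ξ : ExteriorAlgebra ℂ V}
    {q : ℕ} (hξ : ξ ∈ ⋀[ℂ]^q V) :
    ∃ c : ℕ → ExteriorAlgebra ℂ V, ∀ x y : ℂ, formMat b (x • m + y • m') ξ =
      ∑ k ∈ Finset.range (q + 1), (x ^ (q - k) * y ^ k) • c k := by
  obtain ⟨c, hc⟩ := exists_map_expansion (matAct b m) (matAct b m') hξ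
  exact ⟨c, fun x y => by rw [formMat, matAct_add, matAct_smul, matAct_smul, hc]⟩

theorem formMat_mem_of_infinite (U : Submodule ℂ (ExteriorAlgebra ℂ V))
    (m m' : Matrix (Fin 2) (Fin 2) ℂ) {q : ℕ} {ξ : ExteriorAlgebra ℂ V} (hξ : ξ ∈ ⋀[ℂ]^q V)
    {S : Set ℂ} (hS : S.Infinite) (h : ∀ t ∈ S, formMat b (m + t • m') ξ ∈ U) (t : ℂ) :
    formMat b (m + t • m') ξ ∈ U := by
  simp only [formMat, matAct_add, matAct_smul] at h ⊢
  exact mem_of_real_line U _ _ hξ hS h t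

theorem volForm_mem (u : Fin 2 → ℂ) : volForm b u ∈ ⋀[ℂ]^p V :=
  ιMulti_range ℂ p ⟨_, rfl⟩

theorem formMat_volForm (m : Matrix (Fin 2) (Fin 2) ℂ) (u : Fin 2 → ℂ) :
    formMat b m (volForm b u) = volForm b (m.mulVec u) := by
  rw [formMat, volForm, map_apply_ιMulti, volForm]
  congr 1
  funext a
  exact matAct_tens b m u a

theorem volForm_smul (t : ℂ) (u : Fin 2 → ℂ) : volForm b (t • u) = t ^ p • volForm b u := by
  have := formMat_volForm b (t • 1) u
  rw [formMat_smul b t 1 (volForm_mem b u), formMat_one] at this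
  rw [this]
  congr 1
  simp [Matrix.smul_mulVec]

/-- The value of an alternating map of `p` vectors on vectors in the span of `p` given ones is a
multiple of its value on the given ones. -/
theorem alternating_mem_span {F : Type*} [AddCommGroup F] [Module ℂ F] (f : V [⋀^Fin p]→ₗ[ℂ] F)
    (w v : Fin p → V) (hv : ∀ i, v i ∈ Submodule.span ℂ (Set.range w)) :
    ∃ t : ℂ, f v = t • f w := by
  choose c hc using fun i => (Submodule.mem_span_range_iff_exists_fun ℂ).1 (hv i)
  let L : (Fin p → ℂ) →ₗ[ℂ] V := Fintype.linearCombination ℂ w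
  let e := Pi.basisFun ℂ (Fin p)
  refine ⟨e.det c, ?_⟩
  rw [← sub_eq_zero, ← Module.forall_dual_apply_eq_zero_iff ℂ]
  intro l
  -- Pulled back to ℂᵖ along the coefficients, any scalar alternating p-form is a multiple of the
  -- determinant; linear forms `l` reduce the vector-valued case to this one.
  have h := (l.compAlternatingMap (f.compLinearMap L)).eq_smul_basis_det e
  have h1 := congrArg (fun g => g c) h
  have h2 : (fun i => L (c i)) = v := by
    funext i
    simpa [L, Fintype.linearCombination_apply] using hc i
  have h3 : (fun i => L (e i)) = w := by
    funext i
    simp [L, e, Fintype.linearCombination_apply, Pi.single_apply, ite_smul]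
  simp only [LinearMap.compAlternatingMap_apply, AlternatingMap.compLinearMap_apply, h2, h3,
    AlternatingMap.smul_apply, smul_eq_mul] at h1
  rw [map_sub, map_smul, h1, smul_eq_mul, mul_comm, sub_self]

theorem matAct_vecMulVec_mem (u w : Fin 2 → ℂ) (v : V) :
    matAct b (Matrix.vecMulVec u w) v ∈ Submodule.span ℂ (Set.range (tens b u)) := by
  have hb : v ∈ Submodule.span ℂ (Set.range b) := by rw [b.span_eq]; trivial
  induction hb using Submodule.span_induction with
  | mem x hx =>
    obtain ⟨⟨i, a⟩, rfl⟩ := hx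
    rw [matAct_basis]
    have : tens b (fun j => Matrix.vecMulVec u w j i) a = w i • tens b u a := by
      simp only [tens, Matrix.vecMulVec_apply]
      module
    rw [this]
    exact Submodule.smul_mem _ _ (Submodule.subset_span ⟨a, rfl⟩)
  | zero => simp
  | add x y _ _ hx hy => rw [map_add]; exact add_mem hx hy
  | smul a x _ hx => rw [map_smul]; exact Submodule.smul_mem _ _ hx

/-- A matrix of rank one maps every form of degree `p` to a multiple of one form. -/
theorem formMat_vecMulVec (u w : Fin 2 → ℂ) {ξ : ExteriorAlgebra ℂ V} (hξ : ξ ∈ ⋀[ℂ]^p V) :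
    ∃ t : ℂ, formMat b (Matrix.vecMulVec u w) ξ = t • volForm b u := by
  rw [← ιMulti_span_fixedDegree] at hξ
  induction hξ using Submodule.span_induction with
  | mem x hx =>
    obtain ⟨v, rfl⟩ := hx
    rw [formMat, map_apply_ιMulti]
    exact alternating_mem_span _ _ _ fun i => matAct_vecMulVec_mem b u w (v i)
  | zero => exact ⟨0, by simp⟩
  | add x y _ _ hx hy =>
    obtain ⟨s, hs⟩ := hx
    obtain ⟨t, ht⟩ := hy
    exact ⟨s + t, by rw [map_add, hs, ht, add_smul]⟩
  | smul a x _ hx =>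
    obtain ⟨s, hs⟩ := hx
    exact ⟨a * s, by rw [map_smul, hs, mul_smul]⟩

end MatrixAction

end Hypercomplex
end

noncomputable section
namespace Hypercomplex

open ExteriorAlgebra Module

section PlusLower

variable {V : Type*} [AddCommGroup V] [Module ℂ V] {p : ℕ} (b : Basis (Fin 2 × Fin p) ℂ V)

/-! ### Forms annihilated by a factor -/

theorem ι_mul_mul_eq_zero {u θ : ExteriorAlgebra ℂ V} {x : V} (h : ι ℂ x * θ = 0) :
    ι ℂ x * (u * θ) = 0 := by
  induction u using ExteriorAlgebra.induction generalizing θ with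
  | algebraMap r => rw [← mul_assoc, ← Algebra.commutes, mul_assoc, h, mul_zero]
  | ι y =>
    rw [← mul_assoc, eq_neg_of_add_eq_zero_left (ι_add_mul_swap x y), neg_mul, mul_assoc, h,
      mul_zero, neg_zero]
  | mul u v hu hv => rw [mul_assoc]; exact hu (hv h)
  | add u v hu hv => rw [add_mul, mul_add, hu h, hv h, add_zero]

theorem mul_mul_ι_eq_zero {u θ : ExteriorAlgebra ℂ V} {x : V} (h : θ * ι ℂ x = 0) :
    θ * u * ι ℂ x = 0 := by
  induction u using ExteriorAlgebra.induction generalizing θ with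
  | algebraMap r => rw [mul_assoc, Algebra.commutes, ← mul_assoc, h, zero_mul]
  | ι y =>
    rw [mul_assoc, eq_neg_of_add_eq_zero_left (ι_add_mul_swap y x), mul_neg, ← mul_assoc, h,
      zero_mul, neg_zero]
  | mul u v hu hv => rw [← mul_assoc]; exact hv (hu h)
  | add u v hu hv => rw [mul_add, add_mul, hu h, hv h, add_zero]

/-- A is the identity modulo vectors that annihilate θ, so its effect disappears after
multiplication by θ. The induction lets θ vary because in a product u v the factor u is multiplied
by v θ, which the same vectors annihilate. -/
theorem map_mul_eq_of_annihilates (A : V →ₗ[ℂ] V) (ξ : ExteriorAlgebra ℂ V)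
    {θ : ExteriorAlgebra ℂ V} (h : ∀ x, ι ℂ (A x - x) * θ = 0) :
    ExteriorAlgebra.map A ξ * θ = ξ * θ := by
  induction ξ using ExteriorAlgebra.induction generalizing θ with
  | algebraMap r => rw [AlgHom.commutes]
  | ι y =>
    have := h y
    rw [map_sub, sub_mul, sub_eq_zero] at this
    rw [map_apply_ι, this]
  | mul u v hu hv =>
    rw [map_mul, mul_assoc, hv h, hu fun x => ι_mul_mul_eq_zero (h x), mul_assoc]
  | add u v hu hv => rw [map_add, add_mul, add_mul, hu h, hv h]

theorem mul_map_eq_of_annihilates (A : V →ₗ[ℂ] V) (ξ : ExteriorAlgebra ℂ V)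
    {θ : ExteriorAlgebra ℂ V} (h : ∀ x, θ * ι ℂ (A x - x) = 0) :
    θ * ExteriorAlgebra.map A ξ = θ * ξ := by
  induction ξ using ExteriorAlgebra.induction generalizing θ with
  | algebraMap r => rw [AlgHom.commutes]
  | ι y =>
    have := h y
    rw [map_sub, mul_sub, sub_eq_zero] at this
    rw [map_apply_ι, this]
  | mul u v hu hv =>
    rw [map_mul, ← mul_assoc, hu h, hv fun x => mul_mul_ι_eq_zero (h x), mul_assoc]
  | add u v hu hv => rw [map_add, mul_add, mul_add, hu h, hv h]

theorem ι_mul_ιMulti_eq_zero {q : ℕ} (v : Fin q → V) (i : Fin q) :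
    ι ℂ (v i) * ιMulti ℂ q v = 0 := by
  have : ιMulti ℂ 1 ![v i] * ιMulti ℂ q v = 0 := by
    rw [ιMulti_mul_ιMulti]
    refine (ιMulti ℂ (1 + q)).map_eq_zero_of_eq _ (i := Fin.castAdd q 0) (j := Fin.natAdd 1 i) ?_ ?_
    · rw [Fin.append_left, Fin.append_right]; rfl
    · intro h; have := congrArg Fin.val h; simp at this; omega
  simpa using this

theorem ιMulti_mul_ι_eq_zero {q : ℕ} (v : Fin q → V) (i : Fin q) :
    ιMulti ℂ q v * ι ℂ (v i) = 0 := by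
  have : ιMulti ℂ q v * ιMulti ℂ 1 ![v i] = 0 := by
    rw [ιMulti_mul_ιMulti]
    refine (ιMulti ℂ (q + 1)).map_eq_zero_of_eq _ (i := Fin.natAdd q 0) (j := Fin.castAdd 1 i) ?_ ?_
    · rw [Fin.append_left, Fin.append_right]; rfl
    · intro h; have := congrArg Fin.val h; simp at this; omega
  simpa using this

theorem matAct_sub_mem (m : Matrix (Fin 2) (Fin 2) ℂ) (u : Fin 2 → ℂ)
    (h : ∀ w, ∃ t : ℂ, m.mulVec w = w + t • u) (x : V) :
    matAct b m x - x ∈ Submodule.span ℂ (Set.range (tens b u)) := by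
  have hb : x ∈ Submodule.span ℂ (Set.range b) := by rw [b.span_eq]; trivial
  induction hb using Submodule.span_induction with
  | mem x hx =>
    obtain ⟨⟨i, a⟩, rfl⟩ := hx
    obtain ⟨t, ht⟩ := h (Pi.single i 1)
    rw [basis_eq_tens, matAct_tens, ht]
    have : tens b (Pi.single i 1 + t • u) a - tens b (Pi.single i 1) a = t • tens b u a := by
      simp only [tens, Pi.add_apply, Pi.smul_apply, smul_eq_mul]
      module
    rw [this]
    exact Submodule.smul_mem _ _ (Submodule.subset_span ⟨a, rfl⟩)
  | zero => simp
  | add x y _ _ hx hy => rw [map_add, add_sub_add_comm]; exact add_mem hx hy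
  | smul a x _ hx => rw [map_smul, ← smul_sub]; exact Submodule.smul_mem _ _ hx

/-- The form `volForm b u` is annihilated by u ⊗ ℂᵖ, so next to it any matrix congruent to 1 modulo
u acts trivially. It is applied to matrices m of rank one, which turn ξ into a multiple of a volume
form. -/
theorem formMat_mul_volForm (m : Matrix (Fin 2) (Fin 2) ℂ) (u : Fin 2 → ℂ)
    (h : ∀ w, ∃ t : ℂ, m.mulVec w = w + t • u) (ξ : ExteriorAlgebra ℂ V) :
    formMat b m ξ * volForm b u = ξ * volForm b u := by
  refine map_mul_eq_of_annihilates _ _ fun x => ?_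
  have hx := matAct_sub_mem b m u h x
  generalize matAct b m x - x = z at hx ⊢
  induction hx using Submodule.span_induction with
  | mem y hy => obtain ⟨a, rfl⟩ := hy; exact ι_mul_ιMulti_eq_zero _ a
  | zero => simp
  | add x y _ _ hx hy => rw [map_add, add_mul, hx, hy, add_zero]
  | smul a x _ hx => rw [map_smul, smul_mul_assoc, hx, smul_zero]

theorem volForm_mul_formMat (m : Matrix (Fin 2) (Fin 2) ℂ) (u : Fin 2 → ℂ)
    (h : ∀ w, ∃ t : ℂ, m.mulVec w = w + t • u) (ξ : ExteriorAlgebra ℂ V) :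
    volForm b u * formMat b m ξ = volForm b u * ξ := by
  refine mul_map_eq_of_annihilates _ _ fun x => ?_
  have hx := matAct_sub_mem b m u h x
  generalize matAct b m x - x = z at hx ⊢
  induction hx using Submodule.span_induction with
  | mem y hy => obtain ⟨a, rfl⟩ := hy; exact ιMulti_mul_ι_eq_zero _ a
  | zero => simp
  | add x y _ _ hx hy => rw [map_add, mul_add, hx, hy, add_zero]
  | smul a x _ hx => rw [map_smul, mul_smul_comm, hx, smul_zero]

/-! ### Non-vanishing -/

theorem ιMulti_basis_ne_zero {q : ℕ} (e : Basis (Fin q) ℂ V) : ιMulti ℂ q e ≠ 0 := by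
  intro h
  -- The determinant, placed in degree q, is a linear form on the exterior algebra with value 1 on
  -- this product.
  have h1 := congrArg (liftAlternating (Pi.single q e.det)) h
  rw [liftAlternating_apply_ιMulti, map_zero, Pi.single_eq_same, e.det_self] at h1
  exact one_ne_zero h1

/-- The product is the exterior product of all the vectors of the basis of V, in some order. -/
theorem volForm_mul_volForm_ne_zero : volForm b ![0, 1] * volForm b ![1, 0] ≠ 0 := by
  rw [volForm, volForm, ιMulti_mul_ιMulti]
  let e : Fin p ⊕ Fin p ≃ Fin 2 × Fin p := Equiv.ofBijective
    (Sum.elim (fun a => (1, a)) (fun a => (0, a))) <| by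
      constructor
      · rintro (a | a) (c | c) h <;> simp_all
      · rintro ⟨i, a⟩
        fin_cases i
        · exact ⟨Sum.inr a, rfl⟩
        · exact ⟨Sum.inl a, rfl⟩
  have h : Fin.append (tens b ![0, 1]) (tens b ![1, 0]) =
      b.reindex (e.symm.trans finSumFinEquiv) := by
    funext i
    refine Fin.addCases (fun a => ?_) (fun a => ?_) i
    · rw [Fin.append_left, Basis.reindex_apply, Equiv.symm_trans_apply, Equiv.symm_symm,
        finSumFinEquiv_symm_apply_castAdd]
      change _ = b (1, a)
      simp [tens]
    · rw [Fin.append_right, Basis.reindex_apply, Equiv.symm_trans_apply, Equiv.symm_symm,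
        finSumFinEquiv_symm_apply_natAdd]
      change _ = b (0, a)
      simp [tens]
  rw [h]
  exact ιMulti_basis_ne_zero _

theorem volForm_ne_zero : volForm b ![1, 0] ≠ 0 := fun h =>
  volForm_mul_volForm_ne_zero b (by rw [h, mul_zero])

/-! ### The coefficients of the curve of volume forms -/

theorem exists_volForm_coeff : ∃ c : ℕ → ExteriorAlgebra ℂ V, ∀ x y : ℂ,
    volForm b ![x, y] = ∑ k ∈ Finset.range (p + 1), (x ^ (p - k) * y ^ k) • c k := by
  obtain ⟨c, hc⟩ := exists_formMat_expansion b !![1, 0; 0, 0] !![0, 0; 1, 0]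
    (volForm_mem b ![1, 0])
  refine ⟨c, fun x y => ?_⟩
  rw [← hc, formMat_volForm]
  congr 1
  funext i
  fin_cases i <;> simp [Matrix.mulVec, dotProduct]

/-- The coefficient of `x^(p-k) y^k` in `volForm b (x, y)`, a form of type `(p-k, k)`. -/
def volCoeff (k : ℕ) : ExteriorAlgebra ℂ V := (exists_volForm_coeff b).choose k

theorem volForm_eq_sum (x y : ℂ) :
    volForm b ![x, y] = ∑ k ∈ Finset.range (p + 1), (x ^ (p - k) * y ^ k) • volCoeff b k :=
  (exists_volForm_coeff b).choose_spec x y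

theorem volForm_one_eq_sum (t : ℂ) :
    volForm b ![1, t] = ∑ k ∈ Finset.range (p + 1), t ^ k • volCoeff b k := by
  simp [volForm_eq_sum]

/-- The span of all the forms `volForm b u`. -/
def plusSpace : Submodule ℂ (ExteriorAlgebra ℂ V) :=
  Submodule.span ℂ (Set.range fun k : Fin (p + 1) => volCoeff b k)

/-- The forms of degree `p` which are annihilated by the matrices of rank one. -/
def lowerSpace : Submodule ℂ (ExteriorAlgebra ℂ V) where
  carrier := {ξ | ξ ∈ ⋀[ℂ]^p V ∧ ∀ u w, formMat b (Matrix.vecMulVec u w) ξ = 0}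
  add_mem' := fun hx hy => ⟨add_mem hx.1 hy.1, fun u w => by rw [map_add, hx.2, hy.2, add_zero]⟩
  zero_mem' := ⟨zero_mem _, fun u w => map_zero _⟩
  smul_mem' := fun t x hx =>
    ⟨Submodule.smul_mem _ _ hx.1, fun u w => by rw [map_smul, hx.2, smul_zero]⟩

theorem lowerSpace_le : lowerSpace b ≤ ⋀[ℂ]^p V := fun _ h => h.1

theorem volCoeff_mem_plusSpace {k : ℕ} (hk : k < p + 1) : volCoeff b k ∈ plusSpace b :=
  Submodule.subset_span ⟨⟨k, hk⟩, rfl⟩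

theorem volForm_mem_plusSpace (u : Fin 2 → ℂ) : volForm b u ∈ plusSpace b := by
  have : u = ![u 0, u 1] := by funext i; fin_cases i <;> rfl
  rw [this, volForm_eq_sum]
  exact Submodule.sum_mem _ fun k hk =>
    Submodule.smul_mem _ _ (volCoeff_mem_plusSpace b (Finset.mem_range.1 hk))

/-- The coefficients of a polynomial curve lie in any subspace containing the curve. Linear
statements about `plusSpace` are thereby reduced to the forms `volForm b ![1, t]`. -/
theorem plusSpace_le_of_volForm_mem {U : Submodule ℂ (ExteriorAlgebra ℂ V)}
    (h : ∀ t : ℂ, volForm b ![1, t] ∈ U) : plusSpace b ≤ U := by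
  rw [plusSpace, Submodule.span_le]
  rintro _ ⟨k, rfl⟩
  exact coeff_mem_of_infinite U (Set.infinite_univ (α := ℂ))
    (fun t _ => volForm_one_eq_sum b t ▸ h t) k.2

theorem plusSpace_le : plusSpace b ≤ ⋀[ℂ]^p V :=
  plusSpace_le_of_volForm_mem b fun t => volForm_mem b ![1, t]

theorem formMat_mem_plusSpace (m : Matrix (Fin 2) (Fin 2) ℂ) {ξ : ExteriorAlgebra ℂ V}
    (hξ : ξ ∈ plusSpace b) : formMat b m ξ ∈ plusSpace b := by
  have : plusSpace b ≤ (plusSpace b).comap (formMat b m).toLinearMap :=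
    plusSpace_le_of_volForm_mem b fun t => by
      change formMat b m (volForm b ![1, t]) ∈ plusSpace b
      rw [formMat_volForm]
      exact volForm_mem_plusSpace b _
  exact this hξ

theorem formMat_mem_lowerSpace (m : Matrix (Fin 2) (Fin 2) ℂ) {ξ : ExteriorAlgebra ℂ V}
    (hξ : ξ ∈ lowerSpace b) : formMat b m ξ ∈ lowerSpace b := by
  refine ⟨formMat_mem b m hξ.1, fun u w => ?_⟩
  rw [← formMat_mul, Matrix.vecMulVec_mul]
  exact hξ.2 _ _

theorem formMat_vecMulVec_volForm (u w v : Fin 2 → ℂ) :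
    formMat b (Matrix.vecMulVec u w) (volForm b v) =
      (w 0 * v 0 + w 1 * v 1) ^ p • volForm b u := by
  rw [formMat_volForm, ← volForm_smul, Matrix.vecMulVec_mulVec]
  congr 1
  funext i
  simp [dotProduct, Fin.sum_univ_two, mul_comm]

/-- Comparison of the coefficients of tᵏ in (w₀ + t w₁)ᵖ, the factor by which u wᵀ sends `volForm b
![1, t]` to `volForm b u`. -/
theorem formMat_vecMulVec_volCoeff (u w : Fin 2 → ℂ) {k : ℕ} (hk : k < p + 1) :
    formMat b (Matrix.vecMulVec u w) (volCoeff b k) =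
      (w 0 ^ (p - k) * w 1 ^ k * p.choose k) • volForm b u := by
  refine coeff_eq_of_infinite (d := p + 1)
    (c := fun k => formMat b (Matrix.vecMulVec u w) (volCoeff b k))
    (c' := fun k => (w 0 ^ (p - k) * w 1 ^ k * p.choose k) • volForm b u)
    (Set.infinite_univ (α := ℂ)) (fun t _ => ?_) hk
  have h := formMat_vecMulVec_volForm b u w ![1, t]
  rw [volForm_one_eq_sum, map_sum] at h
  simp only [map_smul] at h
  rw [h, add_comm, add_pow, Finset.sum_smul]
  refine Finset.sum_congr rfl fun k _ => ?_
  rw [smul_smul]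
  congr 1
  simp [mul_pow]
  ring

/-- The matrices (1,0)(1,t)ᵀ turn the combination into a polynomial in t with coefficients c k · (p
choose k), which vanishes identically. This yields both the independence of the `volCoeff b k` and
the triviality of the intersection with `lowerSpace`. -/
theorem coeff_eq_zero_of_mem_lowerSpace {c : ℕ → ℂ}
    (h : ∑ k ∈ Finset.range (p + 1), c k • volCoeff b k ∈ lowerSpace b) {k : ℕ} (hk : k < p + 1) :
    c k = 0 := by
  have h0 := coeff_eq_of_infinite (d := p + 1)
    (c := fun k => (c k * p.choose k) • volForm b ![1, 0]) (c' := fun k => 0)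
    (Set.infinite_univ (α := ℂ)) (fun t _ => by
      have h1 := h.2 ![1, 0] ![1, t]
      rw [map_sum] at h1
      simp only [smul_zero, Finset.sum_const_zero]
      rw [← h1]
      refine Finset.sum_congr rfl fun i hi => ?_
      rw [map_smul, formMat_vecMulVec_volCoeff b _ _ (Finset.mem_range.1 hi), smul_smul, smul_smul]
      congr 1
      simp
      ring) hk
  have h2 := (smul_eq_zero.1 h0).resolve_right (volForm_ne_zero b)
  refine (mul_eq_zero.1 h2).resolve_right ?_
  exact_mod_cast (Nat.choose_pos (Nat.lt_succ_iff.1 hk)).ne'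

theorem mem_plusSpace_iff {ξ : ExteriorAlgebra ℂ V} : ξ ∈ plusSpace b ↔
    ∃ c : ℕ → ℂ, ∑ k ∈ Finset.range (p + 1), c k • volCoeff b k = ξ := by
  constructor
  · intro h
    obtain ⟨c, hc⟩ := (Submodule.mem_span_range_iff_exists_fun ℂ).1 h
    refine ⟨fun k => if hk : k < p + 1 then c ⟨k, hk⟩ else 0, ?_⟩
    rw [← hc, Finset.sum_range]
    refine Finset.sum_congr rfl fun k _ => by simp only [Fin.is_lt, dite_true, Fin.eta]
  · rintro ⟨c, rfl⟩
    exact Submodule.sum_mem _ fun k hk =>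
      Submodule.smul_mem _ _ (volCoeff_mem_plusSpace b (Finset.mem_range.1 hk))

theorem plusSpace_inf_lowerSpace {ξ : ExteriorAlgebra ℂ V} (h : ξ ∈ plusSpace b)
    (h' : ξ ∈ lowerSpace b) : ξ = 0 := by
  obtain ⟨c, rfl⟩ := (mem_plusSpace_iff b).1 h
  exact Finset.sum_eq_zero fun k hk => by
    rw [coeff_eq_zero_of_mem_lowerSpace b h' (Finset.mem_range.1 hk), zero_smul]

theorem finrank_plusSpace : finrank ℂ (plusSpace b) = p + 1 := by
  have hli : LinearIndependent ℂ fun k : Fin (p + 1) => volCoeff b k := by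
    rw [Fintype.linearIndependent_iff]
    intro g hg k
    have := coeff_eq_zero_of_mem_lowerSpace b (c := fun k => if hk : k < p + 1 then g ⟨k, hk⟩ else 0)
      (by
        rw [Finset.sum_range]
        simp only [Fin.is_lt, dite_true, Fin.eta, hg]
        exact zero_mem _) k.2
    simpa only [Fin.is_lt, dite_true, Fin.eta] using this
  rw [plusSpace, finrank_span_eq_card hli, Fintype.card_fin]

/-! ### The wedge product on the two summands -/

/-- Next to `volForm b ![1, t]` the form ξ may be replaced by its image under a rank-one matrix, and
that image is zero. -/
theorem mul_eq_zero_of_mem {ξ ζ : ExteriorAlgebra ℂ V} (hξ : ξ ∈ lowerSpace b)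
    (hζ : ζ ∈ plusSpace b) : ξ * ζ = 0 := by
  have : plusSpace b ≤ LinearMap.ker (LinearMap.mulLeft ℂ ξ) :=
    plusSpace_le_of_volForm_mem b fun t => by
      rw [LinearMap.mem_ker, LinearMap.mulLeft_apply]
      -- This matrix is the projection onto (0,1) along (1,t): it sends w to w - w₀ (1,t).
      rw [← formMat_mul_volForm b (Matrix.vecMulVec ![0, 1] ![-t, 1]) ![1, t] (fun w =>
        ⟨-w 0, by
          rw [Matrix.vecMulVec_mulVec]
          funext i
          fin_cases i <;> simp [dotProduct, Fin.sum_univ_two]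
          ring⟩) ξ, hξ.2, zero_mul]
  exact this hζ

/-- With `volForm b ![1, s]` as right factor, the left factor may be projected along (1,s) onto
(0,1), after which the right factor may be projected along (0,1) onto (1,0). The coefficient of s^l
gives the formula. -/
theorem volCoeff_mul_volCoeff {k l : ℕ} (h : k + l = p) :
    volCoeff b k * volCoeff b l =
      ((-1) ^ l * p.choose k : ℂ) • (volForm b ![0, 1] * volForm b ![1, 0]) := by
  have key : ∀ s : ℂ, volCoeff b k * volForm b ![1, s] =
      ((-s) ^ l * p.choose k) • (volForm b ![0, 1] * volForm b ![1, 0]) := by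
    intro s
    rw [← formMat_mul_volForm b (Matrix.vecMulVec ![0, 1] ![-s, 1]) ![1, s] (fun w =>
        ⟨-w 0, by
          rw [Matrix.vecMulVec_mulVec]
          funext i
          fin_cases i <;> simp [dotProduct, Fin.sum_univ_two]
          ring⟩) (volCoeff b k), formMat_vecMulVec_volCoeff b _ _ (by omega), smul_mul_assoc]
    rw [← volForm_mul_formMat b (Matrix.vecMulVec ![1, 0] ![1, 0]) ![0, 1] (fun w =>
        ⟨-w 1, by
          rw [Matrix.vecMulVec_mulVec]
          funext i
          fin_cases i <;> simp [dotProduct, Fin.sum_univ_two]⟩) (volForm b ![1, s]),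
      formMat_vecMulVec_volForm]
    have : p - k = l := by omega
    simp [this]
  have := coeff_eq_of_infinite (d := p + 1)
    (c := fun j => volCoeff b k * volCoeff b j)
    (c' := fun j => if j = l then
      ((-1) ^ l * p.choose k : ℂ) • (volForm b ![0, 1] * volForm b ![1, 0]) else 0)
    (Set.infinite_univ (α := ℂ)) (fun s _ => by
      have h1 := key s
      rw [volForm_one_eq_sum, Finset.mul_sum] at h1
      simp only [mul_smul_comm] at h1
      rw [h1]
      simp only [smul_ite, smul_zero, Finset.sum_ite_eq', Finset.mem_range,
        if_pos (show l < p + 1 by omega), smul_smul]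
      congr 1
      rw [neg_pow]
      ring) (k := l) (by omega)
  simpa using this

theorem volCoeff_mul_volCoeff_ne_zero {k l : ℕ} (h : k + l = p) :
    volCoeff b k * volCoeff b l ≠ 0 := by
  rw [volCoeff_mul_volCoeff b h]
  refine smul_ne_zero (mul_ne_zero (by simp) ?_) (volForm_mul_volForm_ne_zero b)
  exact_mod_cast (Nat.choose_pos (by omega)).ne'

/-- A form of type `(p-k, k)` is in `lowerSpace` as soon as one generic matrix of rank one
annihilates it. -/
theorem mem_lowerSpace_of_weight {ξ : ExteriorAlgebra ℂ V} (hξ : ξ ∈ ⋀[ℂ]^p V) {k : ℕ}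
    (hk : ∀ y : ℂ, formMat b !![1, 0; 0, y] ξ = y ^ k • ξ)
    (h : formMat b !![1, 1; 0, 0] ξ = 0) : ξ ∈ lowerSpace b := by
  refine ⟨hξ, fun u w => ?_⟩
  have key : ∀ x y : ℂ, x ≠ 0 → formMat b (Matrix.vecMulVec u ![x, y]) ξ = 0 := by
    intro x y hx
    -- For x ≠ 0 the matrix u (x,y)ᵀ factors through diag(1, y/x), which only scales ξ, followed by
    -- the given rank-one matrix, which kills it.
    have e : Matrix.vecMulVec u ![x, y] =
        x • (!![u 0, 0; u 1, 0] * (!![1, 1; 0, 0] * !![1, 0; 0, y / x])) := by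
      ext i j
      fin_cases i <;> fin_cases j <;> simp [Matrix.vecMulVec_apply] <;> field_simp
    rw [e, formMat_smul b _ _ hξ, formMat_mul, formMat_mul, hk, map_smul, h]
    simp
  -- The case w₀ = 0 is reached by moving w₀ to w₀ + t and using polynomial dependence on t.
  have := formMat_mem_of_infinite b ⊥ (Matrix.vecMulVec u w) (Matrix.vecMulVec u ![1, 0]) hξ
    (infinite_ne (-w 0)) (fun t ht => by
      have e : Matrix.vecMulVec u w + t • Matrix.vecMulVec u ![1, 0] =
          Matrix.vecMulVec u ![w 0 + t, w 1] := by
        ext i j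
        fin_cases i <;> fin_cases j <;> simp [Matrix.vecMulVec_apply] <;> ring
      rw [e, Submodule.mem_bot]
      exact key _ _ fun h0 => ht (eq_neg_of_add_eq_zero_right h0)) 0
  simpa using this

end PlusLower

end Hypercomplex
end

noncomputable section
namespace Hypercomplex

open ExteriorAlgebra Module

/-! ### Subspaces stable under all matrices -/

section Stable

variable {V : Type*} [AddCommGroup V] [Module ℂ V] {p : ℕ} (b : Basis (Fin 2 × Fin p) ℂ V)

/-- A subspace of the exterior algebra which is stable under all `2 × 2` matrices. -/
def IsMatStable (U : Submodule ℂ (ExteriorAlgebra ℂ V)) : Prop :=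
  ∀ m : Matrix (Fin 2) (Fin 2) ℂ, ∀ u ∈ U, formMat b m u ∈ U

/-- A minimal non-zero subspace among those which are stable under all `2 × 2` matrices. -/
structure IsMatIrreducible (U : Submodule ℂ (ExteriorAlgebra ℂ V)) : Prop where
  stable : IsMatStable b U
  ne_bot : U ≠ ⊥
  eq_bot_or_eq : ∀ W ≤ U, IsMatStable b W → W = ⊥ ∨ W = U

/-- The scalar depends on w alone, because u wᵀ is (1,0) wᵀ followed by a matrix taking (1,0) to u.
-/
theorem exists_forall_formMat_vecMulVec (w : Fin 2 → ℂ) {ξ : ExteriorAlgebra ℂ V}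
    (hξ : ξ ∈ ⋀[ℂ]^p V) :
    ∃ t : ℂ, ∀ u, formMat b (Matrix.vecMulVec u w) ξ = t • volForm b u := by
  obtain ⟨t, ht⟩ := formMat_vecMulVec b ![1, 0] w hξ
  refine ⟨t, fun u => ?_⟩
  have e' : !![u 0, 0; u 1, 0].mulVec ![1, 0] = u := by
    funext i
    fin_cases i <;> simp [Matrix.mulVec, dotProduct]
  have e : Matrix.vecMulVec u w = !![u 0, 0; u 1, 0] * Matrix.vecMulVec ![1, 0] w := by
    rw [Matrix.mul_vecMulVec, e']
  rw [e, formMat_mul, ht, map_smul, formMat_volForm, e']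

/-- If some u wᵀ does not kill ξ ∈ U, then with this w fixed and u arbitrary, ξ is sent to the same
non-zero multiple of every `volForm b u`, so U contains them all. -/
theorem le_lowerSpace_or_plusSpace_le {U : Submodule ℂ (ExteriorAlgebra ℂ V)}
    (hU : U ≤ ⋀[ℂ]^p V) (hs : IsMatStable b U) : U ≤ lowerSpace b ∨ plusSpace b ≤ U := by
  by_cases h : U ≤ lowerSpace b
  · exact Or.inl h
  right
  obtain ⟨ξ, hξ, hn⟩ := Set.not_subset.1 h
  have : ∃ u w, formMat b (Matrix.vecMulVec u w) ξ ≠ 0 := by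
    by_contra! h
    exact hn ⟨hU hξ, h⟩
  obtain ⟨u, w, hw⟩ := this
  obtain ⟨t, ht⟩ := exists_forall_formMat_vecMulVec b w (hU hξ)
  have ht0 : t ≠ 0 := fun h0 => hw (by rw [ht, h0, zero_smul])
  refine plusSpace_le_of_volForm_mem b fun s => ?_
  have := hs (Matrix.vecMulVec ![1, s] w) ξ hξ
  rw [ht] at this
  exact (Submodule.smul_mem_iff U ht0).1 this

theorem plusSpace_ne_bot : plusSpace b ≠ ⊥ := fun h =>
  volForm_ne_zero b ((Submodule.eq_bot_iff _).1 h _ (volForm_mem_plusSpace b _))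

theorem isMatIrreducible_plusSpace : IsMatIrreducible b (plusSpace b) where
  stable := fun m _ hu => formMat_mem_plusSpace b m hu
  ne_bot := plusSpace_ne_bot b
  eq_bot_or_eq := fun W hW hs => by
    rcases le_lowerSpace_or_plusSpace_le b (hW.trans (plusSpace_le b)) hs with h | h
    · left
      rw [Submodule.eq_bot_iff]
      exact fun x hx => plusSpace_inf_lowerSpace b (hW hx) (h hx)
    · exact Or.inr (le_antisymm hW h)

theorem IsMatIrreducible.le_lowerSpace_or_eq {U : Submodule ℂ (ExteriorAlgebra ℂ V)}
    (h : IsMatIrreducible b U) (hU : U ≤ ⋀[ℂ]^p V) : U ≤ lowerSpace b ∨ U = plusSpace b := by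
  refine (le_lowerSpace_or_plusSpace_le b hU h.stable).imp_right fun h' => ?_
  exact ((h.eq_bot_or_eq _ h' fun m _ hu => formMat_mem_plusSpace b m hu).resolve_left
    (plusSpace_ne_bot b)).symm

/-! ### Weights -/

/-- `ξ` has weight `k`, that is, it is of type `(p-k, k)` if its degree is `p`. -/
def HasWeight (k : ℕ) (ξ : ExteriorAlgebra ℂ V) : Prop :=
  ∀ y : ℂ, formMat b !![1, 0; 0, y] ξ = y ^ k • ξ

/-- The coefficients of the curve y ↦ diag(1,y) ξ are the weight components of ξ, by comparison of
coefficients in diag(1,yx) = diag(1,y) diag(1,x). -/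
theorem exists_weight_expansion {ξ : ExteriorAlgebra ℂ V} (hξ : ξ ∈ ⋀[ℂ]^p V) :
    ∃ c : ℕ → ExteriorAlgebra ℂ V,
      (∀ y : ℂ, formMat b !![1, 0; 0, y] ξ = ∑ k ∈ Finset.range (p + 1), y ^ k • c k) ∧
      (∀ k < p + 1, HasWeight b k (c k)) := by
  obtain ⟨c, hc⟩ := exists_formMat_expansion b !![1, 0; 0, 0] !![0, 0; 0, 1] hξ
  have h1 : ∀ y : ℂ, formMat b !![1, 0; 0, y] ξ =
      ∑ k ∈ Finset.range (p + 1), y ^ k • c k := by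
    intro y
    have := hc 1 y
    simpa using this
  refine ⟨c, h1, fun k hk y => ?_⟩
  refine coeff_eq_of_infinite (d := p + 1) (c := fun k => formMat b !![1, 0; 0, y] (c k))
    (c' := fun k => y ^ k • c k) (Set.infinite_univ (α := ℂ)) (fun x _ => ?_) hk
  have e : !![1, 0; 0, y * x] = !![1, 0; 0, y] * !![1, 0; 0, x] := by simp
  have h2 := h1 (y * x)
  rw [e, formMat_mul, h1 x, map_sum] at h2
  simp only [map_smul] at h2
  rw [h2]
  exact Finset.sum_congr rfl fun i _ => by rw [smul_smul, mul_pow, mul_comm]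

theorem coeff_mem_of_weight_expansion {U : Submodule ℂ (ExteriorAlgebra ℂ V)}
    (hs : IsMatStable b U) {ξ : ExteriorAlgebra ℂ V} (hξ : ξ ∈ U) {c : ℕ → ExteriorAlgebra ℂ V}
    {d : ℕ} {f : ℂ → Matrix (Fin 2) (Fin 2) ℂ}
    (h : ∀ y : ℂ, formMat b (f y) ξ = ∑ k ∈ Finset.range d, y ^ k • c k) {k : ℕ} (hk : k < d) :
    c k ∈ U :=
  coeff_mem_of_infinite U (Set.infinite_univ (α := ℂ)) (fun y _ => h y ▸ hs _ _ hξ) hk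

theorem sum_weight_expansion {ξ : ExteriorAlgebra ℂ V} {c : ℕ → ExteriorAlgebra ℂ V} {d : ℕ}
    (h : ∀ y : ℂ, formMat b !![1, 0; 0, y] ξ = ∑ k ∈ Finset.range d, y ^ k • c k) :
    ξ = ∑ k ∈ Finset.range d, c k := by
  have := h 1
  rw [← Matrix.one_fin_two, formMat_one] at this
  simpa using this

theorem eq_zero_of_lt_weight {ξ : ExteriorAlgebra ℂ V} (hξ : ξ ∈ ⋀[ℂ]^p V) {k : ℕ}
    (h : HasWeight b k ξ) (hk : p < k) : ξ = 0 := by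
  obtain ⟨c, hc, -⟩ := exists_weight_expansion b hξ
  have := coeff_eq_of_infinite (d := k + 1) (c := fun i => if i < p + 1 then c i else 0)
    (c' := fun i => if i = k then ξ else 0) (Set.infinite_univ (α := ℂ)) (fun y _ => by
      have h1 := h y
      rw [hc] at h1
      simp only [smul_ite, smul_zero, Finset.sum_ite_eq', Finset.mem_range,
        if_pos (show k < k + 1 by omega), ← h1]
      rw [← Finset.sum_filter]
      congr 1
      ext i
      simp only [Finset.mem_filter, Finset.mem_range]
      omega) (k := k) (by omega)
  simp only [if_neg (show ¬ k < p + 1 by omega), if_true] at this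
  exact this.symm

/-- The singular matrix at y = 0 is covered by polynomial dependence on y. -/
theorem hasWeight_of_ne_zero {ξ : ExteriorAlgebra ℂ V} (hξ : ξ ∈ ⋀[ℂ]^p V) {k : ℕ} (hk : k ≤ p)
    (h : ∀ y : ℂ, y ≠ 0 → formMat b !![1, 0; 0, y] ξ = y ^ k • ξ) : HasWeight b k ξ := by
  obtain ⟨c, hc, -⟩ := exists_weight_expansion b hξ
  have key : ∀ i < p + 1, c i = if i = k then ξ else 0 := fun i hi =>
    coeff_eq_of_infinite (d := p + 1) (c := c) (c' := fun i => if i = k then ξ else 0)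
      (infinite_ne 0) (fun y hy => by
        rw [← hc, h y hy]
        simp only [smul_ite, smul_zero, Finset.sum_ite_eq', Finset.mem_range,
          if_pos (show k < p + 1 by omega)]) hi
  intro y
  rw [hc, Finset.sum_congr rfl fun i hi => by rw [key i (Finset.mem_range.1 hi)]]
  simp only [smul_ite, smul_zero, Finset.sum_ite_eq', Finset.mem_range,
    if_pos (show k < p + 1 by omega)]

/-- The swap is the Weyl reflection: it conjugates diag(1,y) into y · diag(1,1/y), and the scalar y
contributes yᵖ in degree p. -/
theorem hasWeight_swap {ξ : ExteriorAlgebra ℂ V} (hξ : ξ ∈ ⋀[ℂ]^p V) {k : ℕ} (hk : k ≤ p)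
    (h : HasWeight b k ξ) : HasWeight b (p - k) (formMat b !![0, 1; 1, 0] ξ) := by
  refine hasWeight_of_ne_zero b (formMat_mem b _ hξ) (by omega) fun y hy => ?_
  have e : !![1, 0; 0, y] * !![0, 1; 1, 0] =
      y • (!![0, 1; 1, 0] * !![1, 0; 0, y⁻¹]) := by
    ext i j
    fin_cases i <;> fin_cases j <;> simp [hy]
  rw [← formMat_mul, e, formMat_smul b _ _ hξ, formMat_mul, h, map_smul, smul_smul]
  congr 1
  rw [inv_pow, pow_sub₀ _ hy hk]

theorem formMat_swap_swap (ξ : ExteriorAlgebra ℂ V) :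
    formMat b !![0, 1; 1, 0] (formMat b !![0, 1; 1, 0] ξ) = ξ := by
  rw [← formMat_mul]
  have : !![0, 1; 1, 0] * !![0, 1; 1, 0] = (1 : Matrix (Fin 2) (Fin 2) ℂ) := by
    ext i j
    fin_cases i <;> fin_cases j <;> simp
  rw [this, formMat_one]

/-- A vector of minimal weight is fixed by the upper triangular unipotent matrices. -/
theorem formMat_upper_of_minimal {U : Submodule ℂ (ExteriorAlgebra ℂ V)}
    (hU : U ≤ ⋀[ℂ]^p V) (hs : IsMatStable b U) {k : ℕ} {v : ExteriorAlgebra ℂ V} (hv : v ∈ U)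
    (hw : HasWeight b k v) (hmin : ∀ i < k, ∀ u ∈ U, HasWeight b i u → u = 0) (hk : k ≤ p) (s : ℂ) :
    formMat b !![1, s; 0, 1] v = v := by
  obtain ⟨c, hc'⟩ := exists_formMat_expansion b 1 !![0, 1; 0, 0] (hU hv)
  have hc : ∀ s : ℂ, formMat b !![1, s; 0, 1] v = ∑ j ∈ Finset.range (p + 1), s ^ j • c j := by
    intro s
    have := hc' 1 s
    simpa [Matrix.one_fin_two] using this
  have hcU : ∀ j < p + 1, c j ∈ U := fun j hj => coeff_mem_of_weight_expansion b hs hv hc hj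
  -- In effect `c j` has weight k - j; the form with yʲ on the left avoids subtraction and covers j
  -- > k.
  have h1 : ∀ y : ℂ, ∀ j < p + 1, y ^ j • formMat b !![1, 0; 0, y] (c j) = y ^ k • c j := by
    intro y j hj
    refine coeff_eq_of_infinite (d := p + 1)
      (c := fun j => y ^ j • formMat b !![1, 0; 0, y] (c j)) (c' := fun j => y ^ k • c j)
      (Set.infinite_univ (α := ℂ)) (fun s _ => ?_) hj
    have e : !![1, 0; 0, y] * !![1, s * y; 0, 1] = !![1, s; 0, 1] * !![1, 0; 0, y] := by simp
    have h2 := formMat_mul b !![1, 0; 0, y] !![1, s * y; 0, 1] v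
    rw [e, formMat_mul, hw, map_smul, hc, hc, map_sum, Finset.smul_sum] at h2
    simp only [map_smul] at h2
    calc _ = _ := Finset.sum_congr rfl fun i _ => by rw [smul_smul, ← mul_pow]
      _ = _ := h2.symm
      _ = _ := Finset.sum_congr rfl fun i _ => by rw [smul_comm]
  -- The weight components of `c j` below k vanish by minimality. The coefficient of yᵏ in `h1`
  -- equates `c j` with its component of weight k - j, or with 0 when k < j.
  have h3 : ∀ j < p + 1, j ≠ 0 → c j = 0 := by
    intro j hj hj0
    obtain ⟨d, hd, hdw⟩ := exists_weight_expansion b (hU (hcU j hj))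
    have hd0 : ∀ i < k, d i = 0 := fun i hi =>
      hmin i hi _ (coeff_mem_of_weight_expansion b hs (hcU j hj) hd (by omega))
        (hdw i (by omega))
    have := coeff_eq_of_infinite (d := j + (p + 1))
      (c := fun m => if m < j then 0 else d (m - j)) (c' := fun m => if m = k then c j else 0)
      (Set.infinite_univ (α := ℂ)) (fun y _ => by
        have h4 := h1 y j hj
        rw [hd, Finset.smul_sum] at h4
        simp only [smul_ite, smul_zero, Finset.sum_ite_eq', Finset.mem_range,
          if_pos (show k < j + (p + 1) by omega), ← h4]
        rw [Finset.sum_range_add]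
        rw [Finset.sum_eq_zero (s := Finset.range j) fun i hi => if_pos (Finset.mem_range.1 hi),
          zero_add]
        refine Finset.sum_congr rfl fun i _ => ?_
        rw [if_neg (by omega), smul_smul, pow_add, Nat.add_sub_cancel_left]) (k := k) (by omega)
    simp only [if_true] at this
    rw [← this]
    split_ifs with hkj
    · rfl
    · exact hd0 _ (by omega)
  have h0 : c 0 = v := by
    have := hc 0
    rw [← Matrix.one_fin_two, formMat_one, Finset.sum_eq_single 0] at this
    · simpa using this.symm
    · intro j _ hj0
      simp [hj0]
    · simp
  rw [hc, Finset.sum_eq_single 0]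
  · simpa using h0
  · intro j hj hj0
    rw [h3 j (Finset.mem_range.1 hj) hj0, smul_zero]
  · simp

theorem IsMatIrreducible.eq_span_of_mem {U : Submodule ℂ (ExteriorAlgebra ℂ V)}
    (h : IsMatIrreducible b U) {v : ExteriorAlgebra ℂ V} (hv : v ∈ U) (hv0 : v ≠ 0) :
    Submodule.span ℂ (Set.range fun m => formMat b m v) = U := by
  have hmem : v ∈ Submodule.span ℂ (Set.range fun m => formMat b m v) :=
    Submodule.subset_span ⟨1, formMat_one b v⟩
  refine (h.eq_bot_or_eq _ ?_ ?_).resolve_left fun h0 => hv0 ((Submodule.eq_bot_iff _).1 h0 _ hmem)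
  · rw [Submodule.span_le]
    rintro _ ⟨m, rfl⟩
    exact h.stable m v hv
  · intro m u hu
    induction hu using Submodule.span_induction with
    | mem x hx =>
      obtain ⟨m', rfl⟩ := hx
      exact Submodule.subset_span ⟨m * m', formMat_mul b m m' v⟩
    | zero => simp
    | add x y _ _ hx hy => rw [map_add]; exact add_mem hx hy
    | smul a x _ hx => rw [map_smul]; exact Submodule.smul_mem _ _ hx

/-- An irreducible subspace of `lowerSpace` has dimension less than `p + 1`. -/
theorem IsMatIrreducible.finrank_lt {U : Submodule ℂ (ExteriorAlgebra ℂ V)}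
    (h : IsMatIrreducible b U) (hU : U ≤ lowerSpace b) : finrank ℂ U < p + 1 := by
  classical
  have hUp : U ≤ ⋀[ℂ]^p V := hU.trans (lowerSpace_le b)
  have hex : ∃ k, ∃ v ∈ U, v ≠ 0 ∧ HasWeight b k v := by
    obtain ⟨u, hu, hu0⟩ := Submodule.exists_mem_ne_zero_of_ne_bot h.ne_bot
    obtain ⟨c, hc, hcw⟩ := exists_weight_expansion b (hUp hu)
    by_contra! hno
    refine hu0 ?_
    rw [sum_weight_expansion b hc]
    refine Finset.sum_eq_zero fun k hk => ?_
    by_contra hk0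
    have hk := Finset.mem_range.1 hk
    exact hno k _ (coeff_mem_of_weight_expansion b h.stable hu hc hk) hk0 (hcw k hk)
  obtain ⟨v, hv, hv0, hw⟩ := Nat.find_spec hex
  have hmin : ∀ i < Nat.find hex, ∀ u ∈ U, HasWeight b i u → u = 0 := by
    intro i hi u hu hui
    by_contra hu0
    exact Nat.find_min hex hi ⟨u, hu, hu0, hui⟩
  generalize Nat.find hex = k at hw hmin
  have hkp : k ≤ p := by
    by_contra hk
    exact hv0 (eq_zero_of_lt_weight b (hUp hv) hw (by omega))
  have hk0 : k ≠ 0 := by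
    rintro rfl
    refine hv0 ?_
    -- At weight 0 the matrix diag(1,0) would fix v, as 0⁰ = 1; but it has rank one and kills
    -- `lowerSpace`.
    have h1 := hw 0
    have e : !![1, 0; 0, (0 : ℂ)] = Matrix.vecMulVec ![1, 0] ![1, 0] := by
      ext i j
      fin_cases i <;> fin_cases j <;> simp [Matrix.vecMulVec_apply]
    rw [e, (hU hv).2] at h1
    simpa using h1.symm
  obtain ⟨w, hw'⟩ := exists_formMat_expansion b 1 !![0, 0; 1, 0] (hUp hv)
  have hwt : ∀ t : ℂ, formMat b !![1, 0; t, 1] v = ∑ j ∈ Finset.range (p + 1), t ^ j • w j := by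
    intro t
    have := hw' 1 t
    simpa [Matrix.one_fin_two] using this
  have hwU : ∀ j < p + 1, w j ∈ U := fun j hj => coeff_mem_of_weight_expansion b h.stable hv hwt hj
  -- The coefficients of the lower unipotent orbit of v climb in weight one step at a time.
  have hww : ∀ j < p + 1, HasWeight b (k + j) (w j) := by
    intro j hj y
    refine coeff_eq_of_infinite (d := p + 1)
      (c := fun j => formMat b !![1, 0; 0, y] (w j)) (c' := fun j => y ^ (k + j) • w j)
      (Set.infinite_univ (α := ℂ)) (fun t _ => ?_) hj
    have e : !![1, 0; 0, y] * !![1, 0; t, 1] = !![1, 0; y * t, 1] * !![1, 0; 0, y] := by simp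
    have h2 := formMat_mul b !![1, 0; 0, y] !![1, 0; t, 1] v
    rw [e, formMat_mul, hw, map_smul, hwt, hwt, map_sum, Finset.smul_sum] at h2
    simp only [map_smul] at h2
    rw [← h2]
    exact Finset.sum_congr rfl fun i _ => by rw [smul_smul, smul_smul]; congr 1; ring
  -- The swap would give these coefficients weight p - k - j < k, below the minimum. So only `w 0`,
  -- …, `w (p - 2k)` remain, and k > 0 makes their number less than p + 1.
  have hwz : ∀ j < p + 1, p < j + 2 * k → w j = 0 := by
    intro j hj hjk
    by_cases hle : k + j ≤ p
    · have h1 := hmin _ (by omega) _ (h.stable _ _ (hwU j hj))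
        (hasWeight_swap b (hUp (hwU j hj)) hle (hww j hj))
      rw [← formMat_swap_swap b (w j), h1, map_zero]
    · exact eq_zero_of_lt_weight b (hUp (hwU j hj)) (hww j hj) (by omega)
  have hspan : U ≤ Submodule.span ℂ (Set.range fun j : Fin (p + 1 - 2 * k) => w j) := by
    rw [← h.eq_span_of_mem b hv hv0, Submodule.span_le]
    rintro _ ⟨m, rfl⟩
    have key : ∀ m : Matrix (Fin 2) (Fin 2) ℂ, m 0 0 ≠ 0 →
        formMat b m v ∈ Submodule.span ℂ (Set.range fun j : Fin (p + 1 - 2 * k) => w j) := by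
      intro m hm
      -- LDU factorization: the upper factor fixes v, the diagonal one scales it, and the lower one
      -- yields a combination of the `w j`.
      have e : m = m 0 0 • (!![1, 0; m 1 0 / m 0 0, 1] *
          (!![1, 0; 0, m 1 1 / m 0 0 - m 0 1 * m 1 0 / m 0 0 ^ 2] *
            !![1, m 0 1 / m 0 0; 0, 1])) := by
        ext i j
        fin_cases i <;> fin_cases j <;> simp <;> field_simp
        ring
      rw [e, formMat_smul b _ _ (hUp hv), formMat_mul, formMat_mul,
        formMat_upper_of_minimal b hUp h.stable hv hw hmin hkp, hw, map_smul, hwt]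
      refine Submodule.smul_mem _ _ (Submodule.smul_mem _ _ (Submodule.sum_mem _ fun j hj => ?_))
      have hj := Finset.mem_range.1 hj
      by_cases hjk : p < j + 2 * k
      · rw [hwz j hj hjk, smul_zero]
        exact zero_mem _
      · exact Submodule.smul_mem _ _ (Submodule.subset_span ⟨⟨j, by omega⟩, rfl⟩)
    -- Matrices with m₀₀ = 0 are reached along the line m + t · 1.
    have := formMat_mem_of_infinite b _ m 1 (hUp hv) (infinite_ne (-m 0 0))
      (fun t ht => key (m + t • 1) fun h0 => ht (by
        have h1 : m 0 0 + t = 0 := by simpa using h0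
        exact eq_neg_of_add_eq_zero_right h1)) 0
    simpa using this
  have : Module.Finite ℂ (Submodule.span ℂ (Set.range fun j : Fin (p + 1 - 2 * k) => w j)) :=
    FiniteDimensional.span_of_finite ℂ (Set.finite_range _)
  have h1 := Submodule.finrank_mono hspan
  have h2 := finrank_range_le_card (R := ℂ) (fun j : Fin (p + 1 - 2 * k) => w j)
  rw [Set.finrank, Fintype.card_fin] at h2
  omega

end Stable

end Hypercomplex
end

noncomputable section
namespace Hypercomplex

open ExteriorAlgebra Module

/-! ### From unit quaternions to all complex 2 × 2 matrices. -/

section QuaternionStable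

variable {V : Type*} [AddCommGroup V] [Module ℂ V] {p : ℕ} (b : Basis (Fin 2 × Fin p) ℂ V)

/-- The complex matrix by which a quaternion acts. -/
def quatMat (h : ℍ[ℝ]) : Matrix (Fin 2) (Fin 2) ℂ :=
  !![h.re + h.imI * Complex.I, -(h.imJ + h.imK * Complex.I);
    h.imJ - h.imK * Complex.I, h.re - h.imI * Complex.I]

theorem quatMat_eq (h : ℍ[ℝ]) : quatMat h = (h.re : ℂ) • (1 : Matrix (Fin 2) (Fin 2) ℂ) +
    (h.imI : ℂ) • !![Complex.I, 0; 0, -Complex.I] + (h.imJ : ℂ) • !![0, -1; 1, 0] +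
    (h.imK : ℂ) • !![0, -Complex.I; -Complex.I, 0] := by
  ext i j
  fin_cases i <;> fin_cases j <;> simp [quatMat] <;> ring

/-- A space of forms of degree `p` which is stable under the unit quaternions is stable under all
complex matrices, as these are the complex linear combinations of the quaternions. -/
theorem isMatStable_of_quaternion {U : Submodule ℂ (ExteriorAlgebra ℂ V)} (hU : U ≤ ⋀[ℂ]^p V)
    (hs : ∀ h : ℍ[ℝ], ‖h‖ = 1 → ∀ u ∈ U, formMat b (quatMat h) u ∈ U) : IsMatStable b U := by
  intro m u hu
  -- A real factor r acts on forms of degree p by rᵖ, so the restriction to norm one can be dropped.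
  have h0 : ∀ h : ℍ[ℝ], formMat b (quatMat h) u ∈ U := by
    intro h
    obtain ⟨r, h', hn, rfl⟩ : ∃ (r : ℝ) (h' : ℍ[ℝ]), ‖h'‖ = 1 ∧ h = r • h' := by
      by_cases hz : h = 0
      · exact ⟨0, 1, by simp, by simp [hz]⟩
      · have : ‖h‖ ≠ 0 := norm_ne_zero_iff.2 hz
        exact ⟨‖h‖, ‖h‖⁻¹ • h, by simp [norm_smul, this], by simp [smul_smul, this]⟩
    have e : quatMat (r • h') = (r : ℂ) • quatMat h' := by
      ext i j
      fin_cases i <;> fin_cases j <;> simp [quatMat] <;> ring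
    rw [e, formMat_smul b _ _ (hU hu)]
    exact U.smul_mem _ (hs h' hn u hu)
  let f : ℂ → ℂ → ℂ → ℂ → Matrix (Fin 2) (Fin 2) ℂ := fun w x y z =>
    w • (1 : Matrix (Fin 2) (Fin 2) ℂ) + x • !![Complex.I, 0; 0, -Complex.I] +
      y • !![0, -1; 1, 0] + z • !![0, -Complex.I; -Complex.I, 0]
  have h1 : ∀ w x y z : ℝ, formMat b (f w x y z) u ∈ U := by
    intro w x y z
    exact (congrArg (fun m => formMat b m u ∈ U) (quatMat_eq ⟨w, x, y, z⟩)).mp (h0 _)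
  -- The four real coordinates are made complex one at a time, each time by polynomial dependence
  -- along a line.
  have h2 : ∀ (w : ℂ) (x y z : ℝ), formMat b (f w x y z) u ∈ U := by
    intro w x y z
    have e : ∀ t, f t x y z = f 0 x y z + t • 1 := fun t => by simp only [f]; module
    rw [e]
    refine formMat_mem_of_infinite b U _ _ (hU hu) infinite_range_ofReal ?_ w
    rintro _ ⟨t, rfl⟩
    rw [← e]
    exact h1 t x y z
  have h3 : ∀ (w x : ℂ) (y z : ℝ), formMat b (f w x y z) u ∈ U := by
    intro w x y z
    have e : ∀ t, f w t y z = f w 0 y z + t • !![Complex.I, 0; 0, -Complex.I] := fun t => by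
      simp only [f]; module
    rw [e]
    refine formMat_mem_of_infinite b U _ _ (hU hu) infinite_range_ofReal ?_ x
    rintro _ ⟨t, rfl⟩
    rw [← e]
    exact h2 w t y z
  have h4 : ∀ (w x y : ℂ) (z : ℝ), formMat b (f w x y z) u ∈ U := by
    intro w x y z
    have e : ∀ t, f w x t z = f w x 0 z + t • !![0, -1; 1, 0] := fun t => by
      simp only [f]; module
    rw [e]
    refine formMat_mem_of_infinite b U _ _ (hU hu) infinite_range_ofReal ?_ y
    rintro _ ⟨t, rfl⟩
    rw [← e]
    exact h3 w x t z
  have h5 : ∀ w x y z : ℂ, formMat b (f w x y z) u ∈ U := by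
    intro w x y z
    have e : ∀ t, f w x y t = f w x y 0 + t • !![0, -Complex.I; -Complex.I, 0] := fun t => by
      simp only [f]; module
    rw [e]
    refine formMat_mem_of_infinite b U _ _ (hU hu) infinite_range_ofReal ?_ z
    rintro _ ⟨t, rfl⟩
    rw [← e]
    exact h4 w x y t
  have e : m = f ((m 0 0 + m 1 1) / 2) (-Complex.I * (m 0 0 - m 1 1) / 2)
      ((m 1 0 - m 0 1) / 2) (Complex.I * (m 1 0 + m 0 1) / 2) := by
    ext i j
    fin_cases i <;> fin_cases j <;> simp [f] <;> ring_nf <;> simp <;> ring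
  rw [e]
  exact h5 _ _ _ _

end QuaternionStable

/-! ### Complete reducibility -/

section Reducibility

variable {V : Type*} [AddCommGroup V] [Module ℂ V]

/-- The Hermitian form on `⋀ᵖ V` for which the exterior products of the vectors of a basis of `V`
are orthonormal. -/
def hermForm {N : ℕ} (e : Basis (Fin N) ℂ V) (p : ℕ) (x y : ⋀[ℂ]^p V) : ℂ :=
  ∑ s, (starRingEnd ℂ) ((e.exteriorPower p).repr x s) * (e.exteriorPower p).repr y s

/-- The matrix of ⋀ᵖA consists of p × p minors of A, and passing to the conjugate transpose of A
conjugates and transposes the matrix of minors. -/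
theorem hermForm_map {N : ℕ} (e : Basis (Fin N) ℂ V) (p : ℕ) {A A' : V →ₗ[ℂ] V}
    (hA : ∀ i j, e.repr (A (e j)) i = (starRingEnd ℂ) (e.repr (A' (e i)) j)) (x y : ⋀[ℂ]^p V) :
    hermForm e p (exteriorPower.map p A x) y = hermForm e p x (exteriorPower.map p A' y) := by
  let B := e.exteriorPower p
  have h1 : ∀ (C : V →ₗ[ℂ] V) (s t), B.repr (exteriorPower.map p C (B s)) t =
      (Matrix.of fun i j => e.repr (C (e (Set.powersetCard.ofFinEmbEquiv.symm s i)))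
        (Set.powersetCard.ofFinEmbEquiv.symm t j)).det := by
    intro C s t
    simp only [B]
    rw [exteriorPower.basis_apply, exteriorPower.map_apply_ιMulti_family,
      exteriorPower.basis_repr_apply, exteriorPower.ιMulti_family,
      exteriorPower.ιMultiDual_apply_ιMulti]
    rfl
  have h2 : ∀ s t, (starRingEnd ℂ) (B.repr (exteriorPower.map p A (B s)) t) =
      B.repr (exteriorPower.map p A' (B t)) s := by
    intro s t
    rw [h1, h1, RingHom.map_det, ← Matrix.det_transpose]
    congr 1
    ext i j
    simp [hA]
  have h3 : ∀ (C : V →ₗ[ℂ] V) (z : ⋀[ℂ]^p V) t, B.repr (exteriorPower.map p C z) t =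
      ∑ s, B.repr z s * B.repr (exteriorPower.map p C (B s)) t := by
    intro C z t
    conv_lhs => rw [← B.sum_repr z]
    rw [map_sum, map_sum, Finsupp.finsetSum_apply]
    exact Finset.sum_congr rfl fun s _ => by
      rw [map_smul, map_smul, Finsupp.smul_apply, smul_eq_mul]
  change ∑ t, (starRingEnd ℂ) (B.repr (exteriorPower.map p A x) t) * B.repr y t =
    ∑ s, (starRingEnd ℂ) (B.repr x s) * B.repr (exteriorPower.map p A' y) s
  simp only [h3 A x, h3 A' y, map_sum, map_mul, h2, Finset.sum_mul, Finset.mul_sum]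
  rw [Finset.sum_comm]
  exact Finset.sum_congr rfl fun s _ => Finset.sum_congr rfl fun t _ => by ring

theorem coe_exteriorPower_map (p : ℕ) (A : V →ₗ[ℂ] V) (x : ⋀[ℂ]^p V) :
    (exteriorPower.map p A x : ExteriorAlgebra ℂ V) = ExteriorAlgebra.map A x := by
  have hx : x ∈ Submodule.span ℂ (Set.range (exteriorPower.ιMulti ℂ p (M := V))) := by
    rw [exteriorPower.ιMulti_span]; trivial
  induction hx using Submodule.span_induction with
  | mem y hy =>
    obtain ⟨v, rfl⟩ := hy
    rw [exteriorPower.map_apply_ιMulti, exteriorPower.ιMulti_apply_coe,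
      exteriorPower.ιMulti_apply_coe, map_apply_ιMulti]
  | zero => simp
  | add x y _ _ hx hy => simp [hx, hy]
  | smul a x _ hx => simp [hx]

variable {p : ℕ} (b : Basis (Fin 2 × Fin p) ℂ V)

theorem repr_matAct (m : Matrix (Fin 2) (Fin 2) ℂ) (i j : Fin 2 × Fin p) :
    b.repr (matAct b m (b j)) i = if i.2 = j.2 then m i.1 j.1 else 0 := by
  obtain ⟨j, a⟩ := j
  obtain ⟨i, c⟩ := i
  rw [matAct_basis, tens]
  fin_cases i <;> simp [Finsupp.single_apply, Prod.ext_iff, eq_comm]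

/-- The orthogonal complement of a stable space of forms of degree `p` is stable. -/
theorem exists_stable_isCompl {W : Submodule ℂ (ExteriorAlgebra ℂ V)} (hs : IsMatStable b W) :
    ∃ W' ≤ ⋀[ℂ]^p V, IsMatStable b W' ∧ W ⊓ W' = ⊥ ∧ (W ≤ ⋀[ℂ]^p V → W ⊔ W' = ⋀[ℂ]^p V) := by
  let e := b.reindex finProdFinEquiv
  let B := e.exteriorPower p
  -- Coordinates carry `hermForm` to the standard inner product, which supplies orthogonal
  -- complements.
  let F : ⋀[ℂ]^p V ≃ₗ[ℂ] EuclideanSpace ℂ (Set.powersetCard (Fin (2 * p)) p) :=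
    B.equivFun.trans (WithLp.linearEquiv 2 ℂ _).symm
  have hF : ∀ x y, inner ℂ (F x) (F y) = hermForm e p x y := by
    intro x y
    rw [PiLp.inner_apply]
    simp only [RCLike.inner_apply']
    rfl
  -- The adjoint of m ⊗ 1 is m* ⊗ 1, again an acting matrix; hence complements of stable spaces are
  -- stable.
  have hadj : ∀ (m : Matrix (Fin 2) (Fin 2) ℂ) (x y), hermForm e p
      (exteriorPower.map p (matAct b m) x) y =
      hermForm e p x (exteriorPower.map p (matAct b m.conjTranspose) y) := by
    intro m x y
    refine hermForm_map e p (fun i j => ?_) x y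
    simp only [e, Basis.repr_reindex_apply, Basis.reindex_apply, repr_matAct]
    split_ifs with h1 h2 h2
    · simp
    · exact absurd h1.symm h2
    · exact absurd h2.symm h1
    · simp
  let Wp : Submodule ℂ (⋀[ℂ]^p V) := W.comap (⋀[ℂ]^p V).subtype
  let Wc : Submodule ℂ (⋀[ℂ]^p V) := ((Wp.map F.toLinearMap)ᗮ).comap F.toLinearMap
  have hWc : ∀ y, y ∈ Wc ↔ ∀ x ∈ Wp, hermForm e p x y = 0 := by
    intro y
    simp only [Wc, Submodule.mem_comap, Submodule.mem_orthogonal, Submodule.mem_map]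
    constructor
    · intro h x hx
      rw [← hF]
      exact h _ ⟨x, hx, rfl⟩
    · rintro h _ ⟨x, hx, rfl⟩
      exact (hF x y).trans (h x hx)
  refine ⟨Wc.map (⋀[ℂ]^p V).subtype, Submodule.map_subtype_le _ _, ?_, ?_, ?_⟩
  · rintro m _ ⟨y, hy, rfl⟩
    refine ⟨exteriorPower.map p (matAct b m) y, ?_, coe_exteriorPower_map p _ y⟩
    rw [SetLike.mem_coe, hWc] at hy ⊢
    intro x hx
    have h := hadj m.conjTranspose x y
    rw [Matrix.conjTranspose_conjTranspose] at h
    rw [← h]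
    refine hy _ ?_
    change ((exteriorPower.map p (matAct b m.conjTranspose) x : ⋀[ℂ]^p V) :
      ExteriorAlgebra ℂ V) ∈ W
    rw [coe_exteriorPower_map]
    exact hs _ _ hx
  · rw [Submodule.eq_bot_iff]
    rintro _ ⟨hx, y, hy, rfl⟩
    have h := (hWc y).1 hy y hx
    rw [← hF, inner_self_eq_zero] at h
    simpa using h
  · intro hWp
    refine le_antisymm (sup_le hWp (Submodule.map_subtype_le _ _)) fun ξ hξ => ?_
    have hsup := Submodule.sup_orthogonal_of_hasOrthogonalProjection
      (K := Wp.map F.toLinearMap)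
    have : F ⟨ξ, hξ⟩ ∈ Wp.map F.toLinearMap ⊔ (Wp.map F.toLinearMap)ᗮ := by
      rw [hsup]; trivial
    obtain ⟨_, ⟨x, hx, rfl⟩, z, hz, hxz⟩ := Submodule.mem_sup.1 this
    have hz' : F.symm z ∈ Wc := by
      change F (F.symm z) ∈ (Wp.map F.toLinearMap)ᗮ
      rwa [F.apply_symm_apply]
    have hsum : (⟨ξ, hξ⟩ : ⋀[ℂ]^p V) = x + F.symm z := by
      apply F.injective
      rw [map_add, F.apply_symm_apply]
      exact hxz.symm
    have h2 : ξ = (x : ExteriorAlgebra ℂ V) + (F.symm z : ⋀[ℂ]^p V) := congrArg Subtype.val hsum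
    rw [h2]
    exact Submodule.add_mem_sup hx ⟨_, hz', rfl⟩

/-- Every stable space of forms of degree `p` is a sum of irreducible ones. -/
theorem le_sSup_irreducible {U : Submodule ℂ (ExteriorAlgebra ℂ V)} (hU : U ≤ ⋀[ℂ]^p V)
    (hs : IsMatStable b U) : U ≤ sSup {X | X ≤ U ∧ IsMatIrreducible b X} := by
  have : Module.Finite ℂ V := Module.Finite.of_basis b
  have hfin : ∀ X : Submodule ℂ (ExteriorAlgebra ℂ V), X ≤ ⋀[ℂ]^p V → FiniteDimensional ℂ X :=
    fun X hX => Submodule.finiteDimensional_of_le hX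
  induction hn : finrank ℂ U using Nat.strong_induction_on generalizing U with
  | _ n ih =>
    subst hn
    have hUf := hfin U hU
    by_cases h0 : U = ⊥
    · rw [h0]; exact bot_le
    by_cases hirr : IsMatIrreducible b U
    · exact le_sSup ⟨le_rfl, hirr⟩
    have : ∃ W ≤ U, IsMatStable b W ∧ W ≠ ⊥ ∧ W ≠ U := by
      by_contra! hno
      exact hirr ⟨hs, h0, fun W hW hWs => or_iff_not_imp_left.2 (hno W hW hWs)⟩
    obtain ⟨W, hWU, hWs, hW0, hWne⟩ := this
    obtain ⟨W', hW', hWs', hinf, hsup⟩ := exists_stable_isCompl b hWs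
    have hsup := hsup (hWU.trans hU)
    have hdec : U = W ⊔ (U ⊓ W') := by
      rw [inf_comm, ← sup_inf_assoc_of_le _ hWU, hsup, inf_eq_right.2 hU]
    have hlt1 : W < U := lt_of_le_of_ne hWU hWne
    have hlt2 : U ⊓ W' < U := by
      refine lt_of_le_of_ne inf_le_left fun h => hW0 ?_
      have : W ≤ W' := hWU.trans (inf_eq_left.1 h)
      rw [← hinf, inf_eq_left.2 this]
    have hs2 : IsMatStable b (U ⊓ W') := fun m u hu => ⟨hs m u hu.1, hWs' m u hu.2⟩
    have i1 := ih _ (Submodule.finrank_lt_finrank_of_lt hlt1) (hWU.trans hU) hWs rfl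
    have i2 := ih _ (Submodule.finrank_lt_finrank_of_lt hlt2) (inf_le_left.trans hU) hs2 rfl
    conv_lhs => rw [hdec]
    refine sup_le (i1.trans (sSup_le_sSup ?_)) (i2.trans (sSup_le_sSup ?_))
    · rintro X ⟨hX, hXi⟩
      exact ⟨hX.trans hWU, hXi⟩
    · rintro X ⟨hX, hXi⟩
      exact ⟨hX.trans inf_le_left, hXi⟩

end Reducibility

end Hypercomplex
end

noncomputable section
namespace Hypercomplex

open ExteriorAlgebra Module

/-! ### The projection to the forms of maximal weight -/

section Abstract

variable {V : Type*} [AddCommGroup V] [Module ℂ V] {p : ℕ} (b : Basis (Fin 2 × Fin p) ℂ V)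

theorem hasWeight_volCoeff {k : ℕ} (hk : k < p + 1) : HasWeight b k (volCoeff b k) := by
  intro y
  refine coeff_eq_of_infinite (d := p + 1)
    (c := fun k => formMat b !![1, 0; 0, y] (volCoeff b k)) (c' := fun k => y ^ k • volCoeff b k)
    (Set.infinite_univ (α := ℂ)) (fun t _ => ?_) hk
  have h : formMat b !![1, 0; 0, y] (volForm b ![1, t]) = volForm b ![1, y * t] := by
    rw [formMat_volForm]
    congr 1
    funext i
    fin_cases i <;> simp [Matrix.mulVec, dotProduct]
  rw [volForm_one_eq_sum, volForm_one_eq_sum, map_sum] at h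
  simp only [map_smul] at h
  rw [h]
  exact Finset.sum_congr rfl fun i _ => by rw [smul_smul, mul_pow, mul_comm]

/-- The rank-one matrix sends `volCoeff b k` to (p choose k) times `volForm b ![1, 0]`. Subtracting
the right multiple leaves a form of the same weight that the matrix kills, so t determines the
component of ξ in `plusSpace`. -/
theorem sub_smul_volCoeff_mem {k : ℕ} (hk : k < p + 1) {ξ : ExteriorAlgebra ℂ V}
    (hξ : ξ ∈ ⋀[ℂ]^p V) (hw : HasWeight b k ξ) {t : ℂ}
    (ht : formMat b !![1, 1; 0, 0] ξ = t • volForm b ![1, 0]) :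
    ξ - (t / p.choose k) • volCoeff b k ∈ lowerSpace b := by
  refine mem_lowerSpace_of_weight b
    (sub_mem hξ (Submodule.smul_mem _ _ (plusSpace_le b (volCoeff_mem_plusSpace b hk)))) (k := k)
    (fun y => ?_) ?_
  · rw [map_sub, map_smul, hw, hasWeight_volCoeff b hk, smul_sub, smul_comm]
  · have e : !![1, 1; 0, (0 : ℂ)] = Matrix.vecMulVec ![1, 0] ![1, 1] := by
      ext i j
      fin_cases i <;> fin_cases j <;> simp [Matrix.vecMulVec_apply]
    rw [map_sub, map_smul, ht, e, formMat_vecMulVec_volCoeff b _ _ hk, smul_smul]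
    have : (p.choose k : ℂ) ≠ 0 := by exact_mod_cast (Nat.choose_pos (by omega)).ne'
    rw [sub_eq_zero]
    congr 1
    simp [this]

theorem exists_formMat_eq_smul_volForm {ξ : ExteriorAlgebra ℂ V} (hξ : ξ ∈ ⋀[ℂ]^p V) :
    ∃ t : ℂ, formMat b !![1, 1; 0, 0] ξ = t • volForm b ![1, 0] := by
  have e : !![1, 1; 0, (0 : ℂ)] = Matrix.vecMulVec ![1, 0] ![1, 1] := by
    ext i j
    fin_cases i <;> fin_cases j <;> simp [Matrix.vecMulVec_apply]
  rw [e]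
  exact formMat_vecMulVec b _ _ hξ

theorem pow_mem_exteriorPower {ξ : ExteriorAlgebra ℂ V} (h : ξ ∈ ⋀[ℂ]^2 V) (n : ℕ) :
    ξ ^ n ∈ ⋀[ℂ]^(2 * n) V := by
  rw [exteriorPower, pow_mul]
  exact Submodule.pow_mem_pow _ h n

end Abstract

/-! ### Wedge products of (n,n)-forms with the component of maximal weight. -/

section Middle

variable {V : Type*} [AddCommGroup V] [Module ℂ V] {n : ℕ} (b : Basis (Fin 2 × Fin (2 * n)) ℂ V)

/-- Two forms of type `(n,n)` have proportional wedge products with the component of maximal weight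
of the second one exactly when their highest weight components are proportional. -/
theorem mul_plus_eq_iff {ξ η ζ : ExteriorAlgebra ℂ V} (hξ : ξ ∈ ⋀[ℂ]^(2 * n) V)
    (hη : η ∈ ⋀[ℂ]^(2 * n) V) (hξw : HasWeight b n ξ) (hηw : HasWeight b n η)
    (hne : formMat b !![1, 1; 0, 0] ξ ≠ 0)
    (hζ : ∀ ζ' ∈ plusSpace b, ξ - ζ' ∈ lowerSpace b → ζ = ζ') (c : ℂ) :
    η * ζ = c • (ξ * ζ) ↔
      formMat b !![1, 1; 0, 0] η = c • formMat b !![1, 1; 0, 0] ξ := by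
  obtain ⟨s, hs⟩ := exists_formMat_eq_smul_volForm b hξ
  obtain ⟨t, ht⟩ := exists_formMat_eq_smul_volForm b hη
  have hn : n < 2 * n + 1 := by omega
  have h1 := sub_smul_volCoeff_mem b hn hξ hξw hs
  have h2 := sub_smul_volCoeff_mem b hn hη hηw ht
  have hC : ((2 * n).choose n : ℂ) ≠ 0 := by exact_mod_cast (Nat.choose_pos (by omega)).ne'
  have hs0 : s ≠ 0 := fun h0 => hne (by rw [hs, h0, zero_smul])
  have hmem := volCoeff_mem_plusSpace b hn
  rw [hζ _ (Submodule.smul_mem _ _ hmem) h1]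
  have hvv := volCoeff_mul_volCoeff_ne_zero b (show n + n = 2 * n by omega)
  -- Multiplication by `volCoeff b n` sees only the component in `plusSpace`. Both equations thus
  -- become scalar ones, differing by the factor s ≠ 0 and a binomial coefficient.
  have key : ∀ {θ : ExteriorAlgebra ℂ V} {r : ℂ}, θ - r • volCoeff b n ∈ lowerSpace b →
      θ * volCoeff b n = r • (volCoeff b n * volCoeff b n) := by
    intro θ r hθ
    have := mul_eq_zero_of_mem b hθ hmem
    rwa [sub_mul, smul_mul_assoc, sub_eq_zero] at this
  rw [mul_smul_comm, mul_smul_comm, key h1, key h2, hs, ht, smul_smul, smul_smul, smul_smul,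
    smul_smul, (smul_left_injective ℂ hvv).eq_iff, (smul_left_injective ℂ (volForm_ne_zero b)).eq_iff]
  constructor
  · intro h
    field_simp at h
    rw [h, mul_comm]
  · rintro rfl
    field_simp

end Middle

/-! ### The action of the quaternions in an adapted basis of covectors -/

section Adapted

variable {T : Type*} [AddCommGroup T] [Module ℝ T] {I J K : T →ₗ[ℝ] T}

/-- A basis `z₁, …, z_p, z₁∘J, …, z_p∘J` of the covectors, with `z₁, …, z_p` of type `(1,0)`. -/
structure IsAdapted {p : ℕ} (I J K : T →ₗ[ℝ] T) (b : Basis (Fin 2 × Fin p) ℂ (Covector T)) :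
    Prop where
  JJ : ∀ X, J (J X) = -X
  JI : ∀ X, J (I X) = K X
  IJ : ∀ X, I (J X) = -K X
  type10 : ∀ a X, b (0, a) (I X) = Complex.I * b (0, a) X
  apply_J : ∀ a X, b (0, a) (J X) = b (1, a) X

variable {p : ℕ} {b : Basis (Fin 2 × Fin p) ℂ (Covector T)}

theorem IsAdapted.type01 (hb : IsAdapted I J K b) (a : Fin p) (X : T) :
    b (1, a) (I X) = -(Complex.I * b (1, a) X) := by
  rw [← hb.apply_J, ← hb.apply_J, hb.JI, ← neg_neg (K X), ← hb.IJ, map_neg, hb.type10]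

theorem IsAdapted.apply_J_one (hb : IsAdapted I J K b) (a : Fin p) (X : T) :
    b (1, a) (J X) = -b (0, a) X := by
  rw [← hb.apply_J, hb.JJ, map_neg]

theorem IsAdapted.apply_K (hb : IsAdapted I J K b) (a : Fin p) (X : T) :
    b (0, a) (K X) = -(Complex.I * b (1, a) X) := by
  rw [← neg_neg (K X), ← hb.IJ, map_neg, hb.type10, hb.apply_J]

theorem IsAdapted.apply_K_one (hb : IsAdapted I J K b) (a : Fin p) (X : T) :
    b (1, a) (K X) = -(Complex.I * b (0, a) X) := by
  rw [← neg_neg (K X), ← hb.IJ, map_neg, hb.type01, hb.apply_J_one]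
  ring

theorem IsAdapted.pullCovector_rightAct (hb : IsAdapted I J K b) (h : ℍ[ℝ]) :
    pullCovector (rightAct I J K h) = matAct b (quatMat h) := by
  refine b.ext fun ⟨i, a⟩ => ?_
  rw [matAct_basis]
  ext X
  fin_cases i
  · simp [pullCovector, rightAct, tens, quatMat, hb.type10, hb.apply_J, hb.apply_K]
    ring
  · simp [pullCovector, rightAct, tens, quatMat, hb.type01, hb.apply_J_one, hb.apply_K_one]
    ring

theorem IsAdapted.formAct_eq (hb : IsAdapted I J K b) (h : ℍ[ℝ]) :
    formAct I J K h = formMat b (quatMat h) := by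
  rw [formAct, hb.pullCovector_rightAct, formMat]

theorem IsAdapted.isSU2Stable (hb : IsAdapted I J K b) {U : Submodule ℂ (Forms T)}
    (hU : IsMatStable b U) : IsSU2Stable I J K U := fun h _ u hu => by
  rw [hb.formAct_eq]
  exact hU _ u hu

theorem IsAdapted.isMatStable (hb : IsAdapted I J K b) {U : Submodule ℂ (Forms T)}
    (hUp : U ≤ ⋀[ℂ]^p (Covector T)) (hU : IsSU2Stable I J K U) : IsMatStable b U :=
  isMatStable_of_quaternion b hUp fun h hh u hu => by
    rw [← hb.formAct_eq]
    exact hU h hh u hu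

theorem IsAdapted.isMatIrreducible (hb : IsAdapted I J K b) {U : Submodule ℂ (Forms T)} {w : ℕ}
    (hUp : U ≤ ⋀[ℂ]^p (Covector T)) (hU : IsIrreducibleOfWeight I J K w U) :
    IsMatIrreducible b U where
  stable := hb.isMatStable hUp hU.stable
  ne_bot := hU.ne_bot
  eq_bot_or_eq := fun W hW hs => hU.eq_bot_or_eq W hW (hb.isSU2Stable hs)

theorem IsAdapted.isIrreducibleOfWeight (hb : IsAdapted I J K b) {U : Submodule ℂ (Forms T)}
    {w : ℕ} (hUp : U ≤ ⋀[ℂ]^p (Covector T)) (hU : IsMatIrreducible b U)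
    (hw : finrank ℂ U = w + 1) : IsIrreducibleOfWeight I J K w U where
  stable := hb.isSU2Stable hU.stable
  ne_bot := hU.ne_bot
  eq_bot_or_eq := fun W hW hs => hU.eq_bot_or_eq W hW (hb.isMatStable (hW.trans hUp) hs)
  finrank_eq := hw

/-- An irreducible subspace of `lowerSpace` is too small to have weight p, so `plusSpace` is the
only one of weight p in Λᵖ. -/
theorem IsAdapted.plusForms_eq (hb : IsAdapted I J K b) : plusForms I J K p = plusSpace b := by
  refine le_antisymm (sSup_le ?_) (le_sSup ⟨plusSpace_le b, hb.isIrreducibleOfWeight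
    (plusSpace_le b) (isMatIrreducible_plusSpace b) (finrank_plusSpace b)⟩)
  rintro U ⟨hUp, hU⟩
  have hi := hb.isMatIrreducible hUp hU
  rcases hi.le_lowerSpace_or_eq b hUp with h | h
  · exact absurd hU.finrank_eq (hi.finrank_lt b h).ne
  · exact h.le

/-- An irreducible subspace of smaller weight cannot be `plusSpace`, so it lies in `lowerSpace`.
Conversely `lowerSpace` is a sum of irreducibles by complete reducibility, each of dimension less
than p + 1. -/
theorem IsAdapted.lowerForms_eq (hb : IsAdapted I J K b) : lowerForms I J K p = lowerSpace b := by
  have : Module.Finite ℂ (Covector T) := Module.Finite.of_basis b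
  refine le_antisymm (sSup_le ?_) ?_
  · rintro U ⟨hUp, w, hw, hU⟩
    refine ((hb.isMatIrreducible hUp hU).le_lowerSpace_or_eq b hUp).resolve_right fun h => ?_
    have h1 := hU.finrank_eq
    rw [h, finrank_plusSpace] at h1
    omega
  · refine (le_sSup_irreducible b (lowerSpace_le b)
      fun m _ hu => formMat_mem_lowerSpace b m hu).trans (sSup_le_sSup ?_)
    rintro U ⟨hU, hi⟩
    have hUp := hU.trans (lowerSpace_le b)
    have : FiniteDimensional ℂ U := Submodule.finiteDimensional_of_le hUp
    have hpos : 0 < finrank ℂ U := Nat.pos_of_ne_zero fun h0 =>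
      hi.ne_bot (Submodule.finrank_eq_zero.1 h0)
    have hlt := hi.finrank_lt b hU
    exact ⟨hUp, finrank ℂ U - 1, by omega, hb.isIrreducibleOfWeight hUp hi
      (Nat.sub_add_cancel hpos).symm⟩

/-- The decomposition is unique, so the chosen component is ζ and the default value 0 does not
intervene. -/
theorem IsAdapted.plusProj_eq (hb : IsAdapted I J K b) {ξ ζ : Forms T} (hζ : ζ ∈ plusSpace b)
    (h : ξ - ζ ∈ lowerSpace b) : plusProj I J K p ξ = ζ := by
  have hex : ∃ η ∈ plusForms I J K p, ξ - η ∈ lowerForms I J K p :=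
    ⟨ζ, hb.plusForms_eq ▸ hζ, hb.lowerForms_eq ▸ h⟩
  rw [plusProj, dif_pos hex]
  have hs1 : hex.choose ∈ plusSpace b := hb.plusForms_eq ▸ hex.choose_spec.1
  have hs2 : ξ - hex.choose ∈ lowerSpace b := hb.lowerForms_eq ▸ hex.choose_spec.2
  refine sub_eq_zero.1 (plusSpace_inf_lowerSpace b (sub_mem hs1 hζ) ?_)
  have := sub_mem h hs2
  rwa [sub_sub_sub_cancel_left] at this

/-- I acts as diag(√-1, -√-1); the coefficients here and in `IsAdapted.matAct_top` are those of the
matrix in the basis 1, I, J, K. -/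
theorem IsAdapted.matAct_diag (hb : IsAdapted I J K b) (y : ℂ) :
    matAct b !![1, 0; 0, y] = ∑ k, (![(1 + y) / 2, -Complex.I * (1 - y) / 2] k : ℂ) •
      pullCovector ((![LinearMap.id, I] : Fin 2 → T →ₗ[ℝ] T) k) := by
  refine b.ext fun ⟨i, a⟩ => ?_
  rw [matAct_basis]
  ext X
  fin_cases i
  · simp [pullCovector, tens, hb.type10]
    linear_combination ((1 - y) / 2 * b (0, a) X) * Complex.I_mul_I
  · simp [pullCovector, tens, hb.type01]
    linear_combination (-(1 - y) / 2 * b (1, a) X) * Complex.I_mul_I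

theorem IsAdapted.matAct_top (hb : IsAdapted I J K b) :
    matAct b !![1, 1; 0, 0] = ∑ k, (![1 / 2, -Complex.I / 2, -1 / 2, Complex.I / 2] k : ℂ) •
      pullCovector ((![LinearMap.id, I, J, K] : Fin 4 → T →ₗ[ℝ] T) k) := by
  refine b.ext fun ⟨i, a⟩ => ?_
  rw [matAct_basis]
  ext X
  fin_cases i
  · simp [pullCovector, tens, hb.type10, hb.apply_J, hb.apply_K, Fin.sum_univ_four]
    linear_combination (1 / 2 * b (0, a) X + 1 / 2 * b (1, a) X) * Complex.I_mul_I
  · simp [pullCovector, tens, hb.type01, hb.apply_J_one, hb.apply_K_one, Fin.sum_univ_four]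
    linear_combination (1 / 2 * b (0, a) X - 1 / 2 * b (1, a) X) * Complex.I_mul_I

end Adapted

/-! ### Two-forms -/

section TwoForms

variable {T : Type*} [AddCommGroup T] [Module ℝ T] [Module.Finite ℝ T]

theorem toForm_add (B C : T → T → ℂ) :
    toForm (fun X Y => B X Y + C X Y) = toForm B + toForm C := by
  simp only [toForm, add_smul, Finset.sum_add_distrib, smul_add]

theorem toForm_smul (t : ℂ) (B : T → T → ℂ) :
    toForm (fun X Y => t * B X Y) = t • toForm B := by
  simp only [toForm, mul_smul, ← Finset.smul_sum]
  rw [smul_comm]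

theorem toForm_zero : toForm (fun _ _ : T => (0 : ℂ)) = 0 := by
  simp [toForm]

theorem toForm_sum {ι' : Type*} (s : Finset ι') (B : ι' → T → T → ℂ) :
    toForm (fun X Y => ∑ i ∈ s, B i X Y) = ∑ i ∈ s, toForm (B i) := by
  classical
  induction s using Finset.induction_on with
  | empty => simpa using toForm_zero
  | insert a s ha ih =>
    simp only [Finset.sum_insert ha]
    rw [toForm_add, ih]

theorem toForm_mul (l m : Covector T) :
    toForm (fun X Y => l X * m Y) = (1 / 2 : ℂ) • (ι ℂ l * ι ℂ m) := by
  conv_rhs => rw [← sum_dualVec l, ← sum_dualVec m]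
  simp only [toForm, map_sum, map_smul, Finset.sum_mul_sum, smul_mul_smul_comm]

theorem toForm_mem (B : T → T → ℂ) : toForm B ∈ ⋀[ℂ]^2 (Covector T) := by
  refine Submodule.smul_mem _ _ (Submodule.sum_mem _ fun i _ => Submodule.sum_mem _ fun j _ =>
    Submodule.smul_mem _ _ ?_)
  rw [exteriorPower, pow_two]
  exact Submodule.mul_mem_mul ⟨_, rfl⟩ ⟨_, rfl⟩

theorem sum_dualVec_apply (X : T) :
    X = ∑ i, (finBasis ℝ T).coord i X • finBasis ℝ T i := by
  simp [Basis.sum_repr]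

theorem bilin_eq_sum (B : T →ₗ[ℝ] T →ₗ[ℝ] ℂ) (X Y : T) :
    B X Y = ∑ i, ∑ j, B (finBasis ℝ T i) (finBasis ℝ T j) * (dualVec i X * dualVec j Y) := by
  conv_lhs => rw [sum_dualVec_apply X, sum_dualVec_apply Y]
  simp only [map_sum, LinearMap.sum_apply, map_smul, LinearMap.smul_apply, Finset.smul_sum]
  rw [Finset.sum_comm]
  refine Finset.sum_congr rfl fun i _ => Finset.sum_congr rfl fun j _ => ?_
  simp [dualVec]
  ring

/-- The effect on two-forms of a complex combination of pull-backs. -/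
theorem map_toForm {ι' : Type*} (s : Finset ι') (c : ι' → ℂ) (A : ι' → T →ₗ[ℝ] T)
    (B : T →ₗ[ℝ] T →ₗ[ℝ] ℂ) :
    ExteriorAlgebra.map (∑ k ∈ s, c k • pullCovector (A k)) (toForm fun X Y => B X Y) =
      toForm fun X Y => ∑ k ∈ s, ∑ l ∈ s, c k * c l * B (A k X) (A l Y) := by
  have h : ∀ l m : Covector T, ExteriorAlgebra.map (∑ k ∈ s, c k • pullCovector (A k))
      (toForm fun X Y => l X * m Y) =
      toForm fun X Y => ∑ k ∈ s, ∑ k' ∈ s, c k * c k' * (l (A k X) * m (A k' Y)) := by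
    intro l m
    rw [toForm_mul, map_smul, map_mul, map_apply_ι, map_apply_ι, ← toForm_mul]
    congr 1
    funext X Y
    simp only [LinearMap.sum_apply, LinearMap.smul_apply, pullCovector, LinearMap.coe_mk,
      AddHom.coe_mk, LinearMap.comp_apply, smul_eq_mul, Finset.sum_mul_sum]
    exact Finset.sum_congr rfl fun i _ => Finset.sum_congr rfl fun j _ => by ring
  have h1 : toForm (fun X Y => B X Y) = ∑ i, ∑ j, B (finBasis ℝ T i) (finBasis ℝ T j) •
      toForm (fun X Y => dualVec i X * dualVec j Y) := by
    simp only [← toForm_smul, ← toForm_sum]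
    congr 1
    funext X Y
    exact bilin_eq_sum B X Y
  rw [h1]
  simp only [map_sum, map_smul, h]
  simp only [← toForm_smul, ← toForm_sum]
  congr 1
  funext X Y
  have h2 : ∀ k l, B (A k X) (A l Y) = ∑ i, ∑ j, B (finBasis ℝ T i) (finBasis ℝ T j) *
      (dualVec i (A k X) * dualVec j (A l Y)) := fun k l => bilin_eq_sum B _ _
  simp only [h2, Finset.mul_sum]
  calc _ = ∑ i, ∑ k ∈ s, ∑ j, ∑ l ∈ s, B (finBasis ℝ T i) (finBasis ℝ T j) *
        (c k * c l * (dualVec i (A k X) * dualVec j (A l Y))) :=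
        Finset.sum_congr rfl fun i _ => Finset.sum_comm
    _ = ∑ k ∈ s, ∑ i, ∑ l ∈ s, ∑ j, B (finBasis ℝ T i) (finBasis ℝ T j) *
        (c k * c l * (dualVec i (A k X) * dualVec j (A l Y))) := by
        rw [Finset.sum_comm]
        exact Finset.sum_congr rfl fun k _ => Finset.sum_congr rfl fun i _ => Finset.sum_comm
    _ = ∑ k ∈ s, ∑ l ∈ s, ∑ i, ∑ j, B (finBasis ℝ T i) (finBasis ℝ T j) *
        (c k * c l * (dualVec i (A k X) * dualVec j (A l Y))) :=
        Finset.sum_congr rfl fun k _ => Finset.sum_comm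
    _ = _ := Finset.sum_congr rfl fun k _ => Finset.sum_congr rfl fun l _ =>
        Finset.sum_congr rfl fun i _ => Finset.sum_congr rfl fun j _ => by ring

variable {I J K : T →ₗ[ℝ] T} {p : ℕ} {b : Basis (Fin 2 × Fin p) ℂ (Covector T)}

/-- Invariance under I means type (1,1), and diag(1,y) multiplies (0,1)-covectors by y and fixes
(1,0)-covectors. -/
theorem IsAdapted.formMat_diag_toForm (hb : IsAdapted I J K b) (y : ℂ) (B : T →ₗ[ℝ] T →ₗ[ℝ] ℂ)
    (hB : ∀ X Y, B (I X) (I Y) = B X Y) (hI : ∀ X, I (I X) = -X) :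
    formMat b !![1, 0; 0, y] (toForm fun X Y => B X Y) = y • toForm fun X Y => B X Y := by
  rw [formMat, hb.matAct_diag, map_toForm, ← toForm_smul]
  congr 1
  funext X Y
  have h : B X (I Y) = -B (I X) Y := by
    rw [← hB X, hI, map_neg]
  simp [hB, h]
  linear_combination ((1 - y) ^ 2 / 4 * B X Y) * Complex.I_mul_I

/-- An expression for G on (1,1)-forms free of coordinates; with B = ∂∂̄φ, the right side is later
identified with ∂∂_Jφ. -/
theorem IsAdapted.formMat_top_toForm (hb : IsAdapted I J K b) (B : T →ₗ[ℝ] T →ₗ[ℝ] ℂ)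
    (hB : ∀ X Y, B (I X) (I Y) = B X Y) (hI : ∀ X, I (I X) = -X) :
    formMat b !![1, 1; 0, 0] (toForm fun X Y => B X Y) = toForm fun X Y =>
      -(1 / 2 : ℂ) * (B (J X) Y + B X (J Y) - Complex.I * (B (K X) Y + B X (K Y))) := by
  rw [formMat, hb.matAct_top, map_toForm]
  congr 1
  funext X Y
  have h : ∀ X Y, B X (I Y) = -B (I X) Y := fun X Y => by
    rw [← hB X, hI, map_neg]
  have hK : ∀ X, K X = -I (J X) := fun X => by rw [hb.IJ, neg_neg]
  simp only [Fin.sum_univ_four]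
  simp [hB, h, hK]
  ring_nf
  simp
  ring

end TwoForms

end Hypercomplex
end

noncomputable section
namespace Hypercomplex

open ExteriorAlgebra Module

/-! ### Powers of a two-form in normal form -/

section Power

theorem Commute.add_pow_of_sq_eq_zero {A : Type*} [Semiring A] {s a : A} (h : Commute s a)
    (ha : a * a = 0) (m : ℕ) : (s + a) ^ (m + 1) = s ^ (m + 1) + (m + 1) • (s ^ m * a) := by
  induction m with
  | zero => simp
  | succ m ih =>
    rw [pow_succ (s + a), ih, add_mul, mul_add, mul_add, smul_mul_assoc, smul_mul_assoc, mul_assoc,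
      mul_assoc, ha, mul_zero, smul_zero, add_zero, ← h.eq, ← mul_assoc, ← pow_succ, ← pow_succ,
      succ_nsmul _ (m + 1), add_assoc]
    congr 1
    exact add_comm _ _

variable {V : Type*} [AddCommGroup V] [Module ℂ V]

theorem commute_ι_mul_ι (x y v : V) : Commute (ι ℂ x * ι ℂ y) (ι ℂ v) := by
  rw [Commute, SemiconjBy, mul_assoc, eq_neg_of_add_eq_zero_left (ι_add_mul_swap y v), mul_neg,
    ← mul_assoc, eq_neg_of_add_eq_zero_left (ι_add_mul_swap x v), neg_mul, neg_neg, mul_assoc]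

theorem ιMulti_succ_eq_mul (u : ℕ → V) (q : ℕ) :
    ιMulti ℂ (q + 1) (fun i => u i) = ιMulti ℂ q (fun i => u i) * ι ℂ (u q) := by
  rw [ιMulti_apply, ιMulti_apply, List.ofFn_succ_last, List.prod_append]
  simp

/-- The summands commute and have square zero. The vanishing of the next power is carried along
because the induction step expands (s + a)ⁿ⁺¹ as sⁿ⁺¹ + (n+1) sⁿ a. -/
theorem sum_ι_mul_ι_pow (u : ℕ → V) (n : ℕ) :
    (∑ i ∈ Finset.range n, ι ℂ (u (2 * i)) * ι ℂ (u (2 * i + 1))) ^ n =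
        n.factorial • ιMulti ℂ (2 * n) (fun i => u i) ∧
      (∑ i ∈ Finset.range n, ι ℂ (u (2 * i)) * ι ℂ (u (2 * i + 1))) ^ (n + 1) = 0 := by
  induction n with
  | zero => simp
  | succ n ih =>
    have hc : Commute (∑ i ∈ Finset.range n, ι ℂ (u (2 * i)) * ι ℂ (u (2 * i + 1)))
        (ι ℂ (u (2 * n)) * ι ℂ (u (2 * n + 1))) :=
      Commute.sum_left _ _ _ fun i _ => (commute_ι_mul_ι _ _ _).mul_right (commute_ι_mul_ι _ _ _)
    have ha : ι ℂ (u (2 * n)) * ι ℂ (u (2 * n + 1)) * (ι ℂ (u (2 * n)) * ι ℂ (u (2 * n + 1))) = 0 := by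
      rw [← mul_assoc, (commute_ι_mul_ι _ _ _).eq, ← mul_assoc, ι_sq_zero, zero_mul, zero_mul]
    rw [Finset.sum_range_succ, Commute.add_pow_of_sq_eq_zero hc ha,
      Commute.add_pow_of_sq_eq_zero hc ha, pow_succ _ (n + 1), ih.1, ih.2]
    refine ⟨?_, by simp⟩
    have : ιMulti ℂ (2 * (n + 1)) (fun i => u i) =
        ιMulti ℂ (2 * n) (fun i => u i) * (ι ℂ (u (2 * n)) * ι ℂ (u (2 * n + 1))) := by
      rw [← mul_assoc, ← ιMulti_succ_eq_mul, ← ιMulti_succ_eq_mul]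
      rfl
    rw [this, zero_add, smul_mul_assoc, smul_smul, Nat.factorial_succ]

end Power

/-! ### Quaternionic orthonormal bases -/

section Metric

variable {T : Type*} [AddCommGroup T] [Module ℝ T]

/-- A quaternionic Hermitian scalar product on one tangent space. -/
structure IsQuatHermitian (I J K : T →ₗ[ℝ] T) (g : T →ₗ[ℝ] T →ₗ[ℝ] ℝ) : Prop where
  II : ∀ X, I (I X) = -X
  JJ : ∀ X, J (J X) = -X
  JI : ∀ X, J (I X) = K X
  IJ : ∀ X, I (J X) = -K X
  symm : ∀ X Y, g X Y = g Y X
  pos : ∀ X, X ≠ 0 → 0 < g X X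
  gI : ∀ X Y, g (I X) (I Y) = g X Y
  gJ : ∀ X Y, g (J X) (J Y) = g X Y

/-- The vectors `e i` for `i < k` are orthonormal over the quaternions. -/
def IsQuatOrthonormal (I J K : T →ₗ[ℝ] T) (g : T →ₗ[ℝ] T →ₗ[ℝ] ℝ) (e : ℕ → T) (k : ℕ) : Prop :=
  ∀ i < k, ∀ j < k, g (e i) (e j) = (if i = j then 1 else 0) ∧ g (e i) (I (e j)) = 0 ∧
    g (e i) (J (e j)) = 0 ∧ g (e i) (K (e j)) = 0

variable {I J K : T →ₗ[ℝ] T} {g : T →ₗ[ℝ] T →ₗ[ℝ] ℝ}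

namespace IsQuatHermitian

variable (h : IsQuatHermitian I J K g)

include h

theorem KJ (X : T) : K (J X) = I X := by
  rw [← h.JI, h.IJ, ← h.JI, map_neg, h.JJ, neg_neg]

theorem JK (X : T) : J (K X) = -I X := by rw [← h.JI, h.JJ]

theorem KI (X : T) : K (I X) = -J X := by rw [← h.JI, h.II, map_neg]

theorem IK (X : T) : I (K X) = J X := by rw [← neg_neg (K X), ← h.IJ, map_neg, h.II, neg_neg]

theorem KK (X : T) : K (K X) = -X := by rw [← h.JI (K X), h.IK, h.JJ]

theorem gK (X Y : T) : g (K X) (K Y) = g X Y := by rw [← h.JI, ← h.JI, h.gJ, h.gI]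

theorem gI_left (X Y : T) : g (I X) Y = -g X (I Y) := by
  rw [← h.gI X (I Y), h.II, map_neg, neg_neg]

theorem gJ_left (X Y : T) : g (J X) Y = -g X (J Y) := by
  rw [← h.gJ X (J Y), h.JJ, map_neg, neg_neg]

theorem gK_left (X Y : T) : g (K X) Y = -g X (K Y) := by
  rw [← h.gK X (K Y), h.KK, map_neg, neg_neg]

theorem apply_self_I (X : T) : g X (I X) = 0 := by
  have := h.gI_left X X
  rw [h.symm] at this
  linarith

theorem apply_self_J (X : T) : g X (J X) = 0 := by
  have := h.gJ_left X X
  rw [h.symm] at this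
  linarith

theorem apply_self_K (X : T) : g X (K X) = 0 := by
  have := h.gK_left X X
  rw [h.symm] at this
  linarith

/-- Orthogonality amounts to 4k real linear equations, fewer than the dimension; a non-zero solution
is normalized. -/
theorem exists_orthogonal [Module.Finite ℝ T] {k : ℕ} (hk : 4 * k < finrank ℝ T) (e : ℕ → T) :
    ∃ X : T, g X X = 1 ∧ ∀ i < k, g (e i) X = 0 ∧ g (e i) (I X) = 0 ∧ g (e i) (J X) = 0 ∧
      g (e i) (K X) = 0 := by
  let L : T →ₗ[ℝ] (Fin k → Fin 4 → ℝ) := LinearMap.pi fun i => LinearMap.pi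
    ![g (e i), g (e i) ∘ₗ I, g (e i) ∘ₗ J, g (e i) ∘ₗ K]
  have hL : LinearMap.ker L ≠ ⊥ := LinearMap.ker_ne_bot_of_finrank_lt (by
    rw [finrank_pi_fintype]
    simp
    omega)
  obtain ⟨X, hX, hX0⟩ := Submodule.exists_mem_ne_zero_of_ne_bot hL
  have hpos := h.pos X hX0
  have hX' : ∀ i < k, ∀ c : ℝ, g (e i) (c • X) = 0 ∧ g (e i) (I (c • X)) = 0 ∧
      g (e i) (J (c • X)) = 0 ∧ g (e i) (K (c • X)) = 0 := by
    intro i hi c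
    have h1 := fun m => congrFun (congrFun (LinearMap.mem_ker.1 hX) ⟨i, hi⟩) m
    have h2 := h1 0
    have h3 := h1 1
    have h4 := h1 2
    have h5 := h1 3
    simp [L] at h2 h3 h4 h5
    simp [h2, h3, h4, h5]
  refine ⟨(√(g X X))⁻¹ • X, ?_, fun i hi => hX' i hi _⟩
  simp only [map_smul, LinearMap.smul_apply, smul_eq_mul]
  have := Real.mul_self_sqrt hpos.le
  have h0 : √(g X X) ≠ 0 := (Real.sqrt_pos.2 hpos).ne'
  field_simp
  rw [pow_two, this]

theorem exists_quatOrthonormal [Module.Finite ℝ T] {n : ℕ} (hn : finrank ℝ T = 4 * n) (k : ℕ)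
    (hk : k ≤ n) : ∃ e : ℕ → T, IsQuatOrthonormal I J K g e k := by
  induction k with
  | zero => exact ⟨0, fun i hi => absurd hi (by omega)⟩
  | succ k ih =>
    obtain ⟨e, he⟩ := ih (by omega)
    obtain ⟨X, hX1, hX⟩ := h.exists_orthogonal (k := k) (by omega) e
    refine ⟨Function.update e k X, fun i hi j hj => ?_⟩
    rcases Nat.lt_succ_iff_lt_or_eq.1 hi with hi | rfl <;>
    rcases Nat.lt_succ_iff_lt_or_eq.1 hj with hj | rfl
    · rw [Function.update_of_ne hi.ne, Function.update_of_ne hj.ne]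
      exact he i hi j hj
    · rw [Function.update_of_ne hi.ne, Function.update_self, if_neg hi.ne]
      exact hX i hi
    · rw [Function.update_of_ne hj.ne, Function.update_self, if_neg hj.ne']
      obtain ⟨h1, h2, h3, h4⟩ := hX j hj
      refine ⟨?_, ?_, ?_, ?_⟩
      · rw [h.symm, h1]
      · rw [h.symm, h.gI_left, h2, neg_zero]
      · rw [h.symm, h.gJ_left, h3, neg_zero]
      · rw [h.symm, h.gK_left, h4, neg_zero]
    · rw [Function.update_self, if_pos rfl]
      exact ⟨hX1, h.apply_self_I X, h.apply_self_J X, h.apply_self_K X⟩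

end IsQuatHermitian

/-- The complexification of a real covector. -/
def realCovector (l : T →ₗ[ℝ] ℝ) : Covector T := Algebra.linearMap ℝ ℂ ∘ₗ l

/-- The coordinates of type `(1,0)` of a quaternionic orthonormal basis. -/
def coord10 (I J K : T →ₗ[ℝ] T) (g : T →ₗ[ℝ] T →ₗ[ℝ] ℝ) (e : ℕ → T) (a : ℕ) : Covector T :=
  if a % 2 = 0 then
    realCovector (g (e (a / 2))) - Complex.I • realCovector (g (e (a / 2)) ∘ₗ I)
  else realCovector (g (e (a / 2)) ∘ₗ J) - Complex.I • realCovector (g (e (a / 2)) ∘ₗ K)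

theorem coord10_even (e : ℕ → T) (i : ℕ) (X : T) :
    coord10 I J K g e (2 * i) X = g (e i) X - Complex.I * g (e i) (I X) := by
  simp [coord10, realCovector]

theorem coord10_odd (e : ℕ → T) (i : ℕ) (X : T) :
    coord10 I J K g e (2 * i + 1) X = g (e i) (J X) - Complex.I * g (e i) (K X) := by
  have h1 : (2 * i + 1) % 2 = 1 := by omega
  have h2 : (2 * i + 1) / 2 = i := by omega
  simp [coord10, realCovector, h1, h2]

theorem IsQuatOrthonormal.coord10_apply {n : ℕ} {e : ℕ → T}
    (he : IsQuatOrthonormal I J K g e n) {a j : ℕ} (ha : a < 2 * n) (hj : j < n) :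
    coord10 I J K g e a (e j) = if a = 2 * j then 1 else 0 := by
  rcases Nat.even_or_odd' a with ⟨i, rfl | rfl⟩
  · obtain ⟨h1, h2, -, -⟩ := he i (by omega) j hj
    rw [coord10_even, h1, h2]
    by_cases hij : i = j <;> simp [hij]
  · obtain ⟨-, -, h3, h4⟩ := he i (by omega) j hj
    rw [coord10_odd, h3, h4, if_neg (by omega)]
    simp

namespace IsQuatHermitian

variable (h : IsQuatHermitian I J K g)

include h

theorem coord10_I (e : ℕ → T) (a : ℕ) (X : T) :
    coord10 I J K g e a (I X) = Complex.I * coord10 I J K g e a X := by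
  rcases Nat.even_or_odd' a with ⟨i, rfl | rfl⟩
  · rw [coord10_even, coord10_even, h.II]
    simp only [map_neg, Complex.ofReal_neg]
    linear_combination (g (e i) (I X) : ℂ) * Complex.I_mul_I
  · rw [coord10_odd, coord10_odd, h.JI, h.KI]
    simp only [map_neg, Complex.ofReal_neg]
    linear_combination (g (e i) (K X) : ℂ) * Complex.I_mul_I

variable {n : ℕ} {e : ℕ → T} (he : IsQuatOrthonormal I J K g e n)

include he

theorem coord10_apply_J {a j : ℕ} (ha : a < 2 * n) (hj : j < n) :
    coord10 I J K g e a (J (e j)) = if a = 2 * j + 1 then -1 else 0 := by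
  rcases Nat.even_or_odd' a with ⟨i, rfl | rfl⟩
  · obtain ⟨-, -, h3, h4⟩ := he i (by omega) j hj
    rw [coord10_even, h.IJ, map_neg, h3, h4, if_neg (by omega)]
    simp
  · obtain ⟨h1, h2, -, -⟩ := he i (by omega) j hj
    rw [coord10_odd, h.JJ, h.KJ, map_neg, h1, h2]
    by_cases hij : i = j <;> simp [hij]

theorem linearIndependent_coord10 : LinearIndependent ℂ fun x : Fin 2 × Fin (2 * n) =>
    if x.1 = 0 then coord10 I J K g e x.2 else pullCovector J (coord10 I J K g e x.2) := by
  rw [Fintype.linearIndependent_iff]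
  intro c hc
  have key : ∀ X, ∑ a, c (0, a) * coord10 I J K g e a X +
      ∑ a, c (1, a) * coord10 I J K g e a (J X) = 0 := by
    intro X
    have := congrArg (fun l : Covector T => l X) hc
    simpa [Fintype.sum_prod_type, Fin.sum_univ_two, LinearMap.sum_apply, pullCovector] using this
  have e0 : ∀ (s : Fin 2) (j : ℕ) (hj : j < n), ∑ a, c (s, a) * coord10 I J K g e a (e j) =
      c (s, ⟨2 * j, by omega⟩) := by
    intro s j hj
    rw [Finset.sum_eq_single ⟨2 * j, by omega⟩]
    · rw [he.coord10_apply (by simp; omega) hj, if_pos rfl, mul_one]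
    · intro a _ ha
      rw [he.coord10_apply a.2 hj, if_neg fun h0 => ha (Fin.ext h0), mul_zero]
    · simp
  have e1 : ∀ (s : Fin 2) (j : ℕ) (hj : j < n), ∑ a, c (s, a) * coord10 I J K g e a (J (e j)) =
      -c (s, ⟨2 * j + 1, by omega⟩) := by
    intro s j hj
    rw [Finset.sum_eq_single ⟨2 * j + 1, by omega⟩]
    · rw [h.coord10_apply_J he (by simp; omega) hj, if_pos rfl, mul_neg_one]
    · intro a _ ha
      rw [h.coord10_apply_J he a.2 hj, if_neg fun h0 => ha (Fin.ext h0), mul_zero]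
    · simp
  have f1 : ∀ (s : Fin 2) X, ∑ a, c (s, a) * coord10 I J K g e a (I X) =
      Complex.I * ∑ a, c (s, a) * coord10 I J K g e a X := by
    intro s X
    rw [Finset.mul_sum]
    exact Finset.sum_congr rfl fun a _ => by rw [h.coord10_I]; ring
  have f2 : ∀ (s : Fin 2) X, ∑ a, c (s, a) * coord10 I J K g e a (-X) =
      -∑ a, c (s, a) * coord10 I J K g e a X := by
    intro s X
    rw [← Finset.sum_neg_distrib]
    exact Finset.sum_congr rfl fun a _ => by rw [map_neg]; ring
  -- The relation at e_j and I e_j gives the difference and the sum of the first two coefficients;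
  -- at J e_j and I J e_j it gives those of the other two.
  have fin : ∀ j (hj : j < n), (c (0, ⟨2 * j, by omega⟩) = 0 ∧ c (1, ⟨2 * j + 1, by omega⟩) = 0) ∧
      (c (0, ⟨2 * j + 1, by omega⟩) = 0 ∧ c (1, ⟨2 * j, by omega⟩) = 0) := by
    intro j hj
    have k1 := key (e j)
    have k2 := key (I (e j))
    have k3 := key (J (e j))
    have k4 := key (I (J (e j)))
    have hJIJ : J (I (J (e j))) = I (e j) := by rw [h.IJ, map_neg, h.JK, neg_neg]
    have hJI : J (I (e j)) = -I (J (e j)) := by rw [h.JI, h.IJ, neg_neg]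
    rw [hJI, f2, f1, f1, e0 0 j hj, e1 1 j hj] at k2
    rw [hJIJ, f1, f1, e1 0 j hj, e0 1 j hj] at k4
    rw [h.JJ, f2, e1 0 j hj, e0 1 j hj] at k3
    rw [e0 0 j hj, e1 1 j hj] at k1
    refine ⟨⟨?_, ?_⟩, ?_, ?_⟩
    · linear_combination k1 / 2 - Complex.I * k2 / 2 + (c (0, ⟨2 * j, by omega⟩) / 2 +
        c (1, ⟨2 * j + 1, by omega⟩) / 2) * Complex.I_mul_I
    · linear_combination -k1 / 2 - Complex.I * k2 / 2 + (c (0, ⟨2 * j, by omega⟩) / 2 +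
        c (1, ⟨2 * j + 1, by omega⟩) / 2) * Complex.I_mul_I
    · linear_combination -k3 / 2 + Complex.I * k4 / 2 + (c (0, ⟨2 * j + 1, by omega⟩) / 2 -
        c (1, ⟨2 * j, by omega⟩) / 2) * Complex.I_mul_I
    · linear_combination -k3 / 2 - Complex.I * k4 / 2 - (c (0, ⟨2 * j + 1, by omega⟩) / 2 -
        c (1, ⟨2 * j, by omega⟩) / 2) * Complex.I_mul_I
  rintro ⟨s, a⟩
  rcases Nat.even_or_odd' a.val with ⟨i, hi | hi⟩
  · have ha : a = ⟨2 * i, by omega⟩ := Fin.ext hi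
    have := fin i (by omega)
    rw [ha]
    fin_cases s
    · exact this.1.1
    · exact this.2.2
  · have ha : a = ⟨2 * i + 1, by omega⟩ := Fin.ext hi
    have := fin i (by omega)
    rw [ha]
    fin_cases s
    · exact this.2.1
    · exact this.1.2

theorem exists_isAdapted [Module.Finite ℝ T] (hn : finrank ℝ T = 4 * n) :
    ∃ b : Basis (Fin 2 × Fin (2 * n)) ℂ (Covector T), IsAdapted I J K b ∧
      ∀ a, b (0, a) = coord10 I J K g e a := by
  have hcard : Fintype.card (Fin 2 × Fin (2 * n)) = finrank ℂ (Covector T) := by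
    rw [finrank_linearMap_self, hn]
    simp
    omega
  -- The construction of the basis needs a non-empty index type, so dimension zero is treated apart.
  by_cases hn0 : n = 0
  · subst hn0
    have : Subsingleton (Covector T) := finrank_zero_iff.1 (by rw [← hcard]; simp)
    have : IsEmpty (Fin 2 × Fin (2 * 0)) := ⟨fun x => x.2.elim0⟩
    refine ⟨Basis.empty _, ⟨h.JJ, h.JI, h.IJ, fun a => a.elim0, fun a => a.elim0⟩, fun a => a.elim0⟩
  have : Nonempty (Fin 2 × Fin (2 * n)) := ⟨(0, ⟨0, by omega⟩)⟩
  have hcoe := coe_basisOfLinearIndependentOfCardEqFinrank (h.linearIndependent_coord10 he) hcard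
  refine ⟨basisOfLinearIndependentOfCardEqFinrank (h.linearIndependent_coord10 he) hcard,
    ⟨h.JJ, h.JI, h.IJ, fun a X => ?_, fun a X => ?_⟩, fun a => ?_⟩
  · rw [hcoe]
    exact h.coord10_I e a X
  · rw [hcoe]
    rfl
  · rw [hcoe]
    rfl

/-- Parseval's identity. A vector orthogonal to all e_i, I e_i, J e_i, K e_i is killed by a basis of
covectors, hence zero; this is applied to Y minus its expansion. -/
theorem apply_eq_sum [Module.Finite ℝ T] (hn : finrank ℝ T = 4 * n) (X Y : T) :
    g X Y = ∑ i ∈ Finset.range n, (g (e i) X * g (e i) Y + g (e i) (I X) * g (e i) (I Y) +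
      g (e i) (J X) * g (e i) (J Y) + g (e i) (K X) * g (e i) (K Y)) := by
  obtain ⟨b, hb, hbc⟩ := h.exists_isAdapted he hn
  have hzero : ∀ Z : T, (∀ i < n, g (e i) Z = 0 ∧ g (e i) (I Z) = 0 ∧ g (e i) (J Z) = 0 ∧
      g (e i) (K Z) = 0) → Z = 0 := by
    intro Z hZ
    have h0 : ∀ a, b (0, a) Z = 0 ∧ b (0, a) (J Z) = 0 := by
      intro a
      rw [hbc]
      rcases Nat.even_or_odd' a.val with ⟨i, hi | hi⟩
      · obtain ⟨h1, h2, h3, h4⟩ := hZ i (by omega)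
        rw [hi, coord10_even, coord10_even, h1, h2, h3, h.IJ, map_neg, h4]
        simp
      · obtain ⟨h1, h2, h3, h4⟩ := hZ i (by omega)
        rw [hi, coord10_odd, coord10_odd, h.JJ, h.KJ, map_neg, h1, h2, h3, h4]
        simp
    have hall : ∀ l : Covector T, l Z = 0 := by
      intro l
      rw [← b.sum_repr l, LinearMap.sum_apply]
      refine Finset.sum_eq_zero fun x _ => ?_
      obtain ⟨s, a⟩ := x
      rw [LinearMap.smul_apply]
      fin_cases s
      · exact (congrArg _ (h0 a).1).trans (smul_zero _)
      · refine (congrArg _ ?_).trans (smul_zero _)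
        change b (1, a) Z = 0
        rw [← hb.apply_J, (h0 a).2]
    by_contra hne
    have := hall (realCovector (g Z))
    simp [realCovector] at this
    exact (h.pos Z hne).ne' this
  -- The minus signs come from g(I e_i, Y) = -g(e_i, I Y), and likewise for J and K.
  have hY := hzero (Y - ∑ i ∈ Finset.range n, (g (e i) Y • e i - g (e i) (I Y) • I (e i) -
    g (e i) (J Y) • J (e i) - g (e i) (K Y) • K (e i))) (by
    intro j hj
    have hd : ∀ c : ℕ → ℝ, ∑ i ∈ Finset.range n, c i * (if j = i then 1 else 0) = c j := by
      intro c
      simp [Finset.mem_range, hj]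
    have hs : ∀ f : ℕ → T, ∀ c : ℕ → ℝ, (∀ i < n, g (e j) (f i) = c i * (if j = i then 1 else 0)) →
        g (e j) (∑ i ∈ Finset.range n, f i) = c j := by
      intro f c hf
      rw [map_sum, ← hd c]
      exact Finset.sum_congr rfl fun i hi => hf i (Finset.mem_range.1 hi)
    simp only [map_sub, map_sum I, map_sum J, map_sum K, sub_eq_zero]
    refine ⟨?_, ?_, ?_, ?_⟩
    · refine (hs _ (fun i => g (e i) Y) fun i hi => ?_).symm
      obtain ⟨h1, h2, h3, h4⟩ := he j hj i hi
      simp [h1, h2, h3, h4]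
    · refine (hs _ (fun i => g (e i) (I Y)) fun i hi => ?_).symm
      obtain ⟨h1, h2, h3, h4⟩ := he j hj i hi
      simp [h1, h2, h3, h4, h.II, h.IJ, h.IK]
    · refine (hs _ (fun i => g (e i) (J Y)) fun i hi => ?_).symm
      obtain ⟨h1, h2, h3, h4⟩ := he j hj i hi
      simp [h1, h2, h3, h4, h.JI, h.JJ, h.JK]
    · refine (hs _ (fun i => g (e i) (K Y)) fun i hi => ?_).symm
      obtain ⟨h1, h2, h3, h4⟩ := he j hj i hi
      simp [h1, h2, h3, h4, h.KI, h.KJ, h.KK])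
  rw [sub_eq_zero] at hY
  conv_lhs => rw [hY]
  rw [map_sum]
  refine Finset.sum_congr rfl fun i _ => ?_
  simp only [map_sub, map_smul, smul_eq_mul]
  rw [h.symm X (e i), h.symm X (I (e i)), h.symm X (J (e i)), h.symm X (K (e i)), h.gI_left,
    h.gJ_left, h.gK_left]
  ring

/-- The normal form `Ω = -∑ zᵢ ∧ wᵢ`. -/
theorem toForm_Omega [Module.Finite ℝ T] (hn : finrank ℝ T = 4 * n) :
    toForm (fun X Y => -((g X (J Y) : ℂ) - Complex.I * (g X (K Y) : ℂ))) =
      -∑ i ∈ Finset.range n, ι ℂ (coord10 I J K g e (2 * i)) *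
        ι ℂ (coord10 I J K g e (2 * i + 1)) := by
  simp only [← toForm_wedge]
  rw [← toForm_sum, ← neg_one_smul ℂ, ← toForm_smul]
  congr 1
  funext X Y
  rw [h.apply_eq_sum he hn X (J Y), h.apply_eq_sum he hn X (K Y)]
  push_cast
  rw [Finset.mul_sum, ← Finset.sum_sub_distrib, neg_one_mul]
  congr 1
  refine Finset.sum_congr rfl fun i _ => ?_
  rw [coord10_even, coord10_odd, coord10_even, coord10_odd, h.IJ, h.JJ, h.KJ, h.IK, h.JK, h.KK]
  simp only [map_neg, Complex.ofReal_neg]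
  ring_nf
  rw [Complex.I_sq]
  ring

/-- By the normal form, the power is (-1)ⁿ n! times `volForm b ![1, 0]`. -/
theorem Omega_pow_ne_zero [Module.Finite ℝ T] (hn : finrank ℝ T = 4 * n) :
    toForm (fun X Y => -((g X (J Y) : ℂ) - Complex.I * (g X (K Y) : ℂ))) ^ n ≠ 0 := by
  obtain ⟨b, hb, hbc⟩ := h.exists_isAdapted he hn
  rw [h.toForm_Omega he hn, neg_pow, (sum_ι_mul_ι_pow _ n).1]
  have hv : volForm b ![1, 0] = ιMulti ℂ (2 * n) (fun i => coord10 I J K g e i) := by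
    rw [volForm]
    congr 1
    funext a
    simp [tens, hbc]
  rw [← hv, mul_smul_comm]
  have h1 : (-1 : Forms T) ^ n * volForm b ![1, 0] ≠ 0 := by
    rcases neg_one_pow_eq_or (Forms T) n with h0 | h0 <;> rw [h0] <;>
      simpa using volForm_ne_zero b
  rw [← Nat.cast_smul_eq_nsmul ℂ]
  exact smul_ne_zero (by exact_mod_cast n.factorial_ne_zero) h1

end IsQuatHermitian

end Metric

end Hypercomplex
end

noncomputable section
namespace Hypercomplex

open ExteriorAlgebra Module

/-! ### The equivalence of the two equations on one tangent space -/

section PointwiseEquivalence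

variable {T : Type*} [AddCommGroup T] [Module ℝ T] {I J K : T →ₗ[ℝ] T}
  {g : T →ₗ[ℝ] T →ₗ[ℝ] ℝ}

/-- The complex bilinear form `(X, Y) ↦ g(X, Y∘I)`. -/
def fundamentalBilin (I : T →ₗ[ℝ] T) (g : T →ₗ[ℝ] T →ₗ[ℝ] ℝ) : T →ₗ[ℝ] T →ₗ[ℝ] ℂ :=
  (g.compl₂ I).compr₂ (Algebra.linearMap ℝ ℂ)

theorem IsAdapted.pow_mul_plusProj_iff {n : ℕ} {b : Basis (Fin 2 × Fin (2 * n)) ℂ (Covector T)}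
    (hb : IsAdapted I J K b) {σ η Ω Θ : Forms T} (hσ : σ ∈ ⋀[ℂ]^2 (Covector T))
    (hη : η ∈ ⋀[ℂ]^2 (Covector T)) (hσD : ∀ y, formMat b !![1, 0; 0, y] σ = y • σ)
    (hηD : ∀ y, formMat b !![1, 0; 0, y] η = y • η)
    (hσG : formMat b !![1, 1; 0, 0] σ = -Complex.I • Ω)
    (hηG : formMat b !![1, 1; 0, 0] η = -Complex.I • Θ) (hΩ : Ω ^ n ≠ 0) (c : ℂ) :
    Θ ^ n = c • Ω ^ n ↔
      η ^ n * plusProj I J K (2 * n) (σ ^ n) = c • (σ ^ n * plusProj I J K (2 * n) (σ ^ n)) := by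
  have hw1 : HasWeight b n (σ ^ n) := fun y => by rw [map_pow, hσD, smul_pow]
  have hw2 : HasWeight b n (η ^ n) := fun y => by rw [map_pow, hηD, smul_pow]
  have hI : (-Complex.I) ^ n ≠ 0 := pow_ne_zero _ (neg_ne_zero.2 Complex.I_ne_zero)
  have hne : formMat b !![1, 1; 0, 0] (σ ^ n) ≠ 0 := by
    rw [map_pow, hσG, smul_pow]
    exact smul_ne_zero hI hΩ
  rw [mul_plus_eq_iff b (pow_mem_exteriorPower hσ n) (pow_mem_exteriorPower hη n) hw1 hw2 hne
    (fun ζ hζ hl => hb.plusProj_eq hζ hl) c, map_pow, map_pow, hσG, hηG, smul_pow, smul_pow,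
    smul_comm c, (smul_right_injective (Forms T) hI).eq_iff]

variable [Module.Finite ℝ T]

theorem IsQuatHermitian.formMat_top_omega (h : IsQuatHermitian I J K g) {p : ℕ}
    {b : Basis (Fin 2 × Fin p) ℂ (Covector T)} (hb : IsAdapted I J K b) :
    formMat b !![1, 1; 0, 0] (toForm fun X Y => (g X (I Y) : ℂ)) = -Complex.I •
      toForm (fun X Y => -((g X (J Y) : ℂ) - Complex.I * (g X (K Y) : ℂ))) := by
  have hinv : ∀ X Y, fundamentalBilin I g (I X) (I Y) = fundamentalBilin I g X Y := fun X Y => by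
    simp [fundamentalBilin, h.gI]
  have := hb.formMat_top_toForm _ hinv h.II
  refine this.trans ?_
  rw [← toForm_smul]
  congr 1
  funext X Y
  simp [fundamentalBilin, h.gJ_left, h.gK_left, h.JI, h.IJ, h.KI, h.IK]
  linear_combination (-(g X (K Y) : ℂ)) * Complex.I_mul_I

/-- The theorem on one tangent space, with B for ∂∂̄φ and C for ∂∂_Jφ. Hypothesis `hC` says that C
is the image of B under G; it is all that remains to be proved by calculus. -/
theorem IsQuatHermitian.pow_eq_iff (h : IsQuatHermitian I J K g) {n : ℕ}
    (hn : finrank ℝ T = 4 * n) (B : T →ₗ[ℝ] T →ₗ[ℝ] ℂ) (hB : ∀ X Y, B (I X) (I Y) = B X Y)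
    (C : T → T → ℂ) (hC : ∀ X Y, C X Y =
      -(1 / 2 : ℂ) * (B (J X) Y + B X (J Y) - Complex.I * (B (K X) Y + B X (K Y)))) (c : ℂ) :
    (toForm (fun X Y => -((g X (J Y) : ℂ) - Complex.I * (g X (K Y) : ℂ))) + toForm C) ^ n =
        c • toForm (fun X Y => -((g X (J Y) : ℂ) - Complex.I * (g X (K Y) : ℂ))) ^ n ↔
      (toForm (fun X Y => (g X (I Y) : ℂ)) - Complex.I • toForm (fun X Y => B X Y)) ^ n *
          plusProj I J K (2 * n) (toForm (fun X Y => (g X (I Y) : ℂ)) ^ n) =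
        c • (toForm (fun X Y => (g X (I Y) : ℂ)) ^ n *
          plusProj I J K (2 * n) (toForm (fun X Y => (g X (I Y) : ℂ)) ^ n)) := by
  obtain ⟨e, he⟩ := h.exists_quatOrthonormal hn n le_rfl
  obtain ⟨b, hb, -⟩ := h.exists_isAdapted he hn
  have hinv : ∀ X Y, fundamentalBilin I g (I X) (I Y) = fundamentalBilin I g X Y := fun X Y => by
    simp [fundamentalBilin, h.gI]
  have hB1 := hb.formMat_top_toForm _ hB h.II
  rw [← funext fun X => funext fun Y => hC X Y] at hB1
  refine hb.pow_mul_plusProj_iff (toForm_mem _)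
    (sub_mem (toForm_mem _) (Submodule.smul_mem _ _ (toForm_mem _)))
    (fun y => hb.formMat_diag_toForm y _ hinv h.II) (fun y => ?_) (h.formMat_top_omega hb) ?_
    (h.Omega_pow_ne_zero he hn) c
  · have h1 := hb.formMat_diag_toForm y _ hinv h.II
    have h2 := hb.formMat_diag_toForm y _ hB h.II
    rw [map_sub, map_smul, h2, smul_sub, smul_comm y]
    exact congrArg₂ _ h1 rfl
  · rw [map_sub, map_smul, h.formMat_top_omega hb, hB1]
    module

end PointwiseEquivalence

end Hypercomplex
end

noncomputable section
namespace Hypercomplex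

open ExteriorAlgebra Module

/-! ### The second derivatives of a function along a hypercomplex structure -/

section FirstOrder

variable {V : Type*} [AddCommGroup V] [Module ℝ V]

/-- The value at a point of the Nijenhuis tensor of a field `L` of endomorphisms of `V`, whose
derivative at that point is `D`, on two constant vector fields. -/
def nijenhuisConst (L : V →ₗ[ℝ] V) (D : V →ₗ[ℝ] V →ₗ[ℝ] V) (X Y : V) : V :=
  D (L X) Y - D (L Y) X + L (D Y X) - L (D X Y)

/-- A relation between the antisymmetrized derivatives of the three complex structures of a
hypercomplex structure on an open subset of `V`. -/
theorem antisymm_deriv_relation {I J K : V →ₗ[ℝ] V} {a b c : V →ₗ[ℝ] V →ₗ[ℝ] V}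
    (II : ∀ X, I (I X) = -X) (JJ : ∀ X, J (J X) = -X) (JI : ∀ X, J (I X) = K X)
    (IJ : ∀ X, I (J X) = -K X) (ha : ∀ X Y, a X (I Y) = -I (a X Y))
    (hb : ∀ X Y, b X (J Y) = -J (b X Y)) (hc : ∀ X Y, c X Y = b X (I Y) + J (a X Y))
    (hc' : ∀ X Y, c X Y = -(a X (J Y) + I (b X Y))) (hNI : ∀ X Y, nijenhuisConst I a X Y = 0)
    (hNJ : ∀ X Y, nijenhuisConst J b X Y = 0) (X Y : V) :
    (b X Y - b Y X) - (b (I X) (I Y) - b (I Y) (I X)) - (c (I X) Y - c Y (I X)) -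
        (c X (I Y) - c (I Y) X) =
      (a (K X) Y - a Y (K X)) + (a (J X) (I Y) - a (I Y) (J X)) + (a X (K Y) - a (K Y) X) +
        (a (I X) (J Y) - a (J Y) (I X)) := by
  have IJ' : ∀ X, I (J X) = -J (I X) := fun X => by rw [IJ, JI]
  -- Equating the two product-rule formulas for the derivative of K eliminates a X (J Y).
  have haJ : ∀ X Y, a X (J Y) = -(b X (I Y) + J (a X Y) + I (b X Y)) := fun X Y => by
    have := hc X Y
    rw [hc'] at this
    linear_combination (norm := module) -this
  -- With c and K eliminated and I, J moved outside a and b, the relation is a combination of these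
  -- five Nijenhuis identities, four for J and one for I.
  have h1 := hNJ X (J Y)
  have h2 := congrArg J (hNI (J X) (J Y))
  have h3 := hNJ (I X) (K Y)
  have h4 := congrArg I (hNJ X (K Y))
  have h5 := congrArg I (hNJ (I X) (J Y))
  simp only [nijenhuisConst, ← JI, map_add, map_sub, map_neg, map_zero, hc, haJ, ha, hb, II, JJ,
    IJ', LinearMap.neg_apply, neg_neg] at h1 h2 h3 h4 h5 ⊢
  linear_combination (norm := module) -h1 + h2 + h3 - h4 - h5

/-- The differential of the 1-form `dφ ∘ L`, where `h` and `H` are the first and second derivatives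
of `φ` and `D` is the derivative of `L`. -/
def twistedHessian (H : V →ₗ[ℝ] V →ₗ[ℝ] ℝ) (h : V →ₗ[ℝ] ℝ) (L : V →ₗ[ℝ] V)
    (D : V →ₗ[ℝ] V →ₗ[ℝ] V) : V →ₗ[ℝ] V →ₗ[ℝ] ℝ :=
  H.compl₂ L - (H.compl₂ L).flip + (D - D.flip).compr₂ h

theorem twistedHessian_apply (H : V →ₗ[ℝ] V →ₗ[ℝ] ℝ) (h : V →ₗ[ℝ] ℝ) (L : V →ₗ[ℝ] V)
    (D : V →ₗ[ℝ] V →ₗ[ℝ] V) (X Y : V) :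
    twistedHessian H h L D X Y = H X (L Y) - H Y (L X) + h (D X Y - D Y X) := rfl

/-- The first-order terms are h applied to `antisymm_deriv_relation`; the second-order terms cancel
by symmetry of H. -/
theorem twistedHessian_relation {I J K : V →ₗ[ℝ] V} {a b c : V →ₗ[ℝ] V →ₗ[ℝ] V}
    (II : ∀ X, I (I X) = -X) (JJ : ∀ X, J (J X) = -X) (JI : ∀ X, J (I X) = K X)
    (IJ : ∀ X, I (J X) = -K X) (ha : ∀ X Y, a X (I Y) = -I (a X Y))
    (hb : ∀ X Y, b X (J Y) = -J (b X Y)) (hc : ∀ X Y, c X Y = b X (I Y) + J (a X Y))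
    (hc' : ∀ X Y, c X Y = -(a X (J Y) + I (b X Y))) (hNI : ∀ X Y, nijenhuisConst I a X Y = 0)
    (hNJ : ∀ X Y, nijenhuisConst J b X Y = 0) {H : V →ₗ[ℝ] V →ₗ[ℝ] ℝ}
    (hH : ∀ X Y, H X Y = H Y X) (h : V →ₗ[ℝ] ℝ) (X Y : V) :
    twistedHessian H h J b X Y - twistedHessian H h J b (I X) (I Y) -
        twistedHessian H h K c (I X) Y - twistedHessian H h K c X (I Y) =
      twistedHessian H h I a (K X) Y + twistedHessian H h I a (J X) (I Y) +
        twistedHessian H h I a X (K Y) + twistedHessian H h I a (I X) (J Y) := by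
  have key := congrArg h (antisymm_deriv_relation II JJ JI IJ ha hb hc hc' hNI hNJ X Y)
  have IJ' : ∀ X, I (J X) = -J (I X) := fun X => by rw [IJ, JI]
  simp only [twistedHessian_apply]
  simp only [map_add, map_sub, ← JI, IJ', II, map_neg] at key ⊢
  linear_combination key + hH X (J Y) + hH (J X) Y + hH (I Y) (J (I X)) + hH (J (I Y)) (I X)

/-- The two complex Hessians of a function with respect to a hypercomplex structure. -/
theorem part20_eq_of_relation {I J K : V →ₗ[ℝ] V} (II : ∀ X, I (I X) = -X)
    (JI : ∀ X, J (I X) = K X) (IJ : ∀ X, I (J X) = -K X) {bI bJ bK : V →ₗ[ℝ] V →ₗ[ℝ] ℝ}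
    (hR : ∀ X Y, bJ X Y - bJ (I X) (I Y) - bK (I X) Y - bK X (I Y) =
      bI (K X) Y + bI (J X) (I Y) + bI X (K Y) + bI (I X) (J Y)) {B D : V → V → ℂ}
    (hB : ∀ X Y, B X Y = Complex.I / 4 * (bI X Y + bI (I X) (I Y)))
    (hD : ∀ X Y, D X Y = -(1 / 2 : ℂ) * (bJ X Y - Complex.I * bK X Y)) (X Y : V) :
    part20 I D X Y =
      -(1 / 2 : ℂ) * (B (J X) Y + B X (J Y) - Complex.I * (B (K X) Y + B X (K Y))) := by
  -- The three bilinear forms being real, the relation at (X, Y) gives the real part of the claim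
  -- and the one at (I X, Y) the imaginary part.
  have h1 := congrArg (fun r : ℝ => (r : ℂ)) (hR X Y)
  have h2 := congrArg (fun r : ℝ => (r : ℂ)) (hR (I X) Y)
  have IJ' : ∀ X, I (J X) = -J (I X) := fun X => by rw [IJ, JI]
  simp only [part20, hB, hD, ← JI, IJ', II, map_neg, LinearMap.neg_apply] at h1 h2 ⊢
  push_cast at h1 h2 ⊢
  linear_combination (-1 / 8 : ℂ) * h1 + Complex.I / 8 * h2 +
    (-1 / 8 : ℂ) * (bK (I X) Y + bK X (I Y) + bI (J (I X)) Y + bI (J X) (I Y) + bI X (J (I Y)) +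
      bI (I X) (J Y)) * Complex.I_mul_I

end FirstOrder

end Hypercomplex
end

noncomputable section
namespace Hypercomplex

open ExteriorAlgebra Module

/-! ### Tensor fields in the preferred chart at a point -/

section Chart

open Filter Topology VectorField

variable {E : Type*} [NormedAddCommGroup E] [NormedSpace ℝ E]
  {M : Type*} [TopologicalSpace M] [ChartedSpace E M]

/-- The derivative of the preferred chart at `x`, as a function of the coordinates. -/
def chartFwd (x : M) (y : E) : E →L[ℝ] E :=
  mfderiv 𝓘(ℝ, E) 𝓘(ℝ, E) (extChartAt 𝓘(ℝ, E) x) ((extChartAt 𝓘(ℝ, E) x).symm y)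

/-- The derivative of the inverse of the preferred chart at `x`. -/
def chartBwd (x : M) (y : E) : E →L[ℝ] E :=
  mfderiv 𝓘(ℝ, E) 𝓘(ℝ, E) (extChartAt 𝓘(ℝ, E) x).symm y

/-- The value of a field of endomorphisms as an endomorphism of the model space. -/
def endVal (L : EndField E M) (p : M) : E →L[ℝ] E := L p

/-- The expression of a field of endomorphisms in the preferred chart at `x`. -/
def chartEnd (L : EndField E M) (x : M) (y : E) : E →L[ℝ] E :=
  chartFwd x y ∘L endVal L ((extChartAt 𝓘(ℝ, E) x).symm y) ∘L chartBwd x y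

theorem chartEnd_apply (L : EndField E M) (x : M) (y v : E) :
    chartEnd L x y v =
      chartFwd x y (endVal L ((extChartAt 𝓘(ℝ, E) x).symm y) (chartBwd x y v)) := rfl

/-- The derivative at `x` of the expression of a field of endomorphisms in the preferred chart. -/
def chartEndDeriv (L : EndField E M) (x : M) : E →ₗ[ℝ] E →ₗ[ℝ] E :=
  ContinuousLinearMap.coeLM ℝ ∘ₗ (fderiv ℝ (chartEnd L x) (extChartAt 𝓘(ℝ, E) x x)).toLinearMap

theorem chartEndDeriv_apply (L : EndField E M) (x : M) (v w : E) :
    chartEndDeriv L x v w = fderiv ℝ (chartEnd L x) (extChartAt 𝓘(ℝ, E) x x) v w := rfl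

variable [IsManifold 𝓘(ℝ, E) ∞ M]

theorem chartBwd_chartFwd {x : M} {y : E} (hy : y ∈ (extChartAt 𝓘(ℝ, E) x).target) (v : E) :
    chartBwd x y (chartFwd x y v) = v := by
  have h := mfderivWithin_extChartAt_symm_comp_mfderiv_extChartAt (I := 𝓘(ℝ, E)) hy
  rw [ModelWithCorners.range_eq_univ, mfderivWithin_univ] at h
  exact congrArg (fun F : E →L[ℝ] E => F v) h

theorem chartFwd_chartBwd {x : M} {y : E} (hy : y ∈ (extChartAt 𝓘(ℝ, E) x).target) (v : E) :
    chartFwd x y (chartBwd x y v) = v := by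
  have h := mfderiv_extChartAt_comp_mfderivWithin_extChartAt_symm (I := 𝓘(ℝ, E)) hy
  rw [ModelWithCorners.range_eq_univ, mfderivWithin_univ] at h
  exact congrArg (fun F : E →L[ℝ] E => F v) h

/-- The tangent space at x is the model space as seen through the preferred chart at x, so formulas
at x can be read in coordinates without transport. -/
theorem chartFwd_self (x : M) (v : E) : chartFwd x (extChartAt 𝓘(ℝ, E) x x) v = v := by
  have h : chartFwd x (extChartAt 𝓘(ℝ, E) x x) = tangentCoordChange 𝓘(ℝ, E) x x x := by
    rw [← mfderiv_chartAt_eq_tangentCoordChange (mem_chart_source E x), chartFwd,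
      extChartAt_to_inv]
    rfl
  rw [h]
  exact tangentCoordChange_self (I := 𝓘(ℝ, E)) (v := v) (mem_extChartAt_source x)

theorem chartBwd_self (x : M) (v : E) : chartBwd x (extChartAt 𝓘(ℝ, E) x x) v = v := by
  rw [← chartFwd_self x (chartBwd x _ v),
    chartFwd_chartBwd (mem_extChartAt_target (I := 𝓘(ℝ, E)) x)]

theorem chartEnd_self (L : EndField E M) (x : M) (v : E) :
    chartEnd L x (extChartAt 𝓘(ℝ, E) x x) v = endVal L x v := by
  rw [chartEnd_apply, chartFwd_self, chartBwd_self, extChartAt_to_inv]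

theorem chartEnd_chartEnd {L L' : EndField E M} {x : M} {y : E}
    (hy : y ∈ (extChartAt 𝓘(ℝ, E) x).target) (v : E) :
    chartEnd L x y (chartEnd L' x y v) = chartEnd (fun p => L p ∘L L' p) x y v := by
  simp only [chartEnd_apply, chartBwd_chartFwd hy]
  rfl

theorem differentiableAt_chartEnd {L : EndField E M}
    (hL : ContMDiff 𝓘(ℝ, E) (𝓘(ℝ, E).prod 𝓘(ℝ, E →L[ℝ] E)) ∞
    (fun x => Bundle.TotalSpace.mk' (E →L[ℝ] E)
      (E := fun x : M => TangentSpace 𝓘(ℝ, E) x →L[ℝ] TangentSpace 𝓘(ℝ, E) x) x (L x))) (x : M) :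
    DifferentiableAt ℝ (chartEnd L x) (extChartAt 𝓘(ℝ, E) x x) := by
  have h := ((contMDiffAt_hom_bundle _).1 (hL x)).2
  have h2 : ContMDiffAt 𝓘(ℝ, E) 𝓘(ℝ, E →L[ℝ] E) ∞
      (fun p => chartEnd L x (extChartAt 𝓘(ℝ, E) x p)) x := by
    refine h.congr_of_eventuallyEq ?_
    filter_upwards [extChartAt_source_mem_nhds (I := 𝓘(ℝ, E)) x] with p hp
    have hp' : p ∈ (chartAt E x).source := by simpa using hp
    have := inTangentCoordinates_eq_mfderiv_comp (I := 𝓘(ℝ, E)) (I' := 𝓘(ℝ, E)) (f := fun p : M => p)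
      (g := fun p : M => p) (ϕ := L) (x₀ := x) (x := p) hp' hp'
    rw [ModelWithCorners.range_eq_univ, mfderivWithin_univ] at this
    refine Eq.trans ?_ this.symm
    rw [chartEnd, chartFwd, PartialEquiv.left_inv _ hp]
    rfl
  have h3 : MDifferentiableAt 𝓘(ℝ, E) 𝓘(ℝ, E) (extChartAt 𝓘(ℝ, E) x).symm
      (extChartAt 𝓘(ℝ, E) x x) := by
    have := mdifferentiableWithinAt_extChartAt_symm (I := 𝓘(ℝ, E)) (mem_extChartAt_target x)
    rwa [ModelWithCorners.range_eq_univ, mdifferentiableWithinAt_univ] at this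
  have h4 : MDifferentiableAt 𝓘(ℝ, E) 𝓘(ℝ, E →L[ℝ] E)
      ((fun p => chartEnd L x (extChartAt 𝓘(ℝ, E) x p)) ∘ (extChartAt 𝓘(ℝ, E) x).symm)
      (extChartAt 𝓘(ℝ, E) x x) :=
    MDifferentiableAt.comp (I' := 𝓘(ℝ, E)) _
      (by rw [extChartAt_to_inv]; exact h2.mdifferentiableAt (by simp)) h3
  refine h4.differentiableAt.congr_of_eventuallyEq ?_
  filter_upwards [extChartAt_target_mem_nhds (I := 𝓘(ℝ, E)) x] with y hy
  simp only [Function.comp_apply]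
  rw [PartialEquiv.right_inv _ hy]

/-- The vector field with constant components `v` in the preferred chart at `x`. -/
def chartField (x : M) (v : E) (p : M) : TangentSpace 𝓘(ℝ, E) p :=
  chartBwd x (extChartAt 𝓘(ℝ, E) x p) v

theorem contMDiffAt_chartField (x : M) (v : E) :
    ContMDiffAt 𝓘(ℝ, E) 𝓘(ℝ, E).tangent ∞
      (fun p => (chartField x v p : TangentBundle 𝓘(ℝ, E) M)) x := by
  rw [Bundle.contMDiffAt_section]
  refine (contMDiffAt_const (c := v)).congr_of_eventuallyEq ?_
  filter_upwards [extChartAt_source_mem_nhds (I := 𝓘(ℝ, E)) x] with p hp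
  have hp' : p ∈ (chartAt E x).source := by simpa using hp
  have h := TangentBundle.continuousLinearMapAt_trivializationAt (I := 𝓘(ℝ, E)) hp'
  have hb : p ∈ (trivializationAt E (TangentSpace 𝓘(ℝ, E)) x).baseSet := by simpa using hp'
  have h2 := chartFwd_chartBwd (PartialEquiv.map_source _ hp) v
  rw [chartFwd, PartialEquiv.left_inv _ hp, ← h] at h2
  exact (congrFun (Bundle.Trivialization.coe_linearMapAt_of_mem (R := ℝ) _ hb)
    (chartField x v p)).symm.trans h2

theorem mlieBracket_eq_of_chart {x : M} {V W : ∀ p : M, TangentSpace 𝓘(ℝ, E) p} {V' W' : E → E}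
    (hV : ∀ y ∈ (extChartAt 𝓘(ℝ, E) x).target,
      V ((extChartAt 𝓘(ℝ, E) x).symm y) = chartBwd x y (V' y))
    (hW : ∀ y ∈ (extChartAt 𝓘(ℝ, E) x).target,
      W ((extChartAt 𝓘(ℝ, E) x).symm y) = chartBwd x y (W' y)) :
    mlieBracket 𝓘(ℝ, E) V W x = lieBracket ℝ V' W' (extChartAt 𝓘(ℝ, E) x x) := by
  have key : ∀ {U : ∀ p : M, TangentSpace 𝓘(ℝ, E) p} {U' : E → E},
      (∀ y ∈ (extChartAt 𝓘(ℝ, E) x).target,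
        U ((extChartAt 𝓘(ℝ, E) x).symm y) = chartBwd x y (U' y)) →
      ∀ y ∈ (extChartAt 𝓘(ℝ, E) x).target, (mpullbackWithin 𝓘(ℝ, E) 𝓘(ℝ, E)
        (extChartAt 𝓘(ℝ, E) x).symm U Set.univ y : E) = U' y := by
    intro U U' hU y hy
    rw [mpullbackWithin_apply, mfderivWithin_univ, hU y hy]
    have h : (chartBwd x y).inverse = chartFwd x y :=
      ContinuousLinearMap.inverse_eq (ContinuousLinearMap.ext (chartBwd_chartFwd hy))
        (ContinuousLinearMap.ext (chartFwd_chartBwd hy))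
    exact (congrArg (fun F : E →L[ℝ] E => F (chartBwd x y (U' y))) h).trans
      (chartFwd_chartBwd hy _)
  have ht := extChartAt_target_mem_nhds (I := 𝓘(ℝ, E)) x
  have hid : chartFwd x (extChartAt 𝓘(ℝ, E) x x) = ContinuousLinearMap.id ℝ E :=
    ContinuousLinearMap.ext (chartFwd_self x)
  rw [chartFwd, extChartAt_to_inv] at hid
  rw [mlieBracket, mlieBracketWithin_apply, ModelWithCorners.range_eq_univ, Set.preimage_univ,
    Set.univ_inter]
  refine (congrArg (fun F : E →L[ℝ] E => F.inverse _) hid).trans ?_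
  rw [ContinuousLinearMap.inverse_id]
  have hl : ∀ {V₁ W₁ : E → E}, (∀ y ∈ (extChartAt 𝓘(ℝ, E) x).target, V₁ y = V' y) →
      (∀ y ∈ (extChartAt 𝓘(ℝ, E) x).target, W₁ y = W' y) →
      lieBracketWithin ℝ V₁ W₁ Set.univ (extChartAt 𝓘(ℝ, E) x x) =
        lieBracket ℝ V' W' (extChartAt 𝓘(ℝ, E) x x) := fun h₁ h₂ => by
    rw [lieBracketWithin_univ]
    exact Filter.EventuallyEq.lieBracket_vectorField_eq
      (Filter.eventuallyEq_of_mem ht h₁) (Filter.eventuallyEq_of_mem ht h₂)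
  exact hl (key hV) (key hW)

/-- Integrability is tested on fields constant in the chart. Their bracket vanishes, and the other
brackets reduce to derivatives of L. -/
theorem nijenhuisConst_chartEndDeriv {L : EndField E M} (hL : IsComplexStructure L) (x : M)
    (v w : E) : nijenhuisConst (endVal L x).toLinearMap (chartEndDeriv L x) v w = 0 := by
  have h0 := hL.integrable (chartField x v) (chartField x w) x (contMDiffAt_chartField x v)
    (contMDiffAt_chartField x w)
  have hd := differentiableAt_chartEnd hL.smooth x
  have hf : ∀ (v : E), ∀ y ∈ (extChartAt 𝓘(ℝ, E) x).target,
      chartField x v ((extChartAt 𝓘(ℝ, E) x).symm y) = chartBwd x y v := fun v y hy => by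
    rw [chartField, PartialEquiv.right_inv _ hy]
  have hLf : ∀ (v : E), ∀ y ∈ (extChartAt 𝓘(ℝ, E) x).target,
      L _ (chartField x v ((extChartAt 𝓘(ℝ, E) x).symm y)) =
        chartBwd x y (chartEnd L x y v) := fun v y hy => by
    rw [hf v y hy, chartEnd_apply, chartBwd_chartFwd hy]
    rfl
  have hfd : ∀ v w, fderiv ℝ (fun y => chartEnd L x y v) (extChartAt 𝓘(ℝ, E) x x) w =
      fderiv ℝ (chartEnd L x) (extChartAt 𝓘(ℝ, E) x x) w v := fun v w => by
    rw [fderiv_clm_apply hd (differentiableAt_const v)]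
    simp
  rw [nijenhuis, mlieBracket_eq_of_chart (hLf v) (hLf w), mlieBracket_eq_of_chart (hLf v) (hf w),
    mlieBracket_eq_of_chart (hf v) (hLf w), mlieBracket_eq_of_chart (hf v) (hf w)] at h0
  simp only [lieBracket_eq, hfd, chartEnd_self, fderiv_fun_const, Pi.zero_apply,
    zero_apply, sub_zero, zero_sub] at h0
  have aux : ∀ a b c d : E, a - b - (-c) - d - 0 = 0 → a - b + c - d = 0 := fun a b c d h => by
    simpa using h
  refine aux _ _ _ _ (Eq.trans ?_ h0)
  rw [← map_neg]
  rfl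

theorem fderiv_chartEnd_comp {L L' : EndField E M} {x : M} {F : E → E →L[ℝ] E}
    (hL : DifferentiableAt ℝ (chartEnd L x) (extChartAt 𝓘(ℝ, E) x x))
    (hL' : DifferentiableAt ℝ (chartEnd L' x) (extChartAt 𝓘(ℝ, E) x x))
    (hF : ∀ y ∈ (extChartAt 𝓘(ℝ, E) x).target, ∀ v,
      chartEnd L x y (chartEnd L' x y v) = F y v) (v w : E) :
    fderiv ℝ F (extChartAt 𝓘(ℝ, E) x x) v w =
      chartEndDeriv L x v (endVal L' x w) + endVal L x (chartEndDeriv L' x v w) := by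
  have h : F =ᶠ[𝓝 (extChartAt 𝓘(ℝ, E) x x)] fun y => chartEnd L x y ∘L chartEnd L' x y := by
    filter_upwards [extChartAt_target_mem_nhds (I := 𝓘(ℝ, E)) x] with y hy
    ext v
    exact (hF y hy v).symm
  rw [h.fderiv_eq, fderiv_clm_comp hL hL']
  simp only [add_apply, ContinuousLinearMap.comp_apply, ContinuousLinearMap.compL_apply,
    ContinuousLinearMap.flip_apply, chartEnd_self, chartEndDeriv_apply, add_comm]

theorem chartEndDeriv_of_comp {L L' L'' : EndField E M} {x : M}
    (hL : DifferentiableAt ℝ (chartEnd L x) (extChartAt 𝓘(ℝ, E) x x))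
    (hL' : DifferentiableAt ℝ (chartEnd L' x) (extChartAt 𝓘(ℝ, E) x x))
    (h : ∀ p X, L p (L' p X) = L'' p X) (v w : E) :
    chartEndDeriv L'' x v w =
      chartEndDeriv L x v (endVal L' x w) + endVal L x (chartEndDeriv L' x v w) := by
  refine fderiv_chartEnd_comp hL hL' (fun y hy v => ?_) v w
  rw [chartEnd_chartEnd hy]
  congr 2
  funext p
  ext X
  exact h p X

theorem chartEndDeriv_of_comp_neg {L L' L'' : EndField E M} {x : M}
    (hL : DifferentiableAt ℝ (chartEnd L x) (extChartAt 𝓘(ℝ, E) x x))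
    (hL' : DifferentiableAt ℝ (chartEnd L' x) (extChartAt 𝓘(ℝ, E) x x))
    (h : ∀ p X, L p (L' p X) = -L'' p X) (v w : E) :
    chartEndDeriv L'' x v w =
      -(chartEndDeriv L x v (endVal L' x w) + endVal L x (chartEndDeriv L' x v w)) := by
  rw [← fderiv_chartEnd_comp (F := fun y => -chartEnd L'' x y) hL hL' (fun y hy v => ?_) v w]
  · simp [chartEndDeriv_apply]
  · simp only [chartEnd_apply, chartBwd_chartFwd hy, neg_apply]
    exact (congrArg (chartFwd x y) (h _ _)).trans (map_neg (chartFwd x y) _)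

theorem chartEndDeriv_of_comp_self {L : EndField E M} {x : M}
    (hL : DifferentiableAt ℝ (chartEnd L x) (extChartAt 𝓘(ℝ, E) x x))
    (h : ∀ p X, L p (L p X) = -X) (v w : E) :
    chartEndDeriv L x v (endVal L x w) = -endVal L x (chartEndDeriv L x v w) := by
  rw [eq_neg_iff_add_eq_zero,
    ← fderiv_chartEnd_comp (F := fun _ => -ContinuousLinearMap.id ℝ E) hL hL (fun y hy v => ?_) v w]
  · simp
  · simp only [chartEnd_apply, chartBwd_chartFwd hy]
    refine (congrArg (chartFwd x y) (h _ _)).trans ((map_neg (chartFwd x y) _).trans ?_)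
    exact congrArg _ (chartFwd_chartBwd hy v)

theorem chartEnd_id_eventuallyEq (x : M) :
    chartEnd (fun p : M => ContinuousLinearMap.id ℝ (TangentSpace 𝓘(ℝ, E) p)) x
      =ᶠ[𝓝 (extChartAt 𝓘(ℝ, E) x x)] fun _ => ContinuousLinearMap.id ℝ E := by
  filter_upwards [extChartAt_target_mem_nhds (I := 𝓘(ℝ, E)) x] with y hy
  ext v
  exact chartFwd_chartBwd hy v

/-! ### The exterior derivative of a twisted differential -/

/-- A function in the preferred chart at `x`. -/
def chartFun (φ : M → ℝ) (x : M) (y : E) : ℝ := φ ((extChartAt 𝓘(ℝ, E) x).symm y)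

theorem contDiffAt_chartFun {φ : M → ℝ} (hφ : ContMDiff 𝓘(ℝ, E) 𝓘(ℝ, ℝ) ∞ φ) {x : M} {y : E}
    (hy : y ∈ (extChartAt 𝓘(ℝ, E) x).target) : ContDiffAt ℝ ∞ (chartFun φ x) y := by
  have h : ContMDiffAt 𝓘(ℝ, E) 𝓘(ℝ, E) ∞ (extChartAt 𝓘(ℝ, E) x).symm y := by
    have := contMDiffWithinAt_extChartAt_symm_range (I := 𝓘(ℝ, E)) (n := ∞) x hy
    rwa [ModelWithCorners.range_eq_univ, contMDiffWithinAt_univ] at this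
  exact ((hφ _).comp y h).contDiffAt

theorem dFun_eq_of_chart {φ : M → ℝ} (hφ : ContMDiff 𝓘(ℝ, E) 𝓘(ℝ, ℝ) ∞ φ) {x : M} {y : E}
    (hy : y ∈ (extChartAt 𝓘(ℝ, E) x).target)
    (u : E) : (dFun φ ((extChartAt 𝓘(ℝ, E) x).symm y) : E →L[ℝ] ℂ) u =
      ((fderiv ℝ (chartFun φ x) y (chartFwd x y u) : ℝ) : ℂ) := by
  have h : MDifferentiableAt 𝓘(ℝ, E) 𝓘(ℝ, E) (extChartAt 𝓘(ℝ, E) x).symm y := by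
    have := mdifferentiableWithinAt_extChartAt_symm (I := 𝓘(ℝ, E)) hy
    rwa [ModelWithCorners.range_eq_univ, mdifferentiableWithinAt_univ] at this
  have h2 := mfderiv_comp (I' := 𝓘(ℝ, E)) y ((hφ _).mdifferentiableAt (by simp)) h
  have h3 : fderiv ℝ (chartFun φ x) y (chartFwd x y u) =
      (mfderiv 𝓘(ℝ, E) 𝓘(ℝ, ℝ) φ ((extChartAt 𝓘(ℝ, E) x).symm y) : E →L[ℝ] ℝ)
        (chartBwd x y (chartFwd x y u)) := by
    rw [← mfderiv_eq_fderiv]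
    exact congrArg (fun F : E →L[ℝ] ℝ => F (chartFwd x y u)) h2
  rw [h3, chartBwd_chartFwd hy]
  rfl

/-- The Hessian of a function in the preferred chart at `x`. -/
def chartHessian (φ : M → ℝ) (x : M) : E →ₗ[ℝ] E →ₗ[ℝ] ℝ :=
  ContinuousLinearMap.coeLM ℝ ∘ₗ
    (fderiv ℝ (fderiv ℝ (chartFun φ x)) (extChartAt 𝓘(ℝ, E) x x)).toLinearMap

theorem chartHessian_symm {φ : M → ℝ} (hφ : ContMDiff 𝓘(ℝ, E) 𝓘(ℝ, ℝ) ∞ φ) (x : M) (v w : E) :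
    chartHessian φ x v w = chartHessian φ x w v :=
  ((contDiffAt_chartFun hφ (mem_extChartAt_target x)).isSymmSndFDerivAt (by
    rw [minSmoothness_of_isRCLikeNormedField]
    exact ENat.LEInfty.out)) v w

/-- The differential at `x` of the 1-form `dφ ∘ L`, in the preferred chart at `x`. -/
def chartTwisted (φ : M → ℝ) (L : EndField E M) (x : M) : E →ₗ[ℝ] E →ₗ[ℝ] ℝ :=
  twistedHessian (chartHessian φ x)
    (fderiv ℝ (chartFun φ x) (extChartAt 𝓘(ℝ, E) x x)).toLinearMap
    (endVal L x).toLinearMap (chartEndDeriv L x)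

variable [FiniteDimensional ℝ E]

theorem dOne_eq_of_localForm {lam : OneForm E M} {x : M}
    (h : DifferentiableAt ℝ (localForm lam x) (extChartAt 𝓘(ℝ, E) x x)) (v w : E) :
    dOne lam x v w = fderiv ℝ (localForm lam x) (extChartAt 𝓘(ℝ, E) x x) v w -
      fderiv ℝ (localForm lam x) (extChartAt 𝓘(ℝ, E) x x) w v := by
  have e : ∀ u : E,
      (mfderiv 𝓘(ℝ, E) 𝓘(ℝ, E) (extChartAt 𝓘(ℝ, E) x) x : E →L[ℝ] E) u = u := fun u => by
    have := chartFwd_self x u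
    rwa [chartFwd, extChartAt_to_inv] at this
  refine (congrArg₂ (fun a b : E => extDeriv (fun y => ContinuousAlternatingMap.ofSubsingleton
    ℝ E ℂ (0 : Fin 1) (localForm lam x y)) (extChartAt 𝓘(ℝ, E) x x) ![a, b]) (e v) (e w)).trans ?_
  have hd : DifferentiableAt ℝ (fun y => ContinuousAlternatingMap.ofSubsingleton
      ℝ E ℂ (0 : Fin 1) (localForm lam x y)) (extChartAt 𝓘(ℝ, E) x x) :=
    (LinearMap.toContinuousLinearMap
      { toFun := fun l : E →L[ℝ] ℂ => ContinuousAlternatingMap.ofSubsingleton ℝ E ℂ (0 : Fin 1) l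
        map_add' := fun _ _ => rfl
        map_smul' := fun _ _ => rfl }).differentiableAt.comp _ h
  rw [extDeriv_apply hd]
  have hfd : ∀ v w, fderiv ℝ (fun y => localForm lam x y v) (extChartAt 𝓘(ℝ, E) x x) w =
      fderiv ℝ (localForm lam x) (extChartAt 𝓘(ℝ, E) x x) w v := fun v w => by
    rw [fderiv_clm_apply h (differentiableAt_const v)]
    simp
  rw [← hfd, ← hfd]
  simp [Fin.sum_univ_two, Fin.removeNth, sub_eq_add_neg]

/-- Two terms suffice: ∂̄φ combines dφ and dφ ∘ I, and ∂_Jφ combines dφ ∘ J and dφ ∘ K. -/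
theorem dOne_eq_chartTwisted {φ : M → ℝ} (hφ : ContMDiff 𝓘(ℝ, E) 𝓘(ℝ, ℝ) ∞ φ)
    {L L' : EndField E M} {x : M}
    (hL : DifferentiableAt ℝ (chartEnd L x) (extChartAt 𝓘(ℝ, E) x x))
    (hL' : DifferentiableAt ℝ (chartEnd L' x) (extChartAt 𝓘(ℝ, E) x x)) {c c' : ℂ}
    {lam : OneForm E M}
    (hlam : ∀ p X, lam p X = c * dFun φ p (L p X) + c' * dFun φ p (L' p X)) (v w : E) :
    dOne lam x v w = c * chartTwisted φ L x v w + c' * chartTwisted φ L' x v w := by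
  have hφ' := contDiffAt_chartFun hφ (mem_extChartAt_target (I := 𝓘(ℝ, E)) x)
  have hdφ : DifferentiableAt ℝ (fderiv ℝ (chartFun φ x)) (extChartAt 𝓘(ℝ, E) x x) :=
    (hφ'.fderiv_right (m := 1) (by rw [one_add_one_eq_two]; exact ENat.LEInfty.out)).differentiableAt (by simp)
  set F : EndField E M → E → E →L[ℝ] ℂ := fun L y =>
    Complex.ofRealCLM ∘L (fderiv ℝ (chartFun φ x) y ∘L chartEnd L x y) with hF
  have hFd : ∀ {L : EndField E M},
      DifferentiableAt ℝ (chartEnd L x) (extChartAt 𝓘(ℝ, E) x x) →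
      DifferentiableAt ℝ (F L) (extChartAt 𝓘(ℝ, E) x x) := fun hL =>
    (differentiableAt_const _).clm_comp (hdφ.clm_comp hL)
  have hFf : ∀ {L : EndField E M},
      DifferentiableAt ℝ (chartEnd L x) (extChartAt 𝓘(ℝ, E) x x) → ∀ v w,
      fderiv ℝ (F L) (extChartAt 𝓘(ℝ, E) x x) v w =
        ((chartHessian φ x v (endVal L x w) +
          fderiv ℝ (chartFun φ x) (extChartAt 𝓘(ℝ, E) x x) (chartEndDeriv L x v w) : ℝ) : ℂ) := by
    intro L hL v w
    rw [hF, fderiv_clm_comp (differentiableAt_const _) (hdφ.clm_comp hL),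
      fderiv_clm_comp hdφ hL]
    simp only [fderiv_fun_const, Pi.zero_apply, add_apply, ContinuousLinearMap.comp_apply,
      ContinuousLinearMap.compL_apply, ContinuousLinearMap.flip_apply, chartEnd_self,
      chartEndDeriv_apply, zero_apply, map_zero]
    rw [add_zero, add_comm]
    rfl
  have hloc : localForm lam x =ᶠ[𝓝 (extChartAt 𝓘(ℝ, E) x x)]
      fun y => c • F L y + c' • F L' y := by
    filter_upwards [extChartAt_target_mem_nhds (I := 𝓘(ℝ, E)) x] with y hy
    ext u
    have key : ∀ L : EndField E M, (dFun φ ((extChartAt 𝓘(ℝ, E) x).symm y) : E →L[ℝ] ℂ)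
        (endVal L ((extChartAt 𝓘(ℝ, E) x).symm y) (chartBwd x y u)) = F L y u := fun L =>
      dFun_eq_of_chart hφ hy _
    refine (hlam _ _).trans ?_
    exact congrArg₂ (fun a b => c * a + c' * b) (key L) (key L')
  rw [dOne_eq_of_localForm
    ((((hFd hL).const_smul c).add ((hFd hL').const_smul c')).congr_of_eventuallyEq hloc),
    hloc.fderiv_eq, fderiv_fun_add (f := fun y => c • F L y) (g := fun y => c' • F L' y)
      ((hFd hL).const_smul c) ((hFd hL').const_smul c'),
    fderiv_fun_const_smul (hFd hL), fderiv_fun_const_smul (hFd hL')]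
  simp only [add_apply, smul_apply, hFf hL, hFf hL', chartTwisted, twistedHessian_apply,
    smul_eq_mul]
  simp
  ring

end Chart

end Hypercomplex
end

noncomputable section
namespace Hypercomplex

open ExteriorAlgebra Module

/-! ### The complex Hessians of a function on a hypercomplex manifold -/

section Hessians

variable {E : Type*} [NormedAddCommGroup E] [NormedSpace ℝ E]
  {M : Type*} [TopologicalSpace M] [ChartedSpace E M] [IsManifold 𝓘(ℝ, E) ∞ M]
  {S : HypercomplexStructure E M} {φ : M → ℝ}

theorem delbarFun_apply (φ : M → ℝ) (p : M) (X : TangentSpace 𝓘(ℝ, E) p) :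
    delbarFun S.I φ p X = (1 / 2 : ℂ) * dFun φ p X + Complex.I / 2 * dFun φ p (S.I p X) := by
  have : delbarFun S.I φ p X = (1 / 2 : ℂ) * (dFun φ p X + Complex.I * dFun φ p (S.I p X)) := rfl
  rw [this]
  ring

theorem delJFun_apply (φ : M → ℝ) (p : M) (X : TangentSpace 𝓘(ℝ, E) p) :
    S.delJFun φ p X = -(1 / 2 : ℂ) * dFun φ p (S.J p X) + Complex.I / 2 * dFun φ p (S.K p X) := by
  have : S.delJFun φ p X = delbarFun S.I φ p (-S.J p X) := rfl
  rw [this, map_neg, delbarFun_apply, S.mul_JI, map_neg]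
  ring

variable [FiniteDimensional ℝ E]

theorem dOne_zero (x : M) (v w : E) : dOne (fun _ => 0 : OneForm E M) x v w = 0 := by
  have h : localForm (fun _ => 0 : OneForm E M) x = fun _ => 0 :=
    funext fun _ => ContinuousLinearMap.zero_comp _
  refine (dOne_eq_of_localForm (by rw [h]; exact differentiableAt_const _) v w).trans ?_
  rw [h]
  simp

theorem toForm_part_zero (x : M) :
    toForm (part20 (S.I x) (dOne (fun _ => 0 : OneForm E M) x)) = 0 ∧
      toForm (part11 (S.I x) (dOne (fun _ => 0 : OneForm E M) x)) = 0 := by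
  have h : dOne (fun _ => 0 : OneForm E M) x = fun _ _ => 0 :=
    funext fun v => funext fun w => dOne_zero (E := E) x v w
  rw [h]
  constructor <;> simp [toForm, part20, part11]

/-- ∂̄φ has type (0,1), so only one of the two terms of `delOne` survives. -/
theorem deldelbar_eq (φ : M → ℝ) (x : M) :
    S.deldelbar φ x = toForm (part11 (S.I x) (dOne (delbarFun S.I φ) x)) := by
  have h1 : part10 S.I (delbarFun S.I φ) = fun _ => 0 := by
    funext p
    ext X
    have : part10 S.I (delbarFun S.I φ) p X =
      (1 / 2 : ℂ) * (delbarFun S.I φ p X - Complex.I * delbarFun S.I φ p (S.I p X)) := rfl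
    rw [this, delbarFun_apply, delbarFun_apply, S.complexI.sq, map_neg]
    refine Eq.trans ?_ (zero_apply X).symm
    linear_combination (dFun φ p X / 4) * Complex.I_mul_I
  have h2 : part01 S.I (delbarFun S.I φ) = delbarFun S.I φ := by
    funext p
    ext X
    have : part01 S.I (delbarFun S.I φ) p X =
      (1 / 2 : ℂ) * (delbarFun S.I φ p X + Complex.I * delbarFun S.I φ p (S.I p X)) := rfl
    rw [this, delbarFun_apply, delbarFun_apply, S.complexI.sq, map_neg]
    linear_combination (-dFun φ p X / 4) * Complex.I_mul_I
  rw [HypercomplexStructure.deldelbar, delOne, h1, h2, (toForm_part_zero x).1, zero_add]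

/-- J anticommutes with I and so exchanges types; hence ∂_Jφ has type (1,0). -/
theorem deldelJ_eq (φ : M → ℝ) (x : M) :
    S.deldelJ φ x = toForm (part20 (S.I x) (dOne (S.delJFun φ) x)) := by
  have hK : ∀ p X, S.K p (S.I p X) = -S.J p X := fun p X => by
    rw [← S.mul_IJ, S.complexI.sq, map_neg]
  have h1 : part01 S.I (S.delJFun φ) = fun _ => 0 := by
    funext p
    ext X
    have : part01 S.I (S.delJFun φ) p X =
      (1 / 2 : ℂ) * (S.delJFun φ p X + Complex.I * S.delJFun φ p (S.I p X)) := rfl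
    rw [this, delJFun_apply, delJFun_apply, S.mul_IJ, hK, map_neg]
    refine Eq.trans ?_ (zero_apply X).symm
    linear_combination (-dFun φ p (S.J p X) / 4) * Complex.I_mul_I
  have h2 : part10 S.I (S.delJFun φ) = S.delJFun φ := by
    funext p
    ext X
    have : part10 S.I (S.delJFun φ) p X =
      (1 / 2 : ℂ) * (S.delJFun φ p X - Complex.I * S.delJFun φ p (S.I p X)) := rfl
    rw [this, delJFun_apply, delJFun_apply, S.mul_IJ, hK, map_neg]
    linear_combination (dFun φ p (S.J p X) / 4) * Complex.I_mul_I
  rw [HypercomplexStructure.deldelJ, delOne, h1, h2, (toForm_part_zero x).2, add_zero]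

variable (S)

/-- The term in dφ is closed, by symmetry of the Hessian, and only dφ ∘ I contributes. -/
theorem dOne_delbarFun (hφ : ContMDiff 𝓘(ℝ, E) 𝓘(ℝ, ℝ) ∞ φ) (x : M) (v w : E) :
    dOne (delbarFun S.I φ) x v w = Complex.I / 2 * chartTwisted φ S.I x v w := by
  have hid := chartEnd_id_eventuallyEq (E := E) x
  rw [dOne_eq_chartTwisted hφ
    (hid.differentiableAt_iff.2 (differentiableAt_const _))
    (differentiableAt_chartEnd S.complexI.smooth x) (delbarFun_apply φ) v w]
  have h0 : chartTwisted φ (fun p => ContinuousLinearMap.id ℝ (TangentSpace 𝓘(ℝ, E) p)) x v w =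
      0 := by
    have hd : ∀ v w, chartEndDeriv
        (fun p : M => ContinuousLinearMap.id ℝ (TangentSpace 𝓘(ℝ, E) p)) x v w = 0 := fun v w => by
      rw [chartEndDeriv_apply, hid.fderiv_eq]
      simp
    rw [chartTwisted, twistedHessian_apply, hd, hd, sub_zero, map_zero, add_zero, sub_eq_zero]
    exact chartHessian_symm hφ x v w
  rw [h0]
  simp

theorem dOne_delJFun (hφ : ContMDiff 𝓘(ℝ, E) 𝓘(ℝ, ℝ) ∞ φ) (x : M) (v w : E) :
    dOne (S.delJFun φ) x v w =
      -(1 / 2 : ℂ) * (chartTwisted φ S.J x v w - Complex.I * chartTwisted φ S.K x v w) := by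
  rw [dOne_eq_chartTwisted hφ (differentiableAt_chartEnd S.complexJ.smooth x)
    (differentiableAt_chartEnd S.complexK.smooth x) (delJFun_apply φ) v w]
  ring

/-- This is G(∂∂̄φ) = ∂∂_Jφ. The inputs are the derivatives of the quaternion relations in the
chart, the integrability of I and J, and the symmetry of the Hessian. -/
theorem part20_dOne_delJFun (hφ : ContMDiff 𝓘(ℝ, E) 𝓘(ℝ, ℝ) ∞ φ) (x : M) (v w : E) :
    part20 (endVal S.I x) (dOne (S.delJFun φ) x) v w =
      -(1 / 2 : ℂ) * (part11 (endVal S.I x) (dOne (delbarFun S.I φ) x) (endVal S.J x v) w +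
        part11 (endVal S.I x) (dOne (delbarFun S.I φ) x) v (endVal S.J x w) -
        Complex.I * (part11 (endVal S.I x) (dOne (delbarFun S.I φ) x) (endVal S.K x v) w +
          part11 (endVal S.I x) (dOne (delbarFun S.I φ) x) v (endVal S.K x w))) := by
  have hI := differentiableAt_chartEnd S.complexI.smooth x
  have hJ := differentiableAt_chartEnd S.complexJ.smooth x
  have II : ∀ X, (endVal S.I x).toLinearMap ((endVal S.I x).toLinearMap X) = -X :=
    S.complexI.sq x
  have JJ : ∀ X, (endVal S.J x).toLinearMap ((endVal S.J x).toLinearMap X) = -X :=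
    S.complexJ.sq x
  have JI : ∀ X, (endVal S.J x).toLinearMap ((endVal S.I x).toLinearMap X) =
    (endVal S.K x).toLinearMap X := S.mul_IJ x
  have IJ : ∀ X, (endVal S.I x).toLinearMap ((endVal S.J x).toLinearMap X) =
    -(endVal S.K x).toLinearMap X := S.mul_JI x
  refine part20_eq_of_relation (I := (endVal S.I x).toLinearMap)
    (J := (endVal S.J x).toLinearMap) (K := (endVal S.K x).toLinearMap) II JI IJ
    (bI := chartTwisted φ S.I x) (bJ := chartTwisted φ S.J x) (bK := chartTwisted φ S.K x)
    (twistedHessian_relation II JJ JI IJ (chartEndDeriv_of_comp_self hI S.complexI.sq)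
      (chartEndDeriv_of_comp_self hJ S.complexJ.sq) (chartEndDeriv_of_comp hJ hI S.mul_IJ)
      (chartEndDeriv_of_comp_neg hI hJ S.mul_JI) (nijenhuisConst_chartEndDeriv S.complexI x)
      (nijenhuisConst_chartEndDeriv S.complexJ x) (chartHessian_symm hφ x) _)
    (fun X Y => ?_) (dOne_delJFun S hφ x) v w
  refine (show part11 (endVal S.I x) (dOne (delbarFun S.I φ) x) X Y = (1 / 2 : ℂ) *
    (dOne (delbarFun S.I φ) x X Y +
      dOne (delbarFun S.I φ) x (endVal S.I x X) (endVal S.I x Y)) from rfl).trans ?_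
  rw [dOne_delbarFun S hφ, dOne_delbarFun S hφ]
  simp only [ContinuousLinearMap.coe_coe]
  ring

end Hessians

end Hypercomplex
end

noncomputable section
namespace Hypercomplex

open ExteriorAlgebra Module

/-! ### The equivalence of the two equations -/

section Equivalence

variable {E : Type*} [NormedAddCommGroup E] [NormedSpace ℝ E]
  {M : Type*} [TopologicalSpace M] [ChartedSpace E M] [IsManifold 𝓘(ℝ, E) ∞ M]
  (S : HypercomplexStructure E M) {g : RiemMetric E M}

/-- The metric at the point `x` as a bilinear form. -/
def metricAt (g : RiemMetric E M) (x : M) :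
    TangentSpace 𝓘(ℝ, E) x →ₗ[ℝ] TangentSpace 𝓘(ℝ, E) x →ₗ[ℝ] ℝ :=
  ContinuousLinearMap.coeLM ℝ ∘ₗ (g.inner x).toLinearMap

theorem quaternion_norm_eq_one {h : ℍ[ℝ]}
    (hh : h.re ^ 2 + h.imI ^ 2 + h.imJ ^ 2 + h.imK ^ 2 = 1) : ‖h‖ = 1 := by
  rw [← Quaternion.normSq_def', Quaternion.normSq_eq_norm_mul_self] at hh
  nlinarith [norm_nonneg h]

theorem isQuatHermitian_metricAt (hg : S.IsQuaternionicHermitian g) (x : M) :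
    IsQuatHermitian (S.I x).toLinearMap (S.J x).toLinearMap (S.K x).toLinearMap
      (metricAt g x) where
  II := S.complexI.sq x
  JJ := S.complexJ.sq x
  JI := S.mul_IJ x
  IJ := S.mul_JI x
  symm := g.symm x
  pos := g.pos x
  gI X Y := by
    have e : ∀ X, S.act x ⟨0, 1, 0, 0⟩ X = S.I x X := fun X => by
      simp [HypercomplexStructure.act, rightAct]
    have h := hg x ⟨0, 1, 0, 0⟩ (quaternion_norm_eq_one (by norm_num)) X Y
    rw [e, e] at h
    exact h
  gJ X Y := by
    have e : ∀ X, S.act x ⟨0, 0, 1, 0⟩ X = S.J x X := fun X => by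
      simp [HypercomplexStructure.act, rightAct]
    have h := hg x ⟨0, 0, 1, 0⟩ (quaternion_norm_eq_one (by norm_num)) X Y
    rw [e, e] at h
    exact h

/-- The `(1,1)`-form `∂∂̄φ` at `x` as a bilinear form. -/
def deldelbarBilin (φ : M → ℝ) (x : M) :
    TangentSpace 𝓘(ℝ, E) x →ₗ[ℝ] TangentSpace 𝓘(ℝ, E) x →ₗ[ℝ] ℂ :=
  show E →ₗ[ℝ] E →ₗ[ℝ] ℂ from (Complex.I / 4) • ((chartTwisted φ S.I x + (chartTwisted φ S.I x).compl₁₂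
    (endVal S.I x).toLinearMap (endVal S.I x).toLinearMap).compr₂ (Algebra.linearMap ℝ ℂ))

variable [FiniteDimensional ℝ E]

theorem part11_eq_deldelbarBilin {φ : M → ℝ} (hφ : ContMDiff 𝓘(ℝ, E) 𝓘(ℝ, ℝ) ∞ φ) (x : M)
    (v w : E) : part11 (endVal S.I x) (dOne (delbarFun S.I φ) x) v w =
      deldelbarBilin S φ x v w := by
  refine (show part11 (endVal S.I x) (dOne (delbarFun S.I φ) x) v w = (1 / 2 : ℂ) *
    (dOne (delbarFun S.I φ) x v w +
      dOne (delbarFun S.I φ) x (endVal S.I x v) (endVal S.I x w)) from rfl).trans ?_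
  rw [dOne_delbarFun S hφ, dOne_delbarFun S hφ]
  refine Eq.trans ?_ (show Complex.I / 4 * ((chartTwisted φ S.I x v w +
    chartTwisted φ S.I x (endVal S.I x v) (endVal S.I x w) : ℝ) : ℂ) = _ from rfl)
  push_cast
  ring

theorem quaternionicMongeAmpere_iff_complexHessian {n : ℕ} (hE : finrank ℝ E = 4 * n)
    (hg : S.IsQuaternionicHermitian g) (A : ℝ) (f : M → ℝ) {φ : M → ℝ}
    (hφ : ContMDiff 𝓘(ℝ, E) 𝓘(ℝ, ℝ) ∞ φ) (x : M) :
    S.QuaternionicMongeAmpere g n A f φ x ↔ S.ComplexHessian g n A f φ x := by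
  have hB : part11 (S.I x) (dOne (delbarFun S.I φ) x) = fun X Y => deldelbarBilin S φ x X Y :=
    funext fun v => funext fun w => part11_eq_deldelbarBilin S hφ x v w
  have key := (isQuatHermitian_metricAt S hg x).pow_eq_iff (n := n) hE (deldelbarBilin S φ x)
    (fun (X Y : E) => ?_) (part20 (S.I x) (dOne (S.delJFun φ) x)) (fun (X Y : E) => ?_)
    ((A * Real.exp (f x) : ℝ) : ℂ)
  · rw [HypercomplexStructure.QuaternionicMongeAmpere, HypercomplexStructure.ComplexHessian,
      deldelJ_eq, deldelbar_eq, hB]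
    exact key
  · have h : ∀ v, endVal S.I x (endVal S.I x v) = -v := S.complexI.sq x
    refine ((part11_eq_deldelbarBilin S hφ x (endVal S.I x X) (endVal S.I x Y)).symm.trans ?_).trans
      (part11_eq_deldelbarBilin S hφ x X Y)
    refine (show _ = (1 / 2 : ℂ) * (dOne (delbarFun S.I φ) x (endVal S.I x X) (endVal S.I x Y) +
      dOne (delbarFun S.I φ) x (endVal S.I x (endVal S.I x X))
        (endVal S.I x (endVal S.I x Y))) from rfl).trans ?_
    refine Eq.trans ?_ (show (1 / 2 : ℂ) * (dOne (delbarFun S.I φ) x X Y +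
      dOne (delbarFun S.I φ) x (endVal S.I x X) (endVal S.I x Y)) = _ from rfl)
    rw [h, h, dOne_delbarFun S hφ, dOne_delbarFun S hφ, dOne_delbarFun S hφ]
    simp
    ring
  · refine (part20_dOne_delJFun S hφ x X Y).trans ?_
    exact congrArg _ (congrArg₂ _ (congrArg₂ _ (part11_eq_deldelbarBilin S hφ x _ _)
      (part11_eq_deldelbarBilin S hφ x _ _)) (congrArg _ (congrArg₂ _
        (part11_eq_deldelbarBilin S hφ x _ _) (part11_eq_deldelbarBilin S hφ x _ _))))

end Equivalence

end Hypercomplex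
end
theorem mainTheorem9 {n : ℕ}
    {E : Type*} [NormedAddCommGroup E] [NormedSpace ℝ E] [FiniteDimensional ℝ E]
    (hE : Module.finrank ℝ E = 4 * n)
    {M : Type*} [TopologicalSpace M] [ChartedSpace E M] [IsManifold 𝓘(ℝ, E) ∞ M]
    (S : Hypercomplex.HypercomplexStructure E M)
    (g : Hypercomplex.RiemMetric E M) (hg : S.IsQuaternionicHermitian g)
    (A : ℝ) (f φ : M → ℝ)
    (hf : ContMDiff 𝓘(ℝ, E) 𝓘(ℝ, ℝ) ∞ f) (hφ : ContMDiff 𝓘(ℝ, E) 𝓘(ℝ, ℝ) ∞ φ) :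
    (∀ x : M, S.QuaternionicMongeAmpere g n A f φ x ↔ S.ComplexHessian g n A f φ x) ∧
      ((∀ x : M, S.QuaternionicMongeAmpere g n A f φ x) ↔
        (∀ x : M, S.ComplexHessian g n A f φ x)) := by
  have h := Hypercomplex.quaternionicMongeAmpere_iff_complexHessian S hE hg A f hφ
  exact ⟨h, forall_congr' h⟩
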